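/- Proposition 6.6. **Notation.** The letter $p$ denotes primes, $\tau$ the divisor function, $\mu$ the Möbius function. For a natural number $m$ let $$\mathfrak S(m)=\mathbf 1_{m\equiv 4\,(\mathrm{mod}\ 6)}\,\frac{27}{2}\prod_{p\ge 5}\Bigl(1-\frac{6p^2-4p+1}{(p-1)^4}\Bigr)\prod_{\substack{p\ge 5\\ p\mid m(m+4)}}\Bigl(1+\frac1{p-4}\Bigr)\prod_{\substack{p\ge 5\\ p\mid m+2}}\Bigl(1+\frac2{p-4}\Bigr).$$ For $R>1$ and $\xi\in\mathbb R$ let $h_\xi$ be the multiplicative function supported on square-free integers with $h_\xi(p)=\min\{1,\,10(1+|\xi|)\frac{\log p}{\log R}\}$, and let $$H_R(n)=\tau(n)(\log R)\int_{\mathbb R}\frac{h_\xi(n)}{(1+|\xi|)^{10}}\,d\xi .$$ For real $P_1$ and $D_1$ define the normalised lower and upper bound pre-sieves (beta sieves with $\beta=200$ and level $D_1$, sieving the primes $5\le p<P_1$, the primes $2$ and $3$ being handled directly) by $$\omega(n)=\mathbf 1_{(n,6)=1}\prod_{p<P_1}\Bigl(1-\frac1p\Bigr)^{-1}\sum_{d\mid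 n}\lambda^-(d),\qquad \Omega(n)=\mathbf 1_{(n,6)=1}\prod_{p<P_1}\Bigl(1-\frac1p\Bigr)^{-1}\sum_{d\mid n}\lambda^+(d),$$ where $\lambda^{\pm}(d)=\mu(d)\,\mathbf 1_{d\mid\prod_{5\le p<P_1}p}\,\mathbf 1_{d\in\mathcal D^{\pm}}$, and a square-free $d=p_1p_2\cdots p_l$ with $p_1>p_2>\cdots>p_l$ belongs to $\mathcal D^+$ (respectively $\mathcal D^-$) if $p_1p_2\cdots p_k\,p_k^{200}<D_1$ for all odd (respectively all even) $k$ with $1\le k\le l$. **Statement.** Let $m\ge 10$ be an integer, let $\varepsilon>1/\log\log m$, and let $N,R,P_1,D_1$ be real numbers with $N^\varepsilon\le R\le N$, $N^\varepsilon\le P_1\le N$, $P_1^{500}\le D_1\le N^{1/100}$, $m\in[5N/4,7N/4]$ and $m\equiv 4\pmod 6$. Let $f_1,f_2,f_3\in\{\omega,\Omega\}$. Then $$\sum_{N/2<n\le N}H_R(n)\,|f_1(n+2)|\,|f_2(m-n)|\,|f_3(m-n+2)|\ll\varepsilon^{-10}N\,\mathfrak S(m),$$ where the implied constant is absolute. The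 same bound holds if $H_R(n)$ swaps place with any one of the other weights, on $n+2$, $m-n$ or $m-n+2$. -/

import Mathlib

namespace ChenGoldbach

/-- The singular series
`𝔖(m) = 1_{m ≡ 4 (6)} (27/2) ∏_{p ≥ 5} (1 - (6p² - 4p + 1)/(p - 1)⁴)
  ∏_{p ≥ 5, p ∣ m(m+4)} (1 + 1/(p - 4)) ∏_{p ≥ 5, p ∣ m+2} (1 + 2/(p - 4))`.
Here `1 - (6p² - 4p + 1)/(p - 1)⁴ = (1 - 4/p)(1 - 1/p)⁻⁴`. -/
noncomputable def singularSeries (m : ℕ) : ℝ :=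
  if m ≡ 4 [MOD 6] then
    27 / 2
      * (∏' p : {p : ℕ // p.Prime ∧ 5 ≤ p},
          (1 - (6 * (p : ℝ) ^ 2 - 4 * (p : ℝ) + 1) / ((p : ℝ) - 1) ^ 4))
      * (∏ p ∈ (m * (m + 4)).primeFactors with 5 ≤ p, (1 + 1 / ((p : ℝ) - 4)))
      * (∏ p ∈ (m + 2).primeFactors with 5 ≤ p, (1 + 2 / ((p : ℝ) - 4)))
  else 0

/-- The multiplicative function `h_ξ` (depending on `R`), supported on square-free integers, with
`h_ξ(p) = min {1, 10 (1 + |ξ|) log p / log R}` on primes. -/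
noncomputable def hXi (R ξ : ℝ) (n : ℕ) : ℝ :=
  if Squarefree n then
    ∏ p ∈ n.primeFactors, min 1 (10 * (1 + |ξ|) * (Real.log p / Real.log R))
  else 0

/-- `H_R(n) = τ(n) (log R) ∫_ℝ h_ξ(n) / (1 + |ξ|)^10 dξ`. -/
noncomputable def HR (R : ℝ) (n : ℕ) : ℝ :=
  (n.divisors.card : ℝ) * Real.log R * ∫ ξ : ℝ, hXi R ξ n / (1 + |ξ|) ^ 10

/-- The primes `p < P`, for a real number `P`. -/
noncomputable def primesLT (P : ℝ) : Finset ℕ := {p ∈ Finset.range ⌈P⌉₊ | p.Prime}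

/-- `∏_{5 ≤ p < P} p`. -/
noncomputable def sievingProduct (P : ℝ) : ℕ := ∏ p ∈ primesLT P with 5 ≤ p, p

/-- For a square-free `d = p_1 p_2 ⋯ p_l` with `p_1 > p_2 > ⋯ > p_l` and a prime `p = p_k` dividing
`d`, this is the set `{p_1, …, p_k}`, which has `k` elements. -/
def primeFactorsGE (d p : ℕ) : Finset ℕ := {q ∈ d.primeFactors | p ≤ q}

/-- Membership of the square-free `d = p_1 ⋯ p_l`, `p_1 > ⋯ > p_l`, in the truncation set `𝒟⁺` of the
upper bound beta sieve with `β = 200` and level `D`: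
`p_1 ⋯ p_k p_k^β < D` for all odd `k ≤ l`. -/
def BetaPlus (D : ℝ) (d : ℕ) : Prop :=
  ∀ p ∈ d.primeFactors, Odd (primeFactorsGE d p).card →
    (∏ q ∈ primeFactorsGE d p, (q : ℝ)) * (p : ℝ) ^ 200 < D

/-- Membership of the square-free `d = p_1 ⋯ p_l`, `p_1 > ⋯ > p_l`, in the truncation set `𝒟⁻` of the
lower bound beta sieve with `β = 200` and level `D`:
`p_1 ⋯ p_k p_k^β < D` for all even `k ≤ l`. -/
def BetaMinus (D : ℝ) (d : ℕ) : Prop :=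
  ∀ p ∈ d.primeFactors, Even (primeFactorsGE d p).card →
    (∏ q ∈ primeFactorsGE d p, (q : ℝ)) * (p : ℝ) ^ 200 < D

open Classical in
/-- The upper bound beta sieve weights `λ⁺(d)`. -/
noncomputable def lambdaPlus (P D : ℝ) (d : ℕ) : ℝ :=
  if d ∣ sievingProduct P ∧ BetaPlus D d then (ArithmeticFunction.moebius d : ℝ) else 0

open Classical in
/-- The lower bound beta sieve weights `λ⁻(d)`. -/
noncomputable def lambdaMinus (P D : ℝ) (d : ℕ) : ℝ :=
  if d ∣ sievingProduct P ∧ BetaMinus D d then (ArithmeticFunction.moebius d : ℝ) else 0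

/-- The normalised upper bound pre-sieve
`Ω(n) = 1_{(n,6)=1} ∏_{p < P} (1 - 1/p)⁻¹ ∑_{d ∣ n} λ⁺(d)`. -/
noncomputable def upperPreSieve (P D : ℝ) (n : ℕ) : ℝ :=
  if n.Coprime 6 then
    (∏ p ∈ primesLT P, (1 - 1 / (p : ℝ))⁻¹) * ∑ d ∈ n.divisors, lambdaPlus P D d
  else 0

/-- The normalised lower bound pre-sieve
`ω(n) = 1_{(n,6)=1} ∏_{p < P} (1 - 1/p)⁻¹ ∑_{d ∣ n} λ⁻(d)`. -/
noncomputable def lowerPreSieve (P D : ℝ) (n : ℕ) : ℝ :=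
  if n.Coprime 6 then
    (∏ p ∈ primesLT P, (1 - 1 / (p : ℝ))⁻¹) * ∑ d ∈ n.divisors, lambdaMinus P D d
  else 0

/-- The correlation `∑_{N/2 < n ≤ N} g₀(n) g₁(n+2) g₂(m-n) g₃(m-n+2)`. It is only used with
`0 < 5N/4 ≤ m`, so that `n < m` for all `n` in the range of summation. -/
noncomputable def correlation (N : ℝ) (m : ℕ) (g₀ g₁ g₂ g₃ : ℕ → ℝ) : ℝ :=
  ∑ n ∈ Finset.Ioc ⌊N / 2⌋₊ ⌊N⌋₊, g₀ n * g₁ (n + 2) * g₂ (m - n) * g₃ (m - n + 2)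

end ChenGoldbach

namespace ChenGoldbach

open Finset MeasureTheory

/-! The pre-sieves can be negative, so each |f_i| is majorised pointwise before any sum over n is
taken. Buchstab's identity (`sum_admissible_eq`) writes a truncated Möbius sum as the full sifting
product minus signed terms indexed by the sets A of primes at which the beta condition first fails.
Up to sign, such a term is the indicator that every prime of A divides the number and no sifted
prime below min A does; hence the truncated sum is at most a sum of indicators in absolute value
(`abs_betaSum_le`). Since β = 200 and the level is at least P^500, a failing set containing a prime
below P^(1/2^k) has at least 130k elements (`card_ge_of_firstFailure`), so a factor exp(#A - 130k) ≥
1 can be inserted, as in Rankin's trick.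

Fix ξ and let h(p) be the value of h_ξ at p. For the form carrying H_R, τ is at most twice the
number of divisors up to √Y. Multiplying out (`prod_factorAt_le`) bounds the product of the four
weights by a sum over scales k and 4-tuples of sets of primes: divisibility conditions times a
sifting product over the primes below P^(1/2^k). Averaging over n is an upper bound sieve of
dimension at most four (`exists_sieve_le`), and the sum over tuples is dominated by an Euler
product. Together these grow like exp(106k), and the gain exp(-130k) makes the sum over k converge.
The outcome (`exists_sum_prod_factorAt_le`) is N exp(-4S + Δ + 2 ∑ h(p)/p) plus a small error, where
S is the sum of 1/p over 5 ≤ p < P and Δ is the sum of δ(p)/p, with δ(p) bounding the number of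
roots of the four forms that coincide modulo p.

The three normalising products contribute at most a constant times exp(3S), which leaves exp(-S) ≪
1/log P and turns log R into ε⁻¹. Mertens' theorems give exp(2 ∑ h(p)/p) ≪ ε⁻⁴ (1 + |ξ|)^4,
integrable against (1 + |ξ|)^(-10), and exp(Δ) ≪ 𝔖(m) by `exists_le_singularSeries`. This yields
ε⁻⁵, stronger than the required ε⁻¹⁰. -/

lemma mem_primesLT {P : ℝ} {p : ℕ} : p ∈ primesLT P ↔ p.Prime ∧ (p : ℝ) < P := by
  simp [primesLT, Nat.lt_ceil, and_comm]

/-- The primes `5 ≤ p < z`. -/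
noncomputable def sievePrimes (z : ℝ) : Finset ℕ := {p ∈ primesLT z | 5 ≤ p}

lemma mem_sievePrimes {z : ℝ} {p : ℕ} :
    p ∈ sievePrimes z ↔ p.Prime ∧ 5 ≤ p ∧ (p : ℝ) < z := by
  simp only [sievePrimes, mem_filter, mem_primesLT]; tauto

/-! ### Mertens-type estimates for primes below a real number -/

/-- This series is the cost of replacing 1/(p - 1), which comes from Legendre's formula, by 1/p in
Mertens' first theorem. -/
lemma summable_log_div_mul_pred :
    Summable (fun n : ℕ => Real.log n / ((n : ℝ) * ((n : ℝ) - 1))) := by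
  have h : Summable (fun n : ℕ => 4 * (1 / (n : ℝ) ^ (3 / 2 : ℝ))) :=
    (Real.summable_one_div_nat_rpow.mpr (by norm_num)).mul_left 4
  refine h.of_nonneg_of_le (fun n => ?_) (fun n => ?_)
  · rcases Nat.lt_or_ge n 2 with hn | hn
    · interval_cases n <;> simp
    · have : (2 : ℝ) ≤ n := by exact_mod_cast hn
      exact div_nonneg (Real.log_nonneg (by linarith)) (mul_nonneg (by linarith) (by linarith))
  · rcases Nat.lt_or_ge n 2 with hn | hn
    · interval_cases n <;> simp
    · have h2 : (2 : ℝ) ≤ n := by exact_mod_cast hn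
      have hl : Real.log n ≤ 2 * (n : ℝ) ^ (1 / 2 : ℝ) := by
        have := Real.log_le_rpow_div (x := (n : ℝ)) (by linarith) (ε := 1 / 2) (by norm_num)
        linarith
      have hpow : (n : ℝ) ^ (1 / 2 : ℝ) * (n : ℝ) ^ (3 / 2 : ℝ) = (n : ℝ) ^ 2 := by
        rw [← Real.rpow_add (by linarith)]; norm_num
      have hp : 0 < (n : ℝ) ^ (3 / 2 : ℝ) := by positivity
      rw [mul_one_div, div_le_div_iff₀ (by nlinarith) hp]
      calc Real.log n * (n : ℝ) ^ (3 / 2 : ℝ)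
          ≤ 2 * (n : ℝ) ^ (1 / 2 : ℝ) * (n : ℝ) ^ (3 / 2 : ℝ) := by gcongr
        _ = 2 * (n : ℝ) ^ 2 := by rw [mul_assoc, hpow]
        _ ≤ 4 * ((n : ℝ) * ((n : ℝ) - 1)) := by nlinarith

lemma log_factorial_eq_sum (n : ℕ) :
    Real.log (n.factorial : ℝ) =
      ∑ p ∈ n.primesLE, (n.factorial.factorization p : ℝ) * Real.log p := by
  rw [Real.log_nat_eq_sum_factorization]
  refine Finsupp.sum_of_support_subset _ (fun p hp => ?_) _ (by simp)
  have hp' := Nat.prime_of_mem_primeFactors hp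
  have := (hp'.dvd_factorial).1 (Nat.dvd_of_mem_primeFactors hp)
  simp [Nat.primesLE, Nat.primesBelow, hp']; omega

/-- The lower bound keeps only the first term of Legendre's formula; the upper bound is its
digit-sum form, (p - 1) v_p(n!) = n - (digit sum) ≤ n. -/
lemma factorization_factorial_bounds {n p : ℕ} (hp : p.Prime) :
    (n : ℝ) / p - 1 ≤ n.factorial.factorization p ∧
      (n.factorial.factorization p : ℝ) ≤ n / ((p : ℝ) - 1) := by
  constructor
  · have h := Nat.factorization_factorial (n := n) hp (b := Nat.log p n + 2) (by omega)
    have h1 : n / p ≤ n.factorial.factorization p := by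
      rw [h]
      have := Finset.single_le_sum (f := fun i => n / p ^ i) (fun _ _ => Nat.zero_le _)
        (show 1 ∈ Finset.Ico 1 (Nat.log p n + 2) by simp)
      simpa using this
    have h2 : (n : ℝ) / p < (n / p : ℕ) + 1 := by
      rw [div_lt_iff₀ (by exact_mod_cast hp.pos)]
      exact_mod_cast (by
        have := Nat.lt_div_mul_add (a := n) hp.pos
        nlinarith : n < (n / p + 1) * p)
    have h3 : ((n / p : ℕ) : ℝ) ≤ n.factorial.factorization p := by exact_mod_cast h1
    linarith
  · have := Fact.mk hp
    have h := sub_one_mul_padicValNat_factorial (p := p) n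
    have h1 : (p - 1) * n.factorial.factorization p ≤ n := by
      rw [Nat.factorization_def _ hp, h]; omega
    have h2 : ((p : ℝ) - 1) * n.factorial.factorization p ≤ n := by
      have : ((p - 1 : ℕ) : ℝ) * n.factorial.factorization p ≤ n := by exact_mod_cast h1
      rwa [Nat.cast_sub hp.one_le, Nat.cast_one] at this
    have : (1 : ℝ) < p := by exact_mod_cast hp.one_lt
    rw [le_div_iff₀ (by linarith)]; linarith

/-- Mertens' first theorem. -/
lemma exists_abs_sum_log_div_sub_log_le :
    ∃ C : ℝ, 0 ≤ C ∧ ∀ n : ℕ, 1 ≤ n →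
      |∑ p ∈ n.primesLE, Real.log p / p - Real.log n| ≤ C := by
  obtain ⟨K, hK⟩ : ∃ K : ℝ, K = ∑' n : ℕ, Real.log n / ((n : ℝ) * ((n : ℝ) - 1)) := ⟨_, rfl⟩
  have hterm : ∀ n : ℕ, 0 ≤ Real.log n / ((n : ℝ) * ((n : ℝ) - 1)) := fun n => by
    rcases Nat.lt_or_ge n 2 with hn | hn
    · interval_cases n <;> simp
    · have : (2 : ℝ) ≤ n := by exact_mod_cast hn
      exact div_nonneg (Real.log_nonneg (by linarith)) (mul_nonneg (by linarith) (by linarith))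
  have hK0 : 0 ≤ K := hK ▸ tsum_nonneg hterm
  refine ⟨K + 2, by linarith, fun n hn => ?_⟩
  have hn0 : (0 : ℝ) < n := by exact_mod_cast hn
  have hpr : ∀ p ∈ n.primesLE, p.Prime := fun p hp => (Finset.mem_filter.1 hp).2
  set S := ∑ p ∈ n.primesLE, Real.log p / p with hS
  have hup : Real.log n.factorial ≤ n * Real.log n := by
    rw [← Real.log_pow]
    refine Real.log_le_log (by exact_mod_cast n.factorial_pos) ?_
    exact_mod_cast Nat.factorial_le_pow n
  have hlow : n * Real.log n - n ≤ Real.log n.factorial := by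
    have := Stirling.le_log_factorial_stirling (n := n) (by omega)
    have h1 : 0 ≤ Real.log n := Real.log_nonneg (by exact_mod_cast hn)
    have h2 : 0 ≤ Real.log (2 * Real.pi) := Real.log_nonneg (by linarith [Real.pi_gt_three])
    linarith
  have htheta : ∑ p ∈ n.primesLE, Real.log p ≤ Real.log 4 * n := by
    rw [← Chebyshev.theta_eq_sum_primesLE_log]
    exact Chebyshev.theta_le_log4_mul_x hn0.le
  have hlog4 : Real.log 4 ≤ 2 := by
    have : Real.log 4 = 2 * Real.log 2 := by
      rw [show (4 : ℝ) = 2 ^ 2 by norm_num, Real.log_pow]; norm_num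
    linarith [Real.log_two_lt_d9]
  -- Compare log n! = n log n + O(n) with its prime factorisation. Rounding n/p down costs the
  -- Chebyshev sum θ(n) ≤ n log 4.
  have h1 : n * S - Real.log 4 * n ≤ Real.log n.factorial := by
    rw [log_factorial_eq_sum]
    calc n * S - Real.log 4 * n ≤ n * S - ∑ p ∈ n.primesLE, Real.log p := by linarith
      _ = ∑ p ∈ n.primesLE, ((n : ℝ) / p - 1) * Real.log p := by
          rw [hS, Finset.mul_sum, ← Finset.sum_sub_distrib]
          exact Finset.sum_congr rfl fun p _ => by ring
      _ ≤ _ := Finset.sum_le_sum fun p hp => mul_le_mul_of_nonneg_right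
          (factorization_factorial_bounds (hpr p hp)).1
          (Real.log_nonneg (by exact_mod_cast (hpr p hp).one_le))
  have h2 : Real.log n.factorial ≤ n * (S + K) := by
    rw [log_factorial_eq_sum]
    calc ∑ p ∈ n.primesLE, (n.factorial.factorization p : ℝ) * Real.log p
        ≤ ∑ p ∈ n.primesLE, ((n : ℝ) / ((p : ℝ) - 1)) * Real.log p :=
          Finset.sum_le_sum fun p hp => mul_le_mul_of_nonneg_right
            (factorization_factorial_bounds (hpr p hp)).2
            (Real.log_nonneg (by exact_mod_cast (hpr p hp).one_le))
      _ = n * (S + ∑ p ∈ n.primesLE, Real.log p / ((p : ℝ) * ((p : ℝ) - 1))) := by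
          rw [hS, ← Finset.sum_add_distrib, Finset.mul_sum]
          refine Finset.sum_congr rfl fun p hp => ?_
          have : (1 : ℝ) < p := by exact_mod_cast (hpr p hp).one_lt
          have h3 : (p : ℝ) - 1 ≠ 0 := by linarith
          field_simp
          ring
      _ ≤ n * (S + K) := by
          gcongr
          rw [hK]
          exact summable_log_div_mul_pred.sum_le_tsum _ fun i _ => hterm i
  rw [abs_le]
  constructor
  · have : n * (Real.log n - 1) ≤ n * (S + K) := by linarith
    have := le_of_mul_le_mul_left this hn0
    linarith
  · have : n * (S - Real.log 4) ≤ n * Real.log n := by linarith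
    have := le_of_mul_le_mul_left this hn0
    linarith

/-- Mertens' first theorem for the primes below a real number. -/
lemma exists_abs_sum_primesLT_log_div_sub_log_le :
    ∃ C : ℝ, 0 ≤ C ∧ ∀ x : ℝ, 1 ≤ x →
      |∑ p ∈ primesLT x, Real.log p / p - Real.log x| ≤ C := by
  obtain ⟨C, hC, h⟩ := exists_abs_sum_log_div_sub_log_le
  refine ⟨C + 2, by linarith, fun x hx => ?_⟩
  rcases le_or_gt x 2 with hx2 | hx2
  · have : primesLT x = ∅ := by
      ext p; simp only [mem_primesLT, notMem_empty, iff_false, not_and, not_lt]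
      intro hp; have : (2 : ℝ) ≤ p := by exact_mod_cast hp.two_le
      linarith
    rw [this, sum_empty, zero_sub, abs_neg, abs_of_nonneg (Real.log_nonneg hx)]
    have := Real.log_le_log (by linarith) hx2
    linarith [Real.log_two_lt_d9]
  -- The condition p < x is strict, so the matching integer is ⌈x⌉ - 1 and not ⌊x⌋.
  · set n := ⌈x⌉₊ - 1 with hn
    have hc : 2 < ⌈x⌉₊ := Nat.lt_ceil.2 (by exact_mod_cast hx2)
    have hn1 : 1 ≤ n := by omega
    have hset : primesLT x = n.primesLE := by
      simp only [primesLT, Nat.primesLE, Nat.primesBelow, hn]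
      rw [Nat.sub_add_cancel (by omega)]
    have hnx : (n : ℝ) < x := Nat.lt_ceil.1 (by omega)
    have hxn : x ≤ n + 1 := by
      have := Nat.le_ceil x
      have h2 : (⌈x⌉₊ : ℝ) = n + 1 := by rw [hn]; push_cast [Nat.cast_sub (show 1 ≤ ⌈x⌉₊ by omega)]; ring
      linarith
    have hn0 : (1 : ℝ) ≤ n := by exact_mod_cast hn1
    have h1 : Real.log n ≤ Real.log x := Real.log_le_log (by linarith) hnx.le
    have h2 : Real.log x ≤ Real.log n + 1 := by
      have : x ≤ 2 * n := by linarith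
      have := Real.log_le_log (by linarith) this
      rw [Real.log_mul (by norm_num) (by linarith)] at this
      linarith [Real.log_two_lt_d9]
    rw [hset]
    have := h n hn1
    rw [abs_le] at this ⊢
    constructor <;> linarith [this.1, this.2]

/-- On [x, x²) one has 1/p ≤ (log p / p) / log x, and Mertens' first theorem at both ends bounds the
logarithmically weighted sum by log x + 2C. -/
lemma sum_inv_primes_sq_le {C : ℝ}
    (hC : ∀ x : ℝ, 1 ≤ x → |∑ p ∈ primesLT x, Real.log p / p - Real.log x| ≤ C)
    {x : ℝ} (hx : 2 ≤ x) :
    ∑ p ∈ primesLT (x ^ 2) with x ≤ (p : ℕ), 1 / (p : ℝ) ≤ 1 + 2 * C / Real.log x := by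
  have hl : 0 < Real.log x := Real.log_pos (by linarith)
  have h1 := (abs_le.1 (hC x (by linarith))).1
  have h2 := (abs_le.1 (hC (x ^ 2) (by nlinarith))).2
  rw [Real.log_pow] at h2
  have hsplit := Finset.sum_filter_add_sum_filter_not (primesLT (x ^ 2)) (fun p : ℕ => x ≤ (p : ℝ))
    (fun p => Real.log p / (p : ℝ))
  have hset : (primesLT (x ^ 2)).filter (fun p : ℕ => ¬ x ≤ (p : ℝ)) = primesLT x := by
    ext p; simp only [mem_filter, mem_primesLT, not_le]
    refine ⟨fun h => ⟨h.1.1, h.2⟩, fun h => ⟨⟨h.1, by nlinarith [h.2]⟩, h.2⟩⟩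
  rw [hset] at hsplit
  have h3 : Real.log x * ∑ p ∈ primesLT (x ^ 2) with x ≤ (p : ℕ), 1 / (p : ℝ) ≤
      ∑ p ∈ primesLT (x ^ 2) with x ≤ (p : ℕ), Real.log p / p := by
    rw [mul_sum]
    refine sum_le_sum fun p hp => ?_
    rw [mul_one_div]
    have := (mem_filter.1 hp).2
    gcongr
  push_cast at h2
  have : Real.log x * ∑ p ∈ primesLT (x ^ 2) with x ≤ (p : ℕ), 1 / (p : ℝ) ≤
      Real.log x * (1 + 2 * C / Real.log x) := by
    have : Real.log x * (1 + 2 * C / Real.log x) = Real.log x + 2 * C := by field_simp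
    linarith
  exact le_of_mul_le_mul_left this hl

/-- A weak form of Mertens' second theorem on doubly exponential ranges. -/
lemma exists_sum_inv_primes_le :
    ∃ C : ℝ, 0 ≤ C ∧ ∀ (x : ℝ) (k : ℕ), 2 ≤ x →
      ∑ p ∈ primesLT (x ^ (2 ^ k)) with x ≤ (p : ℕ), 1 / (p : ℝ) ≤ k + C := by
  obtain ⟨C, hC0, hC⟩ := exists_abs_sum_primesLT_log_div_sub_log_le
  refine ⟨8 * C, by linarith, fun x k hx => ?_⟩
  have hl : 1 / 2 ≤ Real.log x := by
    have := Real.log_le_log (by norm_num) hx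
    linarith [Real.log_two_gt_d9]
  -- Each squaring step adds 1, with error 2C / (2^i log x) at step i; the errors form a geometric
  -- series, summed here in closed form.
  have key : ∑ p ∈ primesLT (x ^ (2 ^ k)) with x ≤ (p : ℕ), 1 / (p : ℝ) ≤
      k + 4 * C / Real.log x * (1 - (1 / 2) ^ k) := by
    induction k with
    | zero =>
      rw [sum_eq_zero]
      · simp
      · intro p hp
        simp only [mem_filter, mem_primesLT, pow_zero, pow_one] at hp
        exact absurd hp.2 (not_le.2 hp.1.2)
    | succ k ih =>
      have hxk : 2 ≤ x ^ (2 ^ k) := hx.trans (le_self_pow₀ (by linarith) (by positivity))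
      have h := sum_inv_primes_sq_le hC hxk
      rw [← pow_mul, ← pow_succ, Real.log_pow] at h
      have hsub : ∑ p ∈ primesLT (x ^ (2 ^ (k + 1))) with x ≤ (p : ℕ), 1 / (p : ℝ) ≤
          ∑ p ∈ primesLT (x ^ (2 ^ k)) with x ≤ (p : ℕ), 1 / (p : ℝ) +
          ∑ p ∈ primesLT (x ^ (2 ^ (k + 1))) with x ^ (2 ^ k) ≤ (p : ℕ), 1 / (p : ℝ) := by
        rw [← sum_union]
        · refine sum_le_sum_of_subset_of_nonneg (fun p hp => ?_) (fun _ _ _ => by positivity)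
          simp only [mem_filter, mem_union, mem_primesLT] at hp ⊢
          rcases lt_or_ge (p : ℝ) (x ^ (2 ^ k)) with h | h
          · exact Or.inl ⟨⟨hp.1.1, h⟩, hp.2⟩
          · exact Or.inr ⟨hp.1, h⟩
        · rw [disjoint_left]
          intro p hp hq
          simp only [mem_filter, mem_primesLT] at hp hq
          linarith [hp.1.2, hq.2]
      refine hsub.trans ((add_le_add ih h).trans (le_of_eq ?_))
      have : Real.log x ≠ 0 := by linarith
      push_cast
      rw [one_div, inv_pow, inv_pow, pow_succ]
      field_simp
      ring
  refine key.trans ?_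
  have h1 : (0 : ℝ) ≤ (1 / 2) ^ k := by positivity
  have h2 : 4 * C / Real.log x ≤ 8 * C := by
    rw [div_le_iff₀ (by linarith)]; nlinarith
  have h3 : 0 ≤ 4 * C / Real.log x := by positivity
  nlinarith

/-- The lower bound in Mertens' third theorem. -/
lemma log_le_prod_primesLT {z : ℝ} (hz : 1 ≤ z) :
    Real.log z ≤ ∏ p ∈ primesLT z, (1 - 1 / (p : ℝ))⁻¹ := by
  let f : ℕ →* ℝ :=
    { toFun := fun n => (n : ℝ)⁻¹, map_one' := by simp, map_mul' := fun a b => by simp [mul_comm] }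
  have hf : ∀ n, f n = (n : ℝ)⁻¹ := fun n => rfl
  obtain ⟨hs, hsum⟩ := EulerProduct.summable_and_hasSum_smoothNumbers_prod_primesBelow_geometric
    (f := f) (fun {p} hp => by
      rw [hf, norm_inv, Real.norm_natCast]
      exact inv_lt_one_of_one_lt₀ (by exact_mod_cast hp.one_lt)) ⌈z⌉₊
  have hprod : ∏ p ∈ primesLT z, (1 - 1 / (p : ℝ))⁻¹ = ∏ p ∈ (⌈z⌉₊).primesBelow, (1 - f p)⁻¹ := by
    simp only [hf, one_div]; rfl
  rw [hprod, ← hsum.tsum_eq]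
  set n := ⌈z⌉₊ - 1 with hn
  have hc : 1 ≤ ⌈z⌉₊ := Nat.one_le_ceil_iff.2 (by linarith)
  -- Every integer up to n = ⌈z⌉ - 1 is ⌈z⌉-smooth, so the harmonic sum is a partial sum of the
  -- expanded Euler product.
  have h1 : Real.log z ≤ harmonic n := by
    refine (Real.log_le_log (by linarith) ?_).trans (log_add_one_le_harmonic n)
    have h := Nat.le_ceil z
    have : n + 1 = ⌈z⌉₊ := by omega
    exact_mod_cast this ▸ h
  refine h1.trans ?_
  have hmem : ∀ i ∈ Finset.Icc 1 n, i ∈ Nat.smoothNumbers ⌈z⌉₊ := fun i hi => by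
    rw [Finset.mem_Icc] at hi
    rw [Nat.mem_smoothNumbers']
    intro p _ hd
    have := Nat.le_of_dvd (by omega) hd
    omega
  have hs' : Summable (fun m : (⌈z⌉₊).smoothNumbers => f m) := hsum.summable
  have := hs'.sum_le_tsum ((Finset.Icc 1 n).attach.map
    ⟨fun i => (⟨i.1, hmem i.1 i.2⟩ : (⌈z⌉₊).smoothNumbers), fun a b h =>
      Subtype.ext (by
        have := congrArg (fun t : (⌈z⌉₊).smoothNumbers => (t : ℕ)) h
        exact this)⟩) (fun i _ => by rw [hf]; positivity)
  refine le_trans (le_of_eq ?_) this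
  rw [Finset.sum_map, harmonic_eq_sum_Icc]
  push_cast
  exact (Finset.sum_attach (Finset.Icc 1 n) (fun i : ℕ => (i : ℝ)⁻¹)).symm

lemma sum_inv_sq_le_two (S : Finset ℕ) : ∑ p ∈ S, 1 / (p : ℝ) ^ 2 ≤ 2 := by
  have h := hasSum_zeta_two
  refine (h.summable.sum_le_tsum S fun i _ => by positivity).trans ?_
  rw [h.tsum_eq]
  nlinarith [Real.pi_lt_d2, Real.pi_pos]

/-- Here -log(1 - t) ≤ (1 - t)⁻¹ - 1 = t + t²/(1 - t), and 1 - t ≥ 1/5. The threshold 4/5 is what t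
= 4/p needs for p ≥ 5. -/
lemma inv_one_sub_le_exp {t : ℝ} (h1 : t ≤ 4 / 5) :
    (1 - t)⁻¹ ≤ Real.exp (t + 5 * t ^ 2) := by
  have hpos : 0 < 1 - t := by linarith
  rw [← Real.exp_log (inv_pos.2 hpos), Real.exp_le_exp, Real.log_inv]
  have h := Real.one_sub_inv_le_log_of_pos hpos
  have : (1 - t)⁻¹ - 1 ≤ t + 5 * t ^ 2 := by
    rw [sub_le_iff_le_add, inv_le_iff_one_le_mul₀ hpos]
    nlinarith [mul_nonneg (sq_nonneg t) (by linarith : 0 ≤ 4 / 5 - t)]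
  linarith

lemma prod_inv_one_sub_le_exp {S : Finset ℕ} {c : ℝ}
    (hS : ∀ p ∈ S, c / (p : ℝ) ≤ 4 / 5) :
    ∏ p ∈ S, (1 - c / (p : ℝ))⁻¹ ≤ Real.exp (c * ∑ p ∈ S, 1 / (p : ℝ) + 10 * c ^ 2) := by
  calc ∏ p ∈ S, (1 - c / (p : ℝ))⁻¹ ≤ ∏ p ∈ S, Real.exp (c / p + 5 * (c / p) ^ 2) :=
        prod_le_prod (fun p hp => inv_nonneg.2 (by linarith [hS p hp]))
          fun p hp => inv_one_sub_le_exp (hS p hp)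
    _ = Real.exp (c * ∑ p ∈ S, 1 / (p : ℝ) + 5 * c ^ 2 * ∑ p ∈ S, 1 / (p : ℝ) ^ 2) := by
        rw [← Real.exp_sum, sum_add_distrib, mul_sum, mul_sum]
        congr 2 <;> exact sum_congr rfl fun p _ => by ring
    _ ≤ _ := by
        rw [Real.exp_le_exp]
        have := mul_le_mul_of_nonneg_left (sum_inv_sq_le_two S) (by positivity : 0 ≤ 5 * c ^ 2)
        linarith

lemma sum_primesLT_le (z : ℝ) :
    ∑ p ∈ primesLT z, 1 / (p : ℝ) ≤ ∑ p ∈ sievePrimes z, 1 / (p : ℝ) + 1 := by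
  rw [← sum_filter_add_sum_filter_not (primesLT z) (fun p => 5 ≤ p)]
  refine add_le_add le_rfl ?_
  have hsub : (primesLT z).filter (fun p => ¬ 5 ≤ p) ⊆ {2, 3} := fun p hp => by
    simp only [mem_filter, mem_primesLT, not_le] at hp
    have := hp.1.1.two_le
    have hp5 := hp.2
    have hpp := hp.1.1
    interval_cases p <;> simp_all +decide
  refine (sum_le_sum_of_subset_of_nonneg hsub fun _ _ _ => by positivity).trans ?_
  norm_num

/-- The lower bound in Mertens' second theorem. -/
lemma log_log_le_sum_sievePrimes {z : ℝ} (hz : 2 ≤ z) :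
    Real.log (Real.log z) ≤ ∑ p ∈ sievePrimes z, 1 / (p : ℝ) + 11 := by
  -- The constant 11 is 10 from the quadratic terms of the product plus 1 for the primes 2 and 3.
  have h1 := (log_le_prod_primesLT (z := z) (by linarith)).trans
    (prod_inv_one_sub_le_exp (S := primesLT z) fun p hp => by
      have : (2 : ℝ) ≤ p := by exact_mod_cast (mem_primesLT.1 hp).1.two_le
      rw [div_le_iff₀ (by linarith)]; linarith)
  have h2 := Real.log_le_log (Real.log_pos (by linarith)) h1
  rw [Real.log_exp] at h2
  have h3 := sum_primesLT_le z
  linarith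

/-- Primes below exp l contribute O(1) by Mertens' first theorem, and those from exp l to x about
log(log x / l) by the second. The factor 2 pays for measuring the second range in squarings, since
log 2 > 1/2. With l proportional to log R / (1 + |ξ|) this controls the sum of h_ξ(p)/p. -/
lemma exists_sum_min_log_div_le :
    ∃ C : ℝ, 0 ≤ C ∧ ∀ x l : ℝ, 2 ≤ x → 0 < l →
      ∑ p ∈ primesLT x, min 1 (Real.log p / l) / (p : ℝ) ≤
        2 * Real.log (1 + Real.log x / l) + C := by
  obtain ⟨C₁, hC₁, h₁⟩ := exists_abs_sum_primesLT_log_div_sub_log_le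
  obtain ⟨C₂, hC₂, h₂⟩ := exists_sum_inv_primes_le
  refine ⟨2 + 2 * C₁ + C₂, by linarith, fun x l hx hl => ?_⟩
  have hlx : 1 / 2 ≤ Real.log x := by
    have := Real.log_le_log (by norm_num) hx
    linarith [Real.log_two_gt_d9]
  have hR : 0 ≤ Real.log (1 + Real.log x / l) :=
    Real.log_nonneg (by linarith [div_nonneg (by linarith : 0 ≤ Real.log x) hl.le])
  have hsmall : ∀ y : ℝ, 1 ≤ y →
      ∑ p ∈ primesLT y, min 1 (Real.log p / l) / (p : ℝ) ≤ (Real.log y + C₁) / l := by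
    intro y hy
    have := (abs_le.1 (h₁ y hy)).2
    calc ∑ p ∈ primesLT y, min 1 (Real.log p / l) / (p : ℝ)
        ≤ ∑ p ∈ primesLT y, (Real.log p / p) / l := sum_le_sum fun p _ => by
          rw [div_right_comm]; gcongr; exact min_le_right _ _
      _ = (∑ p ∈ primesLT y, Real.log p / p) / l := by rw [sum_div]
      _ ≤ _ := by gcongr; linarith
  rcases le_or_gt (Real.log x) l with hc | hc
  · have h := hsmall x (by linarith)
    have : (Real.log x + C₁) / l ≤ 1 + 2 * C₁ := by
      rw [div_le_iff₀ hl]; nlinarith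
    linarith
  -- The squaring form of Mertens' theorem needs a starting point at least 2; if exp l ≤ 2 there are
  -- no primes below w at all.
  · set w := max 2 (Real.exp l) with hw
    have hw2 : 2 ≤ w := le_max_left _ _
    have hwx : w ≤ x := max_le hx (by
      rw [← Real.exp_log (show 0 < x by linarith)]; exact Real.exp_le_exp.2 hc.le)
    have hlw : l ≤ Real.log w := by
      rw [← Real.log_exp l]; exact Real.log_le_log (Real.exp_pos _) (le_max_right _ _)
    have hlw0 : 0 < Real.log w := hl.trans_le hlw
    have hex : ∃ k : ℕ, x ≤ w ^ (2 ^ k) := by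
      obtain ⟨n, hn⟩ := pow_unbounded_of_one_lt x (show 1 < w by linarith)
      exact ⟨n, hn.le.trans (pow_le_pow_right₀ (by linarith) Nat.lt_two_pow_self.le)⟩
    classical
    set k := Nat.find hex with hk
    have hkx : x ≤ w ^ (2 ^ k) := Nat.find_spec hex
    have hkb : (k : ℝ) ≤ 1 + 2 * Real.log (1 + Real.log x / l) := by
      rcases Nat.eq_zero_or_pos k with h0 | h0
      · rw [h0]; push_cast; linarith
      · have hlt := not_le.1 (Nat.find_min hex (m := k - 1) (by omega))
        have h3 := Real.log_lt_log (by positivity) hlt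
        rw [Real.log_pow] at h3
        push_cast at h3
        have h4 : (2 : ℝ) ^ (k - 1) ≤ 1 + Real.log x / l := by
          have : (2 : ℝ) ^ (k - 1) ≤ Real.log x / l := by
            rw [le_div_iff₀ hl]
            exact (mul_le_mul_of_nonneg_left hlw (by positivity)).trans h3.le
          linarith
        have h5 := Real.log_le_log (by positivity) h4
        rw [Real.log_pow, Nat.cast_sub h0] at h5
        have h6 : (0 : ℝ) ≤ (k : ℝ) - 1 := by
          have : (1 : ℝ) ≤ k := by exact_mod_cast h0
          linarith
        push_cast at h5
        nlinarith [Real.log_two_gt_d9]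
    have hfirst : ∑ p ∈ primesLT w, min 1 (Real.log p / l) / (p : ℝ) ≤ 1 + 2 * C₁ := by
      rcases le_or_gt (Real.exp l) 2 with he | he
      · have : primesLT w = ∅ := by
          ext p; simp only [mem_primesLT, notMem_empty, iff_false, not_and, not_lt]
          intro hp; rw [hw, max_eq_left he]; exact_mod_cast hp.two_le
        rw [this, sum_empty]; linarith
      · have hwe : w = Real.exp l := max_eq_right he.le
        have hl2 : 1 / 2 ≤ l := by
          have := Real.log_le_log (by norm_num) he.le
          rw [Real.log_exp] at this
          linarith [Real.log_two_gt_d9]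
        refine (hsmall w (by linarith)).trans ?_
        rw [hwe, Real.log_exp, div_le_iff₀ hl]; nlinarith
    have hsub : ∑ p ∈ primesLT x, min 1 (Real.log p / l) / (p : ℝ) ≤
        ∑ p ∈ primesLT w, min 1 (Real.log p / l) / (p : ℝ) +
        ∑ p ∈ primesLT (w ^ (2 ^ k)) with w ≤ (p : ℕ), 1 / (p : ℝ) := by
      rw [← sum_filter_add_sum_filter_not (primesLT x) (fun p : ℕ => (p : ℝ) < w)]
      refine add_le_add (sum_le_sum_of_subset_of_nonneg (fun p hp => ?_) fun p hp _ => ?_) ?_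
      · simp only [mem_filter, mem_primesLT] at hp ⊢
        exact ⟨hp.1.1, hp.2⟩
      · have := (mem_primesLT.1 hp).1.one_le
        have : 0 ≤ Real.log p := Real.log_nonneg (by exact_mod_cast this)
        positivity
      · refine (sum_le_sum fun p _ => div_le_div_of_nonneg_right (min_le_left _ _)
          (by positivity)).trans (sum_le_sum_of_subset_of_nonneg (fun p hp => ?_)
          fun _ _ _ => by positivity)
        simp only [mem_filter, mem_primesLT, not_lt] at hp ⊢
        exact ⟨⟨hp.1.1, by linarith [hp.1.2]⟩, hp.2⟩
    have := h₂ w k hw2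
    linarith

/-! ### Combinatorics of the beta sieve -/

/-- The beta sieve condition on a set `A` of primes: truncations at `p` of parity `e` satisfy
`(∏_{q ∈ A, q ≥ p} q) p^200 < D`. -/
def Admissible (e : ℕ) (D : ℝ) (A : Finset ℕ) : Prop :=
  ∀ p ∈ A, #{q ∈ A | p ≤ q} % 2 = e → (∏ q ∈ A with p ≤ q, (q : ℝ)) * (p : ℝ) ^ 200 < D

/-- The sets that violate the beta sieve condition for the first time at their least element. -/
def FirstFailure (e : ℕ) (D : ℝ) (A : Finset ℕ) : Prop :=
  ∃ p ∈ A, (∀ q ∈ A, p ≤ q) ∧ #A % 2 = e ∧ D ≤ (∏ q ∈ A, (q : ℝ)) * (p : ℝ) ^ 200 ∧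
    Admissible e D (A.erase p)

lemma filter_insert_ge {A : Finset ℕ} {p a : ℕ} (hp : ∀ q ∈ A, p < q) (ha : a ∈ A) :
    {q ∈ insert p A | a ≤ q} = {q ∈ A | a ≤ q} := by
  rw [filter_insert, if_neg (not_le.2 (hp a ha))]

lemma filter_insert_self {A : Finset ℕ} {p : ℕ} (hp : ∀ q ∈ A, p < q) :
    {q ∈ insert p A | p ≤ q} = insert p A :=
  filter_true_of_mem fun q hq => (mem_insert.1 hq).elim (fun h => h.ge) fun h => (hp q h).le

lemma notMem_of_forall_lt {A : Finset ℕ} {p : ℕ} (hp : ∀ q ∈ A, p < q) : p ∉ A :=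
  fun h => lt_irrefl _ (hp p h)

lemma admissible_empty (e : ℕ) (D : ℝ) : Admissible e D ∅ := fun p hp => by simp at hp

lemma admissible_insert {e : ℕ} {D : ℝ} {A : Finset ℕ} {p : ℕ} (hp : ∀ q ∈ A, p < q) :
    Admissible e D (insert p A) ↔ Admissible e D A ∧
      ((#A + 1) % 2 = e → (p * ∏ q ∈ A, (q : ℝ)) * (p : ℝ) ^ 200 < D) := by
  have hpA := notMem_of_forall_lt hp
  unfold Admissible
  rw [forall_mem_insert, and_comm, filter_insert_self hp, card_insert_of_notMem hpA,
    prod_insert hpA]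
  refine and_congr_left fun _ => forall₂_congr fun a ha => ?_
  rw [filter_insert_ge hp ha]

lemma firstFailure_insert {e : ℕ} {D : ℝ} {A : Finset ℕ} {p : ℕ} (hp : ∀ q ∈ A, p < q) :
    FirstFailure e D (insert p A) ↔ (#A + 1) % 2 = e ∧
      D ≤ (p * ∏ q ∈ A, (q : ℝ)) * (p : ℝ) ^ 200 ∧ Admissible e D A := by
  have hpA := notMem_of_forall_lt hp
  constructor
  · rintro ⟨a, ha, hmin, hpar, hD, hadm⟩
    have : a = p := le_antisymm (hmin p (mem_insert_self _ _)) ((mem_insert.1 ha).elim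
      (fun h => h.ge) fun h => (hp a h).le)
    subst this
    rw [card_insert_of_notMem hpA] at hpar
    rw [prod_insert hpA] at hD
    rw [erase_insert hpA] at hadm
    exact ⟨hpar, hD, hadm⟩
  · rintro ⟨hpar, hD, hadm⟩
    refine ⟨p, mem_insert_self _ _, fun q hq => (mem_insert.1 hq).elim (fun h => h.ge)
      fun h => (hp q h).le, ?_, ?_, ?_⟩
    · rwa [card_insert_of_notMem hpA]
    · rwa [prod_insert hpA]
    · rwa [erase_insert hpA]

open Classical in
/-- The Buchstab-type identity behind the combinatorial sieve. -/
lemma sum_admissible_eq (e : ℕ) (D : ℝ) (x : ℕ → ℝ) (P : Finset ℕ) :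
    ∑ A ∈ P.powerset with Admissible e D A, (-1) ^ #A * ∏ p ∈ A, x p =
      ∏ p ∈ P, (1 - x p) - ∑ A ∈ P.powerset with FirstFailure e D A,
        (-1) ^ #A * (∏ p ∈ A, x p) * ∏ q ∈ P with ∀ a ∈ A, q < a, (1 - x q) := by
  induction P using Finset.induction_on_min with
  | empty =>
    have h1 : Admissible e D ∅ := admissible_empty e D
    have h2 : ¬ FirstFailure e D ∅ := fun ⟨p, hp, _⟩ => by simp at hp
    simp [sum_filter, h1, h2]
  | insert p P hp ih =>
    have hpP := notMem_of_forall_lt hp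
    have hlt : ∀ A ∈ P.powerset, ∀ q ∈ A, p < q := fun A hA q hq => hp q (mem_powerset.1 hA hq)
    simp only [sum_filter] at ih ⊢
    rw [sum_powerset_insert hpP, sum_powerset_insert hpP, prod_insert hpP]
    -- The new prime p lies below all of P. A failing set avoiding p only gains the factor 1 - x p;
    -- a set containing p can fail first only at p, and then its tail product is empty; an
    -- admissible set containing p is an admissible set enlarged by p, minus the cases that fail
    -- there. These three facts match term by term.
    have e1 : ∀ A ∈ P.powerset,
        (if FirstFailure e D A then (-1) ^ #A * (∏ p ∈ A, x p) *
          ∏ q ∈ insert p P with ∀ a ∈ A, q < a, (1 - x q) else 0) =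
        (1 - x p) * (if FirstFailure e D A then (-1) ^ #A * (∏ p ∈ A, x p) *
          ∏ q ∈ P with ∀ a ∈ A, q < a, (1 - x q) else 0) := fun A hA => by
      rw [filter_insert, if_pos (hlt A hA), prod_insert (fun h => hpP (mem_filter.1 h).1)]
      split_ifs <;> ring
    have e2 : ∀ A ∈ P.powerset,
        (if FirstFailure e D (insert p A) then (-1) ^ #(insert p A) * (∏ q ∈ insert p A, x q) *
          ∏ q ∈ insert p P with ∀ a ∈ insert p A, q < a, (1 - x q) else 0) =
        -x p * (if (#A + 1) % 2 = e ∧ D ≤ (p * ∏ q ∈ A, (q : ℝ)) * (p : ℝ) ^ 200 ∧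
          Admissible e D A then (-1) ^ #A * ∏ p ∈ A, x p else 0) := fun A hA => by
      have hpA := notMem_of_forall_lt (hlt A hA)
      have hempty : ({q ∈ insert p P | ∀ a ∈ insert p A, q < a} : Finset ℕ) = ∅ := by
        refine filter_false_of_mem fun q hq h => ?_
        have := h p (mem_insert_self _ _)
        rcases mem_insert.1 hq with h' | h'
        · omega
        · have := hp q h'; omega
      rw [hempty, firstFailure_insert (hlt A hA), card_insert_of_notMem hpA, prod_insert hpA]
      split_ifs <;> simp [pow_succ]; ring
    have e3 : ∀ A ∈ P.powerset,
        (if Admissible e D (insert p A) then (-1) ^ #(insert p A) * (∏ q ∈ insert p A, x q)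
          else 0) =
        -x p * (if Admissible e D A then (-1) ^ #A * ∏ p ∈ A, x p else 0) +
        x p * (if (#A + 1) % 2 = e ∧ D ≤ (p * ∏ q ∈ A, (q : ℝ)) * (p : ℝ) ^ 200 ∧
          Admissible e D A then (-1) ^ #A * ∏ p ∈ A, x p else 0) := fun A hA => by
      have hpA := notMem_of_forall_lt (hlt A hA)
      rw [card_insert_of_notMem hpA, prod_insert hpA]
      by_cases h1 : Admissible e D A
      · by_cases h2 : (#A + 1) % 2 = e ∧ D ≤ (p * ∏ q ∈ A, (q : ℝ)) * (p : ℝ) ^ 200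
        · rw [if_neg, if_pos h1, if_pos ⟨h2.1, h2.2, h1⟩]; · ring
          rw [admissible_insert (hlt A hA)]
          exact fun h => absurd (h.2 h2.1) (not_lt.2 h2.2)
        · rw [if_pos, if_pos h1, if_neg (fun h => h2 ⟨h.1, h.2.1⟩), pow_succ]; · ring
          rw [admissible_insert (hlt A hA)]
          exact ⟨h1, fun h => lt_of_not_ge fun h' => h2 ⟨h, h'⟩⟩
      · rw [if_neg, if_neg h1, if_neg (fun h => h1 h.2.2)]; · ring
        rw [admissible_insert (hlt A hA)]
        exact fun h => h1 h.1
    rw [sum_congr rfl e1, sum_congr rfl e2, sum_congr rfl e3, sum_add_distrib, ← mul_sum,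
      ← mul_sum, ← mul_sum, ← mul_sum, ih]
    ring

/-- Removing the least element. -/
lemma exists_eq_insert_min {A : Finset ℕ} (hA : A.Nonempty) :
    ∃ p B, (∀ q ∈ B, p < q) ∧ A = insert p B := by
  refine ⟨A.min' hA, A.erase (A.min' hA), fun q hq => ?_, (insert_erase (A.min'_mem hA)).symm⟩
  exact lt_of_le_of_ne (A.min'_le q (mem_of_mem_erase hq)) (ne_of_mem_erase hq).symm

/-- If the parity tests the least element p, the factor p^200 is to spare. If not, the next element
r was tested, and one of its 200 spare factors r absorbs p < r. A set with only one, untested,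
element is covered by z ≤ D. -/
lemma prod_lt_of_admissible {e : ℕ} {D z : ℝ} {A : Finset ℕ} (hA : Admissible e D A)
    (he : e < 2) (hD : 1 < D) (hzD : z ≤ D) (h1 : ∀ p ∈ A, 2 ≤ p) (hz : ∀ p ∈ A, (p : ℝ) < z) :
    ∏ p ∈ A, (p : ℝ) < D := by
  have aux : ∀ (p : ℕ) (B : Finset ℕ), 2 ≤ p → (∀ q ∈ B, 2 ≤ q) →
      (p * ∏ q ∈ B, (q : ℝ)) * (p : ℝ) ^ 200 < D → p * (p * ∏ q ∈ B, (q : ℝ)) < D := by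
    intro p B hp hB h
    refine lt_of_le_of_lt ?_ h
    have h2 : (2 : ℝ) ≤ p := by exact_mod_cast hp
    have h3 : 0 ≤ p * ∏ q ∈ B, (q : ℝ) := by positivity
    rw [mul_comm]
    gcongr
    exact le_self_pow₀ (by linarith) (by norm_num)
  rcases A.eq_empty_or_nonempty with rfl | hne
  · simpa using hD
  obtain ⟨p, B, hpB, rfl⟩ := exists_eq_insert_min hne
  rw [prod_insert (notMem_of_forall_lt hpB)]
  have hp2 := h1 p (mem_insert_self _ _)
  have hp2' : (2 : ℝ) ≤ p := by exact_mod_cast hp2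
  obtain ⟨hB, hpar⟩ := (admissible_insert hpB).1 hA
  by_cases hc : (#B + 1) % 2 = e
  · have := aux p B hp2 (fun q hq => h1 q (mem_insert_of_mem hq)) (hpar hc)
    have h3 : 0 ≤ p * ∏ q ∈ B, (q : ℝ) := by positivity
    nlinarith
  · rcases B.eq_empty_or_nonempty with rfl | hne'
    · have := hz p (mem_insert_self _ _)
      simpa using this.trans_le hzD
    obtain ⟨r, E, hrE, rfl⟩ := exists_eq_insert_min hne'
    have hrE' := notMem_of_forall_lt hrE
    rw [card_insert_of_notMem hrE'] at hc
    have hr2 := h1 r (by simp)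
    have := aux r E hr2 (fun q hq => h1 q (by simp [hq]))
      (((admissible_insert hrE).1 hB).2 (by omega))
    refine lt_of_le_of_lt ?_ this
    rw [prod_insert hrE']
    have : (p : ℝ) ≤ r := by exact_mod_cast (hpB r (by simp)).le
    gcongr

lemma prod_le_of_firstFailure {e : ℕ} {D z : ℝ} {A : Finset ℕ} (hA : FirstFailure e D A)
    (he : e < 2) (hD : 1 < D) (hzD : z ≤ D) (h1 : ∀ p ∈ A, 2 ≤ p) (hz : ∀ p ∈ A, (p : ℝ) < z) :
    ∏ p ∈ A, (p : ℝ) ≤ D ^ 2 := by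
  have hne : A.Nonempty := ⟨_, hA.choose_spec.1⟩
  obtain ⟨p, B, hpB, rfl⟩ := exists_eq_insert_min hne
  rw [prod_insert (notMem_of_forall_lt hpB), sq]
  have h := prod_lt_of_admissible ((firstFailure_insert hpB).1 hA).2.2 he hD hzD
    (fun q hq => h1 q (mem_insert_of_mem hq)) (fun q hq => hz q (mem_insert_of_mem hq))
  have := (hz p (mem_insert_self _ _)).le.trans hzD
  gcongr

/-- The logarithmic size left over in an admissible set. -/
lemma le_log_sub_sum_log {e : ℕ} {D z : ℝ} (hz : 1 < z) (hD : z ^ 500 ≤ D) (n : ℕ) :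
    ∀ (A : Finset ℕ), #A = n → (∀ p ∈ A, 2 ≤ p) → (∀ p ∈ A, (p : ℝ) < z) → #A % 2 = e →
      (∃ p B, (∀ q ∈ B, p < q) ∧ A = insert p B ∧ Admissible e D B) →
      498 * (99 / 100 : ℝ) ^ (n / 2) * Real.log z ≤ Real.log D - ∑ p ∈ A, Real.log p := by
  have hlz : 0 < Real.log z := Real.log_pos hz
  have hlD : 500 * Real.log z ≤ Real.log D := by
    have := Real.log_le_log (by positivity) hD
    rwa [Real.log_pow] at this
  induction n using Nat.strong_induction_on with
  | _ n ih =>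
  rintro A hcard h1 hAz hpar ⟨p, B, hpB, rfl, hB⟩
  have hlog : ∀ q ∈ insert p B, Real.log q ≤ Real.log z := fun q hq =>
    Real.log_le_log (by have := h1 q hq; positivity) (hAz q hq).le
  have hpB' := notMem_of_forall_lt hpB
  rw [sum_insert hpB']
  have hp := hlog p (mem_insert_self _ _)
  have hpow : ∀ k : ℕ, (99 / 100 : ℝ) ^ k ≤ 1 := fun k => pow_le_one₀ (by norm_num) (by norm_num)
  -- With at most two elements the set uses at most 2 log z of the 500 log z available, which is the
  -- origin of 498.
  rcases B.eq_empty_or_nonempty with rfl | hne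
  · have := hpow (n / 2)
    simp only [sum_empty, add_zero]
    nlinarith
  obtain ⟨r, E, hrE, rfl⟩ := exists_eq_insert_min hne
  have hrE' := notMem_of_forall_lt hrE
  rw [sum_insert hrE']
  have hr := hlog r (by simp)
  rw [card_insert_of_notMem hpB', card_insert_of_notMem hrE'] at hcard hpar
  rcases E.eq_empty_or_nonempty with rfl | hne'
  · have := hpow (n / 2)
    simp only [sum_empty, add_zero]
    nlinarith
  obtain ⟨s, F, hsF, rfl⟩ := exists_eq_insert_min hne'
  have hsF' := notMem_of_forall_lt hsF
  have hE := ((admissible_insert hrE).1 hB).1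
  have hadm := (admissible_insert hsF).1 hE
  have key := ih (n - 2) (by omega) (insert s F) (by omega) (fun q hq => h1 q (by
      simp only [mem_insert] at hq ⊢; tauto)) (fun q hq => hAz q (by
      simp only [mem_insert] at hq ⊢; tauto)) (by omega) ⟨s, F, hsF, rfl, hadm.1⟩
  have hs2 : 2 ≤ s := h1 s (by simp)
  have hr2 : 2 ≤ r := h1 r (by simp)
  have hp2 : 2 ≤ p := h1 p (by simp)
  have hF0 : ∀ q ∈ F, (q : ℝ) ≠ 0 := fun q hq => by
    have := h1 q (by simp [hq])
    positivity
  have hFpos : 0 < ∏ q ∈ F, (q : ℝ) := prod_pos fun q hq => by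
    have := h1 q (by simp [hq])
    positivity
  -- The test at s says that the room L left after `insert s F` exceeds 200 log s. Adding r and p,
  -- both below s, uses at most 2 log s < L/100, so two further elements keep a proportion 99/100 of
  -- the room.
  have hlt := hadm.2 (by rw [card_insert_of_notMem hsF'] at hpar; omega)
  have hlt' := Real.log_lt_log (by positivity) hlt
  rw [Real.log_mul (by positivity) (by positivity), Real.log_mul (by positivity) hFpos.ne',
    Real.log_pow, Real.log_prod hF0] at hlt'
  rw [sum_insert hsF'] at key ⊢
  have hrs : Real.log r ≤ Real.log s :=
    Real.log_le_log (by positivity) (by exact_mod_cast (hrE s (by simp)).le)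
  have hps : Real.log p ≤ Real.log s :=
    Real.log_le_log (by positivity) (by
      exact_mod_cast ((hpB s (by simp))).le)
  have hn : n / 2 = (n - 2) / 2 + 1 := by
    rw [card_insert_of_notMem hsF'] at hcard; omega
  rw [hn, pow_succ]
  push_cast at hlt'
  nlinarith

/-- A set failing the beta sieve condition with a small least element has many elements. -/
lemma card_ge_of_firstFailure {e : ℕ} {D z : ℝ} {A : Finset ℕ} {k p : ℕ} (hz : 1 < z)
    (hD : z ^ 500 ≤ D) (hA : FirstFailure e D A) (h1 : ∀ q ∈ A, 2 ≤ q)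
    (hAz : ∀ q ∈ A, (q : ℝ) < z) (hpA : p ∈ A) (hp : (p : ℝ) ^ 2 ^ k < z) :
    130 * k ≤ #A := by
  have hlz : 0 < Real.log z := Real.log_pos hz
  have hne : A.Nonempty := ⟨_, hA.choose_spec.1⟩
  obtain ⟨r, B, hrB, rfl⟩ := exists_eq_insert_min hne
  have hrB' := notMem_of_forall_lt hrB
  obtain ⟨hpar, hfail, hadm⟩ := (firstFailure_insert hrB).1 hA
  have key := le_log_sub_sum_log hz hD _ (insert r B) rfl h1 hAz
    (by rwa [card_insert_of_notMem hrB']) ⟨r, B, hrB, rfl, hadm⟩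
  have hr2 : 2 ≤ r := h1 r (by simp)
  have hB0 : ∀ q ∈ B, (q : ℝ) ≠ 0 := fun q hq => by
    have := h1 q (by simp [hq])
    positivity
  have hBpos : 0 < ∏ q ∈ B, (q : ℝ) := prod_pos fun q hq => by
    have := h1 q (by simp [hq])
    positivity
  have hfail' := Real.log_le_log (lt_of_lt_of_le (by positivity) hD) hfail
  rw [Real.log_mul (by positivity) (by positivity), Real.log_mul (by positivity) hBpos.ne',
    Real.log_pow, Real.log_prod hB0] at hfail'
  rw [sum_insert hrB'] at key
  have hrp : (r : ℝ) ≤ p := by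
    rcases mem_insert.1 hpA with h | h
    · rw [h]
    · exact_mod_cast (hrB p h).le
  have hr : (2 : ℝ) ^ k * Real.log r < Real.log z := by
    have h3 : (r : ℝ) ^ 2 ^ k < z := lt_of_le_of_lt (by gcongr) hp
    have := Real.log_lt_log (by positivity) h3
    rw [Real.log_pow] at this
    exact_mod_cast this
  by_contra hlt
  rw [not_le] at hlt
  -- Fewer than 130k elements means at most 65k losses of a factor 99/100, and (99/100)^65 ≥ 1/2, so
  -- the room left is at least 498 · 2^(-k) log z. Failure at the least element r says it is at most
  -- 200 log r < 200 · 2^(-k) log z.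
  have h65 : #(insert r B) / 2 ≤ 65 * k := by omega
  have hpow : (1 / 2 : ℝ) ^ k ≤ (99 / 100 : ℝ) ^ (#(insert r B) / 2) := by
    calc (1 / 2 : ℝ) ^ k ≤ ((99 / 100 : ℝ) ^ 65) ^ k :=
          pow_le_pow_left₀ (by norm_num) (by norm_num) k
      _ = (99 / 100 : ℝ) ^ (65 * k) := by rw [pow_mul]
      _ ≤ _ := pow_le_pow_of_le_one (by norm_num) (by norm_num) h65
  push_cast at hfail'
  have h5 : 498 * (1 / 2 : ℝ) ^ k * Real.log z ≤ 200 * Real.log r := by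
    have : 498 * (1 / 2 : ℝ) ^ k * Real.log z ≤
        498 * (99 / 100 : ℝ) ^ (#(insert r B) / 2) * Real.log z := by gcongr
    linarith
  have h6 : (2 : ℝ) ^ k * (1 / 2 : ℝ) ^ k = 1 := by rw [← mul_pow]; norm_num
  have h7 := mul_le_mul_of_nonneg_left h5 (show (0 : ℝ) ≤ 2 ^ k by positivity)
  have h8 : (2 : ℝ) ^ k * (498 * (1 / 2 : ℝ) ^ k * Real.log z) = 498 * Real.log z := by
    linear_combination 498 * Real.log z * h6
  nlinarith

/-- Every prime `5 ≤ p < z` lies in some interval `[z^(1/2^k), z^(1/2^(k-1)))`; here `y` plays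
the role of `z^(1/2^k)`. -/
lemma exists_scale {z : ℝ} {p : ℕ} (hp : 5 ≤ p) (hz : (p : ℝ) < z) :
    ∃ k : ℕ, 2 ≤ z ^ ((1 / 2 : ℝ) ^ (k + 1)) ∧ z ^ ((1 / 2 : ℝ) ^ (k + 1)) ≤ p ∧
      (p : ℝ) ^ 2 ^ k < z := by
  have hp5 : (5 : ℝ) ≤ p := by exact_mod_cast hp
  have hex : ∃ k : ℕ, z ≤ (p : ℝ) ^ 2 ^ k := by
    obtain ⟨n, hn⟩ := pow_unbounded_of_one_lt z (show (1 : ℝ) < p by linarith)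
    exact ⟨n, hn.le.trans (pow_le_pow_right₀ (by linarith) Nat.lt_two_pow_self.le)⟩
  classical
  have hk0 : Nat.find hex ≠ 0 := fun h => by
    have := Nat.find_spec hex
    rw [h] at this
    simp only [pow_zero, pow_one] at this
    linarith
  obtain ⟨k, hk⟩ := Nat.exists_eq_succ_of_ne_zero hk0
  have h1 : z ≤ (p : ℝ) ^ 2 ^ (k + 1) := by
    have := Nat.find_spec hex
    rwa [hk] at this
  have h2 := not_le.1 (Nat.find_min hex (m := k) (by omega))
  have hz0 : 0 < z := by linarith
  have hroot : ∀ a : ℝ, 0 ≤ a → (a ^ 2 ^ (k + 1)) ^ ((1 / 2 : ℝ) ^ (k + 1)) = a := fun a ha => by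
    rw [← Real.rpow_natCast, ← Real.rpow_mul ha]
    push_cast
    rw [← mul_pow]; norm_num
  refine ⟨k, ?_, ?_, h2⟩
  -- Here p ≥ 5 > 4 is used: the scale stays at least 2, as the Mertens bounds require.
  · have h3 : (2 : ℝ) ^ 2 ^ (k + 1) ≤ z := by
      calc (2 : ℝ) ^ 2 ^ (k + 1) = 4 ^ 2 ^ k := by rw [pow_succ', pow_mul]; norm_num
        _ ≤ (p : ℝ) ^ 2 ^ k := pow_le_pow_left₀ (by norm_num) (by linarith) _
        _ ≤ z := h2.le
    have h4 := Real.rpow_le_rpow (by positivity) h3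
      (show 0 ≤ (1 / 2 : ℝ) ^ (k + 1) by positivity)
    rwa [hroot 2 (by norm_num)] at h4
  · have h4 := Real.rpow_le_rpow hz0.le h1 (show 0 ≤ (1 / 2 : ℝ) ^ (k + 1) by positivity)
    rwa [hroot p (by linarith)] at h4

/-! ### Equidistribution of periodic weights in an interval -/

lemma abs_card_filter_modEq_sub_le {u v M : ℕ} (huv : u ≤ v) (hM : 0 < M) (a : ℕ) :
    |(#{n ∈ Ioc u v | n ≡ a [MOD M]} : ℝ) - ((v : ℝ) - u) / M| ≤ 1 := by
  have h := Nat.Ioc_filter_modEq_card u v hM a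
  have hM' : (0 : ℚ) < M := by exact_mod_cast hM
  have h1 := Int.floor_le (((v : ℚ) - a) / M)
  have h2 := Int.lt_floor_add_one (((v : ℚ) - a) / M)
  have h3 := Int.floor_le (((u : ℚ) - a) / M)
  have h4 := Int.lt_floor_add_one (((u : ℚ) - a) / M)
  have h5 : ((u : ℚ) - a) / M ≤ ((v : ℚ) - a) / M := by
    have : (u : ℚ) ≤ v := by exact_mod_cast huv
    gcongr
  have h6 := Int.floor_le_floor h5
  rw [max_eq_left (by linarith)] at h
  have h7 : (#{n ∈ Ioc u v | n ≡ a [MOD M]} : ℚ) =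
      (⌊((v : ℚ) - a) / M⌋ : ℚ) - (⌊((u : ℚ) - a) / M⌋ : ℚ) := by exact_mod_cast h
  have h8 : ((v : ℚ) - u) / M = ((v : ℚ) - a) / M - ((u : ℚ) - a) / M := by
    rw [← sub_div]; ring_nf
  have h9 : |(#{n ∈ Ioc u v | n ≡ a [MOD M]} : ℚ) - ((v : ℚ) - u) / M| ≤ 1 := by
    rw [h7, h8, abs_le]
    constructor <;> linarith
  have h10 := (Rat.cast_le (K := ℝ)).2 h9
  push_cast at h10
  exact h10

/-- Equidistribution in an interval of a product of functions periodic modulo distinct primes. -/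
lemma abs_sum_prod_periodic_sub_le {u v : ℕ} (huv : u ≤ v) (x : ℕ → ℕ → ℝ)
    (hx : ∀ p n, 0 ≤ x p n) (hper : ∀ p n, x p (n % p) = x p n) (A : Finset ℕ) :
    ∀ (M a : ℕ), 0 < M → (∀ p ∈ A, p.Prime) → (∀ p ∈ A, p.Coprime M) →
      |∑ n ∈ Ioc u v with n ≡ a [MOD M], ∏ p ∈ A, x p n -
        ((v : ℝ) - u) / M * ∏ p ∈ A, (∑ r ∈ range p, x p r) / p| ≤
        ∏ p ∈ A, ∑ r ∈ range p, x p r := by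
  induction A using Finset.induction_on with
  | empty =>
    intro M a hM _ _
    simpa using abs_card_filter_modEq_sub_le huv hM a
  | insert p A hpA ih =>
    intro M a hM hprime hcop
    have hp := hprime p (mem_insert_self _ _)
    have hpM := hcop p (mem_insert_self _ _)
    have hp0 : (p : ℝ) ≠ 0 := by exact_mod_cast hp.ne_zero
    have hM0 : (M : ℝ) ≠ 0 := by exact_mod_cast hM.ne'
    -- On the class r modulo p the factor at p is constant, and the Chinese remainder theorem merges
    -- this class with a modulo M into the single class `c r` modulo M p. The error is 1 per final
    -- class, weighted by the product of the factors.
    let c : ℕ → ℕ := fun r => (Nat.chineseRemainder hpM.symm a r : ℕ)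
    have hc : ∀ r, c r ≡ a [MOD M] ∧ c r ≡ r [MOD p] :=
      fun r => (Nat.chineseRemainder hpM.symm a r).2
    have hsplit : ∑ n ∈ Ioc u v with n ≡ a [MOD M], ∏ q ∈ insert p A, x q n =
        ∑ r ∈ range p, x p r * ∑ n ∈ Ioc u v with n ≡ c r [MOD M * p], ∏ q ∈ A, x q n := by
      have h1 : ∀ r ∈ range p, x p r * ∑ n ∈ Ioc u v with n ≡ c r [MOD M * p], ∏ q ∈ A, x q n =
          ∑ n ∈ Ioc u v with n ≡ a [MOD M], if n % p = r then x p n * ∏ q ∈ A, x q n else 0 := by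
        intro r hr
        rw [← sum_filter, filter_filter, mul_sum]
        have hset : {n ∈ Ioc u v | n ≡ c r [MOD M * p]} =
            {n ∈ Ioc u v | n ≡ a [MOD M] ∧ n % p = r} := by
          refine filter_congr fun n _ => ?_
          rw [← Nat.modEq_and_modEq_iff_modEq_mul hpM.symm]
          have hrr : r % p = r := Nat.mod_eq_of_lt (mem_range.1 hr)
          refine and_congr ⟨fun h => h.trans (hc r).1, fun h => h.trans (hc r).1.symm⟩
            ⟨fun h => ?_, fun h => ?_⟩
          · have := h.trans (hc r).2
            rwa [Nat.ModEq, hrr] at this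
          · refine Nat.ModEq.trans ?_ (hc r).2.symm
            rw [Nat.ModEq, h, hrr]
        rw [hset]
        refine sum_congr rfl fun n hn => ?_
        rw [← hper p n, (mem_filter.1 hn).2.2]
      rw [sum_congr rfl h1, sum_comm]
      refine sum_congr rfl fun n _ => ?_
      rw [prod_insert hpA, sum_ite_eq, if_pos (mem_range.2 (Nat.mod_lt _ hp.pos))]
    rw [hsplit, prod_insert hpA, prod_insert hpA]
    have hmain : ((v : ℝ) - u) / M * ((∑ r ∈ range p, x p r) / p *
        ∏ q ∈ A, (∑ r ∈ range q, x q r) / q) =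
        ∑ r ∈ range p, x p r * (((v : ℝ) - u) / (M * p : ℕ) *
          ∏ q ∈ A, (∑ r ∈ range q, x q r) / q) := by
      rw [← sum_mul]; push_cast; field_simp
    rw [hmain, ← sum_sub_distrib, sum_mul]
    refine (abs_sum_le_sum_abs _ _).trans (sum_le_sum fun r _ => ?_)
    rw [← mul_sub, abs_mul, abs_of_nonneg (hx p r)]
    refine mul_le_mul_of_nonneg_left ?_ (hx p r)
    refine ih (M * p) (c r) (Nat.mul_pos hM hp.pos) (fun q hq => hprime q (mem_insert_of_mem hq))
      fun q hq => Nat.Coprime.mul_right (hcop q (mem_insert_of_mem hq)) ?_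
    exact (Nat.coprime_primes (hprime q (mem_insert_of_mem hq)) hp).2 fun h => hpA (h ▸ hq)

/-! ### Fundamental lemma and upper bound sieve -/

/-- The points `z^(1/2^k)`. -/
noncomputable def scale (z : ℝ) (k : ℕ) : ℝ := z ^ ((1 / 2 : ℝ) ^ k)

lemma scale_pow {z : ℝ} (hz : 0 ≤ z) (k : ℕ) : scale z k ^ 2 ^ k = z := by
  rw [scale, ← Real.rpow_natCast, ← Real.rpow_mul hz]
  push_cast
  rw [← mul_pow]; norm_num

lemma scale_zero (z : ℝ) : scale z 0 = z := by simp [scale]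

lemma scale_le {z : ℝ} (hz : 1 ≤ z) (k : ℕ) : scale z k ≤ z := by
  rw [scale]
  calc z ^ ((1 / 2 : ℝ) ^ k) ≤ z ^ (1 : ℝ) :=
        Real.rpow_le_rpow_of_exponent_le hz (pow_le_one₀ (by norm_num) (by norm_num))
    _ = z := Real.rpow_one z

/-- Since k < 2^(2^k) ≤ z, only finitely many scales occur. The crude range is harmless because the
sums over k decay geometrically. -/
lemma lt_ceil_of_two_le_scale {z : ℝ} (hz : 0 ≤ z) {k : ℕ} (h : 2 ≤ scale z k) : k < ⌈z⌉₊ := by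
  rw [Nat.lt_ceil]
  calc (k : ℝ) < ((2 ^ 2 ^ k : ℕ) : ℝ) := by
        exact_mod_cast Nat.lt_two_pow_self.trans Nat.lt_two_pow_self
    _ = (2 : ℝ) ^ 2 ^ k := by push_cast; rfl
    _ ≤ scale z k ^ 2 ^ k := pow_le_pow_left₀ (by norm_num) h _
    _ = z := scale_pow hz k

lemma exists_sum_inv_primes_scale_le :
    ∃ C : ℝ, 0 ≤ C ∧ ∀ (z : ℝ) (k : ℕ), 0 ≤ z → 2 ≤ scale z k →
      ∑ p ∈ primesLT z with scale z k ≤ (p : ℕ), 1 / (p : ℝ) ≤ k + C := by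
  obtain ⟨C, hC, h⟩ := exists_sum_inv_primes_le
  refine ⟨C, hC, fun z k hz hk => ?_⟩
  have := h (scale z k) k hk
  rwa [scale_pow hz] at this

lemma sum_exp_neg_mul_le (c : ℝ) (hc : 1 ≤ c) (K : ℕ) :
    ∑ k ∈ range K, Real.exp (-c * k) ≤ 2 := by
  have h1 : ∀ k : ℕ, Real.exp (-c * k) ≤ (1 / 2 : ℝ) ^ k := fun k => by
    have : Real.exp (-c) ≤ 1 / 2 := by
      calc Real.exp (-c) ≤ Real.exp (-1) := Real.exp_le_exp.2 (by linarith)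
        _ ≤ 1 / 2 := by linarith [Real.exp_neg_one_lt_d9]
    rw [mul_comm, Real.exp_nat_mul]
    exact pow_le_pow_left₀ (Real.exp_pos _).le this k
  refine (sum_le_sum fun k _ => h1 k).trans ?_
  refine (summable_geometric_two.sum_le_tsum (range K) fun i _ => by positivity).trans ?_
  rw [tsum_geometric_two]

/-- By unique factorisation, distinct sets of primes have distinct products, all in [1, Y]. -/
lemma card_le_of_prod_le {Y : ℝ} (F : Finset (Finset ℕ)) (hp : ∀ A ∈ F, ∀ p ∈ A, p.Prime)
    (hY : ∀ A ∈ F, ∏ p ∈ A, (p : ℝ) ≤ Y) (hY0 : 0 ≤ Y) : (#F : ℝ) ≤ Y := by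
  have h : #F ≤ #(Icc 1 ⌊Y⌋₊) := by
    refine card_le_card_of_injOn (fun A => ∏ p ∈ A, p) (fun A hA => ?_) fun A hA B hB hAB => ?_
    · refine mem_coe.2 (mem_Icc.2 ⟨Nat.one_le_iff_ne_zero.2
        (prod_ne_zero_iff.2 fun p hp' => (hp A hA p hp').ne_zero), Nat.le_floor ?_⟩)
      push_cast
      exact hY A hA
    · have := congrArg Nat.primeFactors hAB
      simp only at this
      rwa [Nat.primeFactors_prod (hp A hA), Nat.primeFactors_prod (hp B hB)] at this
  calc (#F : ℝ) ≤ #(Icc 1 ⌊Y⌋₊) := by exact_mod_cast h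
    _ ≤ Y := by simpa using Nat.floor_le hY0

lemma prod_le_prod_of_subset_of_le_one {s t : Finset ℕ} {f : ℕ → ℝ} (hst : s ⊆ t)
    (h0 : ∀ p ∈ t, 0 ≤ f p) (h1 : ∀ p ∈ t, f p ≤ 1) : ∏ p ∈ t, f p ≤ ∏ p ∈ s, f p := by
  rw [← prod_sdiff hst]
  exact mul_le_of_le_one_left (prod_nonneg fun p hp => h0 p (hst hp))
    (prod_le_one (fun p hp => h0 p (mem_sdiff.1 hp).1) fun p hp => h1 p (mem_sdiff.1 hp).1)

lemma exp_one_le_three : Real.exp 1 ≤ 3 := by linarith [Real.exp_one_lt_d9]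

open Classical in
/-- The fundamental lemma for the upper bound beta sieve, up to a constant. -/
lemma exists_sum_admissible_le :
    ∃ C : ℝ, 0 < C ∧ ∀ (z D : ℝ) (S : Finset ℕ) (g : ℕ → ℝ), 1 < z → z ^ 500 ≤ D →
      S ⊆ sievePrimes z → (∀ p ∈ S, 0 ≤ g p) → (∀ p ∈ S, g p ≤ 4 / p) →
      ∑ A ∈ S.powerset with Admissible 1 D A, (-1) ^ #A * ∏ p ∈ A, g p ≤
        C * ∏ p ∈ S, (1 - g p) := by
  obtain ⟨C₂, hC₂, h₂⟩ := exists_sum_inv_primes_scale_le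
  refine ⟨1 + 2 * Real.exp (16 * (1 + C₂) + 160), by positivity,
    fun z D S g hz hD hS hg0 hg => ?_⟩
  have hS5 : ∀ p ∈ S, (5 : ℝ) ≤ p := fun p hp => by
    exact_mod_cast (mem_sievePrimes.1 (hS hp)).2.1
  have hfrac : ∀ p ∈ S, 4 / (p : ℝ) ≤ 4 / 5 := fun p hp => by
    have := hS5 p hp; gcongr
  have hV : ∀ p ∈ S, 0 < 1 - g p := fun p hp => by linarith [hg p hp, hfrac p hp]
  set V := ∏ p ∈ S, (1 - g p) with hVdef
  have hV0 : 0 < V := prod_pos hV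
  rw [sum_admissible_eq]
  set K := ⌈z⌉₊ with hK
  -- A failing set charged to scale k has all its primes in `T k`, and the sum of 1/p over `T k` is
  -- at most k + O(1).
  set T : ℕ → Finset ℕ := fun k => {p ∈ S | scale z (k + 1) ≤ (p : ℝ)} with hT
  have hTsum : ∀ k, 2 ≤ scale z (k + 1) → ∑ p ∈ T k, 1 / (p : ℝ) ≤ k + (1 + C₂) := fun k hk => by
    have h := h₂ z (k + 1) (by linarith) hk
    push_cast at h
    refine (sum_le_sum_of_subset_of_nonneg (fun p hp => ?_) fun _ _ _ => by positivity).trans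
      (h.trans (by linarith))
    rw [hT, mem_filter] at hp
    exact mem_filter.2 ⟨(mem_filter.1 (hS hp.1)).1, hp.2⟩
  have hTV : ∀ k, 2 ≤ scale z (k + 1) → ∏ p ∈ S with ¬ scale z (k + 1) ≤ (p : ℕ), (1 - g p) ≤
      V * Real.exp (4 * (k + (1 + C₂)) + 160) := fun k hk => by
    have h1 : V = (∏ p ∈ T k, (1 - g p)) *
        ∏ p ∈ S with ¬ scale z (k + 1) ≤ (p : ℕ), (1 - g p) :=
      (prod_filter_mul_prod_filter_not S _ _).symm
    have hTpos : 0 < ∏ p ∈ T k, (1 - g p) := prod_pos fun p hp => hV p (mem_filter.1 hp).1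
    have h2 : (∏ p ∈ T k, (1 - g p))⁻¹ ≤ Real.exp (4 * (k + (1 + C₂)) + 160) := by
      rw [← prod_inv_distrib]
      calc ∏ p ∈ T k, (1 - g p)⁻¹ ≤ ∏ p ∈ T k, (1 - 4 / (p : ℝ))⁻¹ :=
            prod_le_prod (fun p hp => inv_nonneg.2 (hV p (mem_filter.1 hp).1).le) fun p hp => by
              have hpS := (mem_filter.1 hp).1
              have := hfrac p hpS
              exact inv_anti₀ (by linarith) (by linarith [hg p hpS])
        _ ≤ Real.exp (4 * ∑ p ∈ T k, 1 / (p : ℝ) + 10 * 4 ^ 2) :=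
            prod_inv_one_sub_le_exp fun p hp => hfrac p (mem_filter.1 hp).1
        _ ≤ _ := Real.exp_le_exp.2 (by linarith [hTsum k hk])
    calc ∏ p ∈ S with ¬ scale z (k + 1) ≤ (p : ℕ), (1 - g p)
        = V * (∏ p ∈ T k, (1 - g p))⁻¹ := by rw [h1]; field_simp
      _ ≤ _ := by gcongr
  -- Charge A to the scale k of its least element. The factor exp(#A - 130k) ≥ 1 may be inserted,
  -- and exp(#A) is spread over the primes of A so that the sum over A stays multiplicative. The
  -- tail product is compared with V by restoring the primes of `T k`.
  have hterm : ∀ A ∈ S.powerset, FirstFailure 1 D A →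
      -((-1) ^ #A * (∏ p ∈ A, g p) * ∏ q ∈ S with ∀ a ∈ A, q < a, (1 - g q)) ≤
      ∑ k ∈ range K with 2 ≤ scale z (k + 1), if A ∈ (T k).powerset then
        Real.exp (-130 * k) * (V * Real.exp (4 * (k + (1 + C₂)) + 160)) *
          ∏ p ∈ A, (Real.exp 1 * g p) else 0 := by
    intro A hA hF
    have hAS := mem_powerset.1 hA
    obtain ⟨p, hpA, hmin, hpar, -, -⟩ := id hF
    have hpS := mem_sievePrimes.1 (hS (hAS hpA))
    obtain ⟨k, hk1, hk2, hk3⟩ := exists_scale hpS.2.1 hpS.2.2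
    have hcard := card_ge_of_firstFailure hz hD hF
      (fun q hq => (mem_sievePrimes.1 (hS (hAS hq))).1.two_le)
      (fun q hq => (mem_sievePrimes.1 (hS (hAS hq))).2.2) hpA hk3
    have hAT : A ∈ (T k).powerset := mem_powerset.2 fun q hq => mem_filter.2 ⟨hAS hq,
      hk2.trans (by exact_mod_cast hmin q hq)⟩
    have hkK : k ∈ (range K).filter (fun k => 2 ≤ scale z (k + 1)) :=
      mem_filter.2 ⟨mem_range.2 ((Nat.lt_succ_self k).trans
        (lt_ceil_of_two_le_scale (by linarith) hk1)), hk1⟩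
    have hgA : 0 ≤ ∏ p ∈ A, g p := prod_nonneg fun q hq => hg0 q (hAS hq)
    refine le_trans ?_ (single_le_sum (fun j _ => ?_) hkK)
    · rw [if_pos hAT, Odd.neg_one_pow (Nat.odd_iff.2 hpar), prod_mul_distrib, prod_const]
      have h1 : ∏ q ∈ S with ∀ a ∈ A, q < a, (1 - g q) ≤
          ∏ p ∈ S with ¬ scale z (k + 1) ≤ (p : ℕ), (1 - g p) := by
        refine prod_le_prod_of_subset_of_le_one (fun q hq => ?_) (fun q hq => ?_)
          fun q hq => ?_
        · rw [mem_filter, not_le] at hq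
          refine mem_filter.2 ⟨hq.1, fun a ha => ?_⟩
          have := (mem_filter.1 (mem_powerset.1 hAT ha)).2
          exact_mod_cast hq.2.trans_le this
        · exact (hV q (mem_filter.1 hq).1).le
        · linarith [hg0 q (mem_filter.1 hq).1]
      have h2 : 1 ≤ Real.exp (-130 * k) * Real.exp 1 ^ #A := by
        rw [← Real.exp_nat_mul, ← Real.exp_add]
        refine Real.one_le_exp ?_
        have : (130 * k : ℝ) ≤ #A := by exact_mod_cast hcard
        linarith
      have h3 := h1.trans (hTV k hk1)
      have h4 : 0 ≤ V * Real.exp (4 * (k + (1 + C₂)) + 160) := by positivity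
      calc -(-1 * (∏ p ∈ A, g p) * ∏ q ∈ S with ∀ a ∈ A, q < a, (1 - g q))
          = (∏ p ∈ A, g p) * ∏ q ∈ S with ∀ a ∈ A, q < a, (1 - g q) := by ring
        _ ≤ (∏ p ∈ A, g p) * (V * Real.exp (4 * (k + (1 + C₂)) + 160)) := by gcongr
        _ ≤ (Real.exp (-130 * k) * Real.exp 1 ^ #A) *
            ((∏ p ∈ A, g p) * (V * Real.exp (4 * (k + (1 + C₂)) + 160))) :=
            le_mul_of_one_le_left (by positivity) h2
        _ = _ := by ring
    · split_ifs with hj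
      · have : 0 ≤ ∏ p ∈ A, (Real.exp 1 * g p) := prod_nonneg fun q hq =>
          mul_nonneg (Real.exp_pos _).le (hg0 q (hAS hq))
        positivity
      · exact le_rfl
  have hsum : -∑ A ∈ S.powerset with FirstFailure 1 D A, (-1) ^ #A * (∏ p ∈ A, g p) *
      ∏ q ∈ S with ∀ a ∈ A, q < a, (1 - g q) ≤
      2 * Real.exp (16 * (1 + C₂) + 160) * V := by
    have hnn : ∀ A ∈ S.powerset, ∀ k, 0 ≤ if A ∈ (T k).powerset then
        Real.exp (-130 * k) * (V * Real.exp (4 * (k + (1 + C₂)) + 160)) *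
          ∏ p ∈ A, (Real.exp 1 * g p) else 0 := fun A hA k => by
      split_ifs with hj
      · have : 0 ≤ ∏ p ∈ A, (Real.exp 1 * g p) := prod_nonneg fun q hq =>
          mul_nonneg (Real.exp_pos _).le (hg0 q (mem_powerset.1 hA hq))
        positivity
      · exact le_rfl
    rw [← sum_neg_distrib]
    calc _ ≤ ∑ A ∈ S.powerset with FirstFailure 1 D A,
          ∑ k ∈ range K with 2 ≤ scale z (k + 1), (if A ∈ (T k).powerset then
            Real.exp (-130 * k) * (V * Real.exp (4 * (k + (1 + C₂)) + 160)) *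
            ∏ p ∈ A, (Real.exp 1 * g p) else 0) :=
          sum_le_sum fun A hA => hterm A (mem_filter.1 hA).1 (mem_filter.1 hA).2
      _ ≤ ∑ A ∈ S.powerset, ∑ k ∈ range K with 2 ≤ scale z (k + 1),
          (if A ∈ (T k).powerset then
            Real.exp (-130 * k) * (V * Real.exp (4 * (k + (1 + C₂)) + 160)) *
            ∏ p ∈ A, (Real.exp 1 * g p) else 0) :=
          sum_le_sum_of_subset_of_nonneg (filter_subset _ _)
            fun A hA _ => sum_nonneg fun k _ => hnn A hA k
      _ = ∑ k ∈ range K with 2 ≤ scale z (k + 1),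
            Real.exp (-130 * k) * (V * Real.exp (4 * (k + (1 + C₂)) + 160)) *
            ∏ p ∈ T k, (1 + Real.exp 1 * g p) := by
          rw [sum_comm]
          refine sum_congr rfl fun k _ => ?_
          rw [← sum_filter, prod_one_add, mul_sum]
          refine sum_congr ?_ fun _ _ => rfl
          ext A
          simp only [mem_filter, mem_powerset]
          exact ⟨fun h => h.2, fun h => ⟨h.trans (filter_subset _ _), h⟩⟩
      _ ≤ ∑ k ∈ range K with 2 ≤ scale z (k + 1),
            Real.exp (16 * (1 + C₂) + 160) * V * Real.exp (-114 * k) := by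
          -- The exponent in k is -130 + 4 + 12 = -114: restoring the primes of `T k` costs 4k, and
          -- the Euler product costs 12k because e g(p) ≤ 3 · 4/p. The 160 is 10 · 4² from
          -- `prod_inv_one_sub_le_exp`.
          refine sum_le_sum fun k hk => ?_
          have hk2 := (mem_filter.1 hk).2
          have h1 : ∏ p ∈ T k, (1 + Real.exp 1 * g p) ≤ Real.exp (12 * (k + (1 + C₂))) := by
            have hnn' : ∀ p ∈ T k, 0 ≤ Real.exp 1 * g p := fun p hp =>
              mul_nonneg (Real.exp_pos _).le (hg0 p (mem_filter.1 hp).1)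
            refine (prod_le_prod (fun p hp => by linarith [hnn' p hp]) fun p hp =>
              (add_comm _ _).trans_le (Real.add_one_le_exp (Real.exp 1 * g p))).trans ?_
            rw [← Real.exp_sum, Real.exp_le_exp]
            calc ∑ p ∈ T k, Real.exp 1 * g p ≤ ∑ p ∈ T k, 12 * (1 / (p : ℝ)) :=
                  sum_le_sum fun p hp => by
                    have hpS := (mem_filter.1 hp).1
                    calc Real.exp 1 * g p ≤ 3 * (4 / p) :=
                          mul_le_mul exp_one_le_three (hg p hpS) (hg0 p hpS) (by norm_num)
                      _ = 12 * (1 / (p : ℝ)) := by ring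
              _ = 12 * ∑ p ∈ T k, 1 / (p : ℝ) := by rw [mul_sum]
              _ ≤ _ := by linarith [hTsum k hk2]
          calc Real.exp (-130 * k) * (V * Real.exp (4 * (k + (1 + C₂)) + 160)) *
                ∏ p ∈ T k, (1 + Real.exp 1 * g p)
              ≤ Real.exp (-130 * k) * (V * Real.exp (4 * (k + (1 + C₂)) + 160)) *
                Real.exp (12 * (k + (1 + C₂))) := by gcongr
            _ = V * (Real.exp (-130 * k) * Real.exp (4 * (k + (1 + C₂)) + 160) *
                Real.exp (12 * (k + (1 + C₂)))) := by ring
            _ = V * (Real.exp (16 * (1 + C₂) + 160) * Real.exp (-114 * k)) := by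
                rw [← Real.exp_add, ← Real.exp_add, ← Real.exp_add]; ring_nf
            _ = _ := by ring
      _ ≤ ∑ k ∈ range K, Real.exp (16 * (1 + C₂) + 160) * V * Real.exp (-114 * k) :=
          sum_le_sum_of_subset_of_nonneg (filter_subset _ _) fun _ _ _ => by positivity
      _ ≤ _ := by
          rw [← mul_sum]
          have := sum_exp_neg_mul_le 114 (by norm_num) K
          have h0 : 0 ≤ Real.exp (16 * (1 + C₂) + 160) * V := by positivity
          nlinarith
  linarith

open Classical in
-- For parity 1 every failing set has odd size, so the correction in Buchstab's identity has a
-- favourable sign. The values x p may be any reals in [0, 1], not just indicators, which allows a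
-- residue class to be sifted with partial weight.
lemma prod_one_sub_le_sum_admissible (D : ℝ) (S : Finset ℕ) (x : ℕ → ℝ)
    (h0 : ∀ p ∈ S, 0 ≤ x p) (h1 : ∀ p ∈ S, x p ≤ 1) :
    ∏ p ∈ S, (1 - x p) ≤ ∑ A ∈ S.powerset with Admissible 1 D A, (-1) ^ #A * ∏ p ∈ A, x p := by
  rw [sum_admissible_eq]
  have : ∑ A ∈ S.powerset with FirstFailure 1 D A,
      (-1) ^ #A * (∏ p ∈ A, x p) * ∏ q ∈ S with ∀ a ∈ A, q < a, (1 - x q) ≤ 0 := by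
    refine sum_nonpos fun A hA => ?_
    obtain ⟨hAS, p, _, _, hpar, _, _⟩ := mem_filter.1 hA
    rw [Odd.neg_one_pow (Nat.odd_iff.2 hpar), mul_assoc, neg_one_mul, neg_nonpos]
    exact mul_nonneg (prod_nonneg fun q hq => h0 q (mem_powerset.1 hAS hq))
      (prod_nonneg fun q hq => by linarith [h1 q (mem_filter.1 hq).1])
  linarith

/-- An upper bound sieve of dimension at most four for weights periodic modulo primes. -/
lemma exists_sieve_le :
    ∃ C : ℝ, 0 < C ∧ ∀ (z D : ℝ) (S B : Finset ℕ) (u v : ℕ) (x y : ℕ → ℕ → ℝ), 1 < z →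
      z ^ 500 ≤ D → S ⊆ sievePrimes z → Disjoint B S → (∀ p ∈ B, p.Prime ∧ 5 ≤ p) → u ≤ v →
      (∀ p n, 0 ≤ x p n) → (∀ p n, x p n ≤ 1) → (∀ p n, x p (n % p) = x p n) →
      (∀ p n, 0 ≤ y p n) → (∀ p n, y p (n % p) = y p n) →
      (∀ p ∈ S, ∑ r ∈ range p, x p r ≤ 4) → (∀ p ∈ B, ∑ r ∈ range p, y p r ≤ 1) →
      ∑ n ∈ Ioc u v with n ≡ 5 [MOD 6], (∏ p ∈ B, y p n) * ∏ p ∈ S, (1 - x p n) ≤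
        C * ((v : ℝ) - u) * (∏ p ∈ B, (∑ r ∈ range p, y p r) / p) *
          ∏ p ∈ S, (1 - (∑ r ∈ range p, x p r) / p) + D ^ 2 := by
  obtain ⟨C, hC, h⟩ := exists_sum_admissible_le
  refine ⟨C, hC, fun z D S B u v x y hz hD hS hBS hB huv hx0 hx1 hxper hy0 hyper hx4 hy1 => ?_⟩
  classical
  have hD1 : 1 < D := (one_lt_pow₀ hz (by norm_num)).trans_le hD
  have hzD : z ≤ D := (le_self_pow₀ hz.le (by norm_num)).trans hD
  have hSp : ∀ p ∈ S, p.Prime ∧ 5 ≤ p ∧ (p : ℝ) < z := fun p hp => mem_sievePrimes.1 (hS hp)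
  set GB := ∏ p ∈ B, (∑ r ∈ range p, y p r) / (p : ℝ) with hGB
  set g : ℕ → ℝ := fun p => (∑ r ∈ range p, x p r) / (p : ℝ) with hg
  have hGB0 : 0 ≤ GB := prod_nonneg fun p _ =>
    div_nonneg (sum_nonneg fun r _ => hy0 p r) (by positivity)
  have huv' : (0 : ℝ) ≤ (v : ℝ) - u := by
    have : (u : ℝ) ≤ v := by exact_mod_cast huv
    linarith
  have hA : ∀ A ∈ S.powerset.filter (Admissible 1 D),
      (-1) ^ #A * ∑ n ∈ Ioc u v with n ≡ 5 [MOD 6], (∏ p ∈ B, y p n) * ∏ p ∈ A, x p n ≤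
      ((v : ℝ) - u) / 6 * GB * ((-1) ^ #A * ∏ p ∈ A, g p) + D := by
    intro A hA
    obtain ⟨hAS, hadm⟩ := mem_filter.1 hA
    rw [mem_powerset] at hAS
    have hdisj : Disjoint B A := hBS.mono_right hAS
    -- B and A are disjoint, so the two families merge into one and equidistribution is applied once
    -- over B ∪ A.
    let w : ℕ → ℕ → ℝ := fun p n => if p ∈ B then y p n else x p n
    have hwB : ∀ p ∈ B, ∀ n, w p n = y p n := fun p hp n => if_pos hp
    have hwA : ∀ p ∈ A, ∀ n, w p n = x p n := fun p hp n =>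
      if_neg fun h => disjoint_left.1 hdisj h hp
    have key := abs_sum_prod_periodic_sub_le huv w
      (fun p n => by simp only [w]; split_ifs <;> [exact hy0 p n; exact hx0 p n])
      (fun p n => by simp only [w]; split_ifs <;> [exact hyper p n; exact hxper p n])
      (B ∪ A) 6 5 (by norm_num)
      (fun p hp => (mem_union.1 hp).elim (fun h => (hB p h).1) fun h => (hSp p (hAS h)).1)
      (fun p hp => by
        have : p.Prime ∧ 5 ≤ p := (mem_union.1 hp).elim (fun h => hB p h)
          fun h => ⟨(hSp p (hAS h)).1, (hSp p (hAS h)).2.1⟩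
        rw [show 6 = 2 * 3 from rfl]
        refine Nat.Coprime.mul_right ?_ ?_
        · exact (Nat.coprime_primes this.1 Nat.prime_two).2 (by omega)
        · exact (Nat.coprime_primes this.1 Nat.prime_three).2 (by omega))
    have e1 : ∀ n, ∏ p ∈ B ∪ A, w p n = (∏ p ∈ B, y p n) * ∏ p ∈ A, x p n := fun n => by
      rw [prod_union hdisj, prod_congr rfl fun p hp => hwB p hp n,
        prod_congr rfl fun p hp => hwA p hp n]
    have e2 : ∏ p ∈ B ∪ A, (∑ r ∈ range p, w p r) / (p : ℝ) = GB * ∏ p ∈ A, g p := by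
      rw [prod_union hdisj]
      congr 1
      · exact prod_congr rfl fun p hp => by rw [sum_congr rfl fun r _ => hwB p hp r]
      · exact prod_congr rfl fun p hp => by rw [sum_congr rfl fun r _ => hwA p hp r]
    have e3 : ∏ p ∈ B ∪ A, ∑ r ∈ range p, w p r ≤ D := by
      rw [prod_union hdisj, prod_congr rfl fun p hp => sum_congr rfl fun r _ => hwB p hp r,
        prod_congr rfl fun p hp => sum_congr rfl fun r _ => hwA p hp r]
      have h1 : ∏ p ∈ B, ∑ r ∈ range p, y p r ≤ 1 :=
        prod_le_one (fun p _ => sum_nonneg fun r _ => hy0 p r) hy1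
      have h2 : ∏ p ∈ A, ∑ r ∈ range p, x p r ≤ ∏ p ∈ A, (p : ℝ) :=
        prod_le_prod (fun p _ => sum_nonneg fun r _ => hx0 p r) fun p hp => by
          have : (5 : ℝ) ≤ p := by exact_mod_cast (hSp p (hAS hp)).2.1
          linarith [hx4 p (hAS hp)]
      have h3 := prod_lt_of_admissible hadm (by norm_num) hD1 hzD
        (fun p hp => (hSp p (hAS hp)).1.two_le) (fun p hp => (hSp p (hAS hp)).2.2)
      have h4 : 0 ≤ ∏ p ∈ A, ∑ r ∈ range p, x p r :=
        prod_nonneg fun p _ => sum_nonneg fun r _ => hx0 p r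
      nlinarith
    rw [sum_congr rfl fun n _ => e1 n, e2] at key
    push_cast at key
    have hle := key.trans e3
    set T := ∑ n ∈ Ioc u v with n ≡ 5 [MOD 6], (∏ p ∈ B, y p n) * ∏ p ∈ A, x p n
    have habs : (-1) ^ #A * (T - ((v : ℝ) - u) / 6 * (GB * ∏ p ∈ A, g p)) ≤ D := by
      refine (le_abs_self _).trans ?_
      rwa [abs_mul, abs_pow, abs_neg, abs_one, one_pow, one_mul]
    linarith
  -- There are at most D admissible sets, each with remainder at most D; hence the error D².
  have hcard : (#(S.powerset.filter (Admissible 1 D)) : ℝ) ≤ D :=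
    card_le_of_prod_le _
      (fun A hA p hp => (hSp p (mem_powerset.1 (mem_filter.1 hA).1 hp)).1)
      (fun A hA => by
        obtain ⟨hAS, hadm⟩ := mem_filter.1 hA
        rw [mem_powerset] at hAS
        exact (prod_lt_of_admissible hadm (by norm_num) hD1 hzD
          (fun p hp => (hSp p (hAS hp)).1.two_le) (fun p hp => (hSp p (hAS hp)).2.2)).le)
      (by linarith)
  calc ∑ n ∈ Ioc u v with n ≡ 5 [MOD 6], (∏ p ∈ B, y p n) * ∏ p ∈ S, (1 - x p n)
      ≤ ∑ n ∈ Ioc u v with n ≡ 5 [MOD 6], (∏ p ∈ B, y p n) *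
        ∑ A ∈ S.powerset with Admissible 1 D A, (-1) ^ #A * ∏ p ∈ A, x p n :=
        sum_le_sum fun n _ => mul_le_mul_of_nonneg_left
          (prod_one_sub_le_sum_admissible D S _ (fun p _ => hx0 p n) fun p _ => hx1 p n)
          (prod_nonneg fun p _ => hy0 p n)
    _ = ∑ A ∈ S.powerset with Admissible 1 D A, (-1) ^ #A *
        ∑ n ∈ Ioc u v with n ≡ 5 [MOD 6], (∏ p ∈ B, y p n) * ∏ p ∈ A, x p n := by
        simp_rw [mul_sum]
        rw [sum_comm]
        exact sum_congr rfl fun A _ => sum_congr rfl fun n _ => by ring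
    _ ≤ ∑ A ∈ S.powerset with Admissible 1 D A,
        (((v : ℝ) - u) / 6 * GB * ((-1) ^ #A * ∏ p ∈ A, g p) + D) := sum_le_sum hA
    _ = ((v : ℝ) - u) / 6 * GB * (∑ A ∈ S.powerset with Admissible 1 D A,
        (-1) ^ #A * ∏ p ∈ A, g p) + #(S.powerset.filter (Admissible 1 D)) * D := by
        rw [sum_add_distrib, ← mul_sum, sum_const, nsmul_eq_mul]
    _ ≤ ((v : ℝ) - u) / 6 * GB * (C * ∏ p ∈ S, (1 - g p)) + D * D := by
        gcongr
        exact h z D S g hz hD hS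
          (fun p _ => div_nonneg (sum_nonneg fun r _ => hx0 p r) (by positivity))
          fun p hp => div_le_div_of_nonneg_right (hx4 p hp) (by positivity)
    _ ≤ _ := by
        have hV : 0 ≤ ∏ p ∈ S, (1 - g p) := prod_nonneg fun p hp => by
          have h5 : (5 : ℝ) ≤ p := by exact_mod_cast (hSp p hp).2.1
          have : g p ≤ 1 := by
            rw [hg]; simp only
            rw [div_le_one (by linarith)]; linarith [hx4 p hp]
          linarith
        have h2 : 0 ≤ C * ((v : ℝ) - u) * GB * ∏ p ∈ S, (1 - g p) := by positivity
        have : ((v : ℝ) - u) / 6 * GB * (C * ∏ p ∈ S, (1 - g p)) =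
            1 / 6 * (C * ((v : ℝ) - u) * GB * ∏ p ∈ S, (1 - g p)) := by ring
        nlinarith

/-! ### The pre-sieves as sums over sets of primes -/

lemma sievingProduct_eq (P : ℝ) : sievingProduct P = ∏ p ∈ sievePrimes P, p := rfl

lemma prime_of_mem_sievePrimes {z : ℝ} {p : ℕ} (hp : p ∈ sievePrimes z) : p.Prime :=
  (mem_sievePrimes.1 hp).1

lemma prod_dvd_of_forall_prime_dvd {A : Finset ℕ} {n : ℕ} (hA : ∀ p ∈ A, p.Prime)
    (h : ∀ p ∈ A, p ∣ n) : ∏ p ∈ A, p ∣ n :=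
  prod_primes_dvd n (fun p hp => (hA p hp).prime) h

lemma squarefree_sievingProduct (P : ℝ) : Squarefree (sievingProduct P) := by
  rw [sievingProduct_eq]
  refine (squarefree_prod_of_pairwise_isCoprime (R := ℕ) ?_ fun p hp =>
    (prime_of_mem_sievePrimes hp).squarefree)
  intro p hp q hq hpq
  exact Nat.coprime_iff_isRelPrime.1 ((Nat.coprime_primes (prime_of_mem_sievePrimes hp)
    (prime_of_mem_sievePrimes hq)).2 hpq)

open Classical in
/-- The divisor sum of a truncated Möbius function as a sum over sets of primes. -/
lemma sum_divisors_moebius_eq (P : ℝ) (Q : ℕ → Prop) (R : Finset ℕ → Prop)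
    (hQR : ∀ d, Q d ↔ R d.primeFactors) {n : ℕ} (hn : n ≠ 0) :
    ∑ d ∈ n.divisors, (if d ∣ sievingProduct P ∧ Q d then
      (ArithmeticFunction.moebius d : ℝ) else 0) =
    ∑ A ∈ (sievePrimes P).powerset with R A,
      (-1) ^ #A * ∏ p ∈ A, (if p ∣ n then (1 : ℝ) else 0) := by
  have hS : ∀ A ∈ (sievePrimes P).powerset, ∀ p ∈ A, p.Prime := fun A hA p hp =>
    prime_of_mem_sievePrimes (mem_powerset.1 hA hp)
  have h2 : ∑ A ∈ (sievePrimes P).powerset with R A,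
      (-1) ^ #A * ∏ p ∈ A, (if p ∣ n then (1 : ℝ) else 0) =
      ∑ A ∈ {A ∈ (sievePrimes P).powerset | R A ∧ ∀ p ∈ A, p ∣ n}, (-1 : ℝ) ^ #A := by
    rw [← filter_filter, sum_filter (p := fun A => ∀ p ∈ A, p ∣ n)]
    refine sum_congr rfl fun A _ => ?_
    rw [prod_ite_zero, prod_const_one]
    split_ifs <;> simp
  rw [h2, ← sum_filter]
  refine sum_nbij' Nat.primeFactors (fun A => ∏ p ∈ A, p) ?_ ?_ ?_ ?_ ?_
  · intro d hd
    simp only [mem_filter, Nat.mem_divisors, mem_powerset] at hd ⊢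
    refine ⟨fun p hp => ?_, (hQR d).1 hd.2.2, fun p hp =>
      (Nat.dvd_of_mem_primeFactors hp).trans hd.1.1⟩
    have hp' := Nat.prime_of_mem_primeFactors hp
    have h3 := (Nat.dvd_of_mem_primeFactors hp).trans hd.2.1
    rw [sievingProduct_eq] at h3
    obtain ⟨q, hq, hpq⟩ := (hp'.prime.dvd_finsetProd_iff _).1 h3
    rwa [(Nat.prime_dvd_prime_iff_eq hp' (prime_of_mem_sievePrimes hq)).1 hpq]
  · intro A hA
    simp only [mem_filter, Nat.mem_divisors] at hA ⊢
    have hAp := hS A hA.1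
    refine ⟨⟨prod_dvd_of_forall_prime_dvd hAp hA.2.2, hn⟩, ?_, ?_⟩
    · rw [sievingProduct_eq]
      exact prod_dvd_prod_of_subset _ _ _ (mem_powerset.1 hA.1)
    · rw [hQR, Nat.primeFactors_prod hAp]; exact hA.2.1
  · intro d hd
    simp only [mem_filter] at hd
    exact Nat.prod_primeFactors_of_squarefree
      ((squarefree_sievingProduct P).squarefree_of_dvd hd.2.1)
  · intro A hA
    exact Nat.primeFactors_prod (hS A (mem_filter.1 hA).1)
  · intro d hd
    simp only [mem_filter] at hd
    have hsq := Nat.prod_primeFactors_of_squarefree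
      ((squarefree_sievingProduct P).squarefree_of_dvd hd.2.1)
    conv_lhs => rw [← hsq]
    rw [ArithmeticFunction.isMultiplicative_moebius.map_prod_of_prime _
      fun p hp => Nat.prime_of_mem_primeFactors hp,
      prod_congr rfl fun p hp => ArithmeticFunction.moebius_apply_prime
        (Nat.prime_of_mem_primeFactors hp), prod_const]
    push_cast
    rfl

lemma betaPlus_iff (D : ℝ) (d : ℕ) : BetaPlus D d ↔ Admissible 1 D d.primeFactors := by
  simp only [BetaPlus, Admissible, primeFactorsGE, Nat.odd_iff]

lemma betaMinus_iff (D : ℝ) (d : ℕ) : BetaMinus D d ↔ Admissible 0 D d.primeFactors := by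
  simp only [BetaMinus, Admissible, primeFactorsGE, Nat.even_iff]

open Classical in
/-- The divisor sum of the beta sieve weights of parity `e`. -/
noncomputable def betaSum (e : ℕ) (P D : ℝ) (n : ℕ) : ℝ :=
  ∑ A ∈ (sievePrimes P).powerset with Admissible e D A,
    (-1) ^ #A * ∏ p ∈ A, (if p ∣ n then (1 : ℝ) else 0)

lemma sum_lambdaPlus_eq (P D : ℝ) {n : ℕ} (hn : n ≠ 0) :
    ∑ d ∈ n.divisors, lambdaPlus P D d = betaSum 1 P D n :=
  sum_divisors_moebius_eq P _ _ (betaPlus_iff D) hn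

lemma sum_lambdaMinus_eq (P D : ℝ) {n : ℕ} (hn : n ≠ 0) :
    ∑ d ∈ n.divisors, lambdaMinus P D d = betaSum 0 P D n :=
  sum_divisors_moebius_eq P _ _ (betaMinus_iff D) hn

open Classical in
-- Take x p to be the indicator of p ∣ n in Buchstab's identity: every term becomes plus or minus an
-- indicator, and A = ∅ stands for the full sifting product. No sign of the sieve is used, so both
-- parities are covered.
lemma abs_betaSum_le (e : ℕ) (P D : ℝ) (n : ℕ) :
    |betaSum e P D n| ≤ ∑ A ∈ (sievePrimes P).powerset with A = ∅ ∨ FirstFailure e D A,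
      if (∀ p ∈ A, p ∣ n) ∧ ∀ q ∈ sievePrimes P, (∀ a ∈ A, q < a) → ¬ q ∣ n
        then (1 : ℝ) else 0 := by
  rw [betaSum, sum_admissible_eq]
  have hterm : ∀ A : Finset ℕ, (if (∀ p ∈ A, p ∣ n) ∧
      ∀ q ∈ sievePrimes P, (∀ a ∈ A, q < a) → ¬ q ∣ n then (1 : ℝ) else 0) =
      (∏ p ∈ A, (if p ∣ n then (1 : ℝ) else 0)) *
        ∏ q ∈ sievePrimes P with ∀ a ∈ A, q < a, (1 - if q ∣ n then (1 : ℝ) else 0) := by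
    intro A
    have h1 : ∀ q : ℕ, (1 - if q ∣ n then (1 : ℝ) else 0) = if ¬ q ∣ n then 1 else 0 :=
      fun q => by split_ifs <;> simp_all
    simp_rw [h1]
    rw [prod_ite_zero, prod_ite_zero, prod_const_one, prod_const_one]
    simp only [mem_filter, and_imp]
    split_ifs <;> simp_all
  have hempty : ¬ FirstFailure e D ∅ := fun ⟨p, hp, _⟩ => by simp at hp
  have hset : {A ∈ (sievePrimes P).powerset | A = ∅ ∨ FirstFailure e D A} =
      insert ∅ {A ∈ (sievePrimes P).powerset | FirstFailure e D A} := by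
    ext A
    simp only [mem_filter, mem_insert, mem_powerset]
    constructor
    · rintro ⟨h, rfl | h'⟩ <;> simp_all
    · rintro (rfl | h)
      · simp
      · exact ⟨h.1, Or.inr h.2⟩
  rw [hset, sum_insert (by simp [hempty]), hterm ∅]
  have habs1 : ∀ q : ℕ, |(1 - if q ∣ n then (1 : ℝ) else 0)| =
      (1 - if q ∣ n then (1 : ℝ) else 0) := fun q => abs_of_nonneg (by split_ifs <;> simp)
  have habs2 : ∀ q : ℕ, |(if q ∣ n then (1 : ℝ) else 0)| =
      (if q ∣ n then (1 : ℝ) else 0) := fun q => abs_of_nonneg (by split_ifs <;> simp)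
  refine (abs_sub _ _).trans (add_le_add (le_of_eq ?_) ((abs_sum_le_sum_abs _ _).trans
    (sum_le_sum fun A _ => le_of_eq ?_)))
  · simp [abs_prod, habs1]
  · rw [hterm A, abs_mul, abs_mul, abs_pow, abs_neg, abs_one, one_pow, one_mul, abs_prod,
      abs_prod]
    simp only [habs1, habs2]

/-! ### Pointwise majorant for the four weights -/

/-- Every divisor pairs with its complement, so that half of the divisors of a square-free number
`n ≤ Y` are at most `√Y`. -/
lemma card_divisors_le {n : ℕ} (hn : Squarefree n) {Y : ℝ} (hY : (n : ℝ) ≤ Y) :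
    (#n.divisors : ℝ) ≤
      2 * #{A ∈ n.primeFactors.powerset | (∏ p ∈ A, ((p : ℕ) : ℝ)) ^ 2 ≤ Y} := by
  have hn0 := hn.ne_zero
  have h1 : #n.divisors ≤ #n.primeFactors.powerset := by
    refine card_le_card_of_injOn Nat.primeFactors (fun d hd => ?_) fun d hd d' hd' h => ?_
    · exact mem_coe.2 (mem_powerset.2 (Nat.primeFactors_mono (Nat.dvd_of_mem_divisors hd) hn0))
    · have e1 := Nat.prod_primeFactors_of_squarefree
        (hn.squarefree_of_dvd (Nat.dvd_of_mem_divisors hd))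
      have e2 := Nat.prod_primeFactors_of_squarefree
        (hn.squarefree_of_dvd (Nat.dvd_of_mem_divisors hd'))
      rw [← e1, ← e2, h]
  set G := {A ∈ n.primeFactors.powerset | (∏ p ∈ A, ((p : ℕ) : ℝ)) ^ 2 ≤ Y} with hG
  have h2 : #{A ∈ n.primeFactors.powerset | ¬ (∏ p ∈ A, ((p : ℕ) : ℝ)) ^ 2 ≤ Y} ≤ #G := by
    refine card_le_card_of_injOn (fun A => n.primeFactors \ A) (fun A hA => ?_)
      fun A hA B hB hAB => ?_
    · obtain ⟨hA1, hA2⟩ := mem_filter.1 (mem_coe.1 hA)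
      refine mem_coe.2 (mem_filter.2 ⟨mem_powerset.2 sdiff_subset, ?_⟩)
      have hprod : (∏ p ∈ n.primeFactors \ A, (p : ℝ)) * ∏ p ∈ A, (p : ℝ) = n := by
        rw [prod_sdiff (mem_powerset.1 hA1)]
        rw [← Nat.cast_prod, Nat.prod_primeFactors_of_squarefree hn]
      have ha : 0 ≤ ∏ p ∈ n.primeFactors \ A, (p : ℝ) := prod_nonneg fun _ _ => by positivity
      have hb : 0 ≤ ∏ p ∈ A, (p : ℝ) := prod_nonneg fun _ _ => by positivity
      rw [not_le] at hA2
      set a := ∏ p ∈ n.primeFactors \ A, (p : ℝ)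
      set b := ∏ p ∈ A, (p : ℝ)
      rcases le_or_gt a b with hab | hab
      · nlinarith
      · have : (1 : ℝ) ≤ n := by exact_mod_cast Nat.one_le_iff_ne_zero.2 hn0
        nlinarith
    · have hA1 := mem_powerset.1 (mem_filter.1 (mem_coe.1 hA)).1
      have hB1 := mem_powerset.1 (mem_filter.1 (mem_coe.1 hB)).1
      simp only at hAB
      rw [← Finset.sdiff_sdiff_eq_self hA1, hAB, Finset.sdiff_sdiff_eq_self hB1]
  have h3 := card_filter_add_card_filter_not (s := n.primeFactors.powerset)
    (fun A => (∏ p ∈ A, (p : ℝ)) ^ 2 ≤ Y)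
  rw [← hG] at h3
  have h4 : #n.divisors ≤ 2 * #G := by omega
  exact_mod_cast h4

/-- Sieving weights on `n`: forbidden classes `c i`, `i ≠ j`, and the class `c j` with
weight `h`. -/
noncomputable def sieveWeight (c : Fin 4 → ℤ) (h : ℕ → ℝ) (j : Fin 4) (p n : ℕ) : ℝ :=
  open Classical in
  if ∃ i, i ≠ j ∧ (n : ℤ) ≡ c i [ZMOD p] then 1
  else if (n : ℤ) ≡ c j [ZMOD p] then 1 - h p else 0

/-- Indicator of the congruence conditions modulo `p` imposed by a tuple of sets. -/
noncomputable def compatWeight (c : Fin 4 → ℤ) (A : Fin 4 → Finset ℕ) (p n : ℕ) : ℝ :=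
  open Classical in if ∀ i, p ∈ A i → (n : ℤ) ≡ c i [ZMOD p] then 1 else 0

/-- The weight of a prime in the `i`-th set of a tuple. -/
noncomputable def tupleWeight (h : ℕ → ℝ) (P : ℝ) (j : Fin 4) (k : ℕ) (i : Fin 4) (p : ℕ) : ℝ :=
  open Classical in
  if i = j then h p else if scale P k ≤ p ∧ (p : ℝ) < P then Real.exp 1 else 0

open Classical in
/-- The tuples of sets of primes over which we sum. -/
noncomputable def tuples (X Y D : ℝ) (j : Fin 4) : Finset (Fin 4 → Finset ℕ) :=
  {A ∈ Fintype.piFinset fun _ => (sievePrimes X).powerset |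
    (∏ p ∈ A j, (p : ℝ)) ^ 2 ≤ Y ∧ ∀ i, i ≠ j → ∏ p ∈ A i, (p : ℝ) ≤ D ^ 2}

/-- The product majorised in `prod_factorAt_le`. -/
noncomputable def factorAt (h : ℕ → ℝ) (P D : ℝ) (j : Fin 4) (e N : Fin 4 → ℕ) (i : Fin 4) : ℝ :=
  open Classical in
  if i = j then (#(N j).divisors : ℝ) * (if Squarefree (N j) then ∏ p ∈ (N j).primeFactors, h p
    else 0) else |betaSum (e i) P D (N i)|

lemma one_le_prod_of_one_le {ι : Type*} {s : Finset ι} {f : ι → ℝ} (h : ∀ i ∈ s, 1 ≤ f i) :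
    1 ≤ ∏ i ∈ s, f i := by
  simpa using prod_le_prod (f := fun _ : ι => (1 : ℝ)) (fun _ _ => zero_le_one) h

/-- One scale serves all three sieved forms: it is read off from the least prime p of the union of
their sets. If p^(2^k) < P, the set containing p already has 130k elements; the scale returned is k
+ 1, whence the shift by 130 in the exponent. If all sets are empty, scale 0 works. -/
lemma exists_scale_tuple {P D : ℝ} {j : Fin 4} {e : Fin 4 → ℕ} {A : Fin 4 → Finset ℕ} (hP : 2 ≤ P)
    (hD : P ^ 500 ≤ D) (hA : ∀ i, i ≠ j → A i ⊆ sievePrimes P)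
    (hF : ∀ i, i ≠ j → A i = ∅ ∨ FirstFailure (e i) D (A i)) :
    ∃ k : ℕ, 2 ≤ scale P k ∧ (∀ i, i ≠ j → ∀ a ∈ A i, scale P k ≤ a) ∧
      1 ≤ Real.exp (130 - 130 * k) * ∏ i ∈ univ.erase j, Real.exp 1 ^ #(A i) := by
  have hone : ∀ i ∈ univ.erase j, (1 : ℝ) ≤ Real.exp 1 ^ #(A i) := fun i _ =>
    one_le_pow₀ (Real.one_le_exp zero_le_one)
  by_cases hall : ∀ i, i ≠ j → A i = ∅
  · refine ⟨0, by rwa [scale_zero], fun i hi a ha => by simp [hall i hi] at ha, ?_⟩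
    refine one_le_mul_of_one_le_of_one_le (Real.one_le_exp (by norm_num)) ?_
    exact one_le_prod_of_one_le hone
  · push Not at hall
    obtain ⟨i₁, hi₁, hne₁⟩ := hall
    set U := (univ.erase j).biUnion A with hU
    have hUne : U.Nonempty := by
      obtain ⟨a, ha⟩ := hne₁
      exact ⟨a, mem_biUnion.2 ⟨i₁, mem_erase.2 ⟨hi₁, mem_univ _⟩, ha⟩⟩
    obtain ⟨i₀, hi₀, hp⟩ := mem_biUnion.1 (U.min'_mem hUne)
    set p := U.min' hUne with hpdef
    have hi₀j := (mem_erase.1 hi₀).1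
    have hpS := mem_sievePrimes.1 (hA i₀ hi₀j hp)
    obtain ⟨k, hk1, hk2, hk3⟩ := exists_scale hpS.2.1 hpS.2.2
    refine ⟨k + 1, hk1, fun i hi a ha => hk2.trans ?_, ?_⟩
    · exact_mod_cast U.min'_le a (mem_biUnion.2 ⟨i, mem_erase.2 ⟨hi, mem_univ _⟩, ha⟩)
    · have hFi : FirstFailure (e i₀) D (A i₀) :=
        (hF i₀ hi₀j).resolve_left fun h => by simp [h] at hp
      have hcard := card_ge_of_firstFailure (z := P) (by linarith) hD hFi
        (fun q hq => (mem_sievePrimes.1 (hA i₀ hi₀j hq)).1.two_le)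
        (fun q hq => (mem_sievePrimes.1 (hA i₀ hi₀j hq)).2.2) hp hk3
      have h1 : Real.exp 1 ^ #(A i₀) ≤ ∏ i ∈ univ.erase j, Real.exp 1 ^ #(A i) := by
        rw [← mul_prod_erase _ _ hi₀]
        exact le_mul_of_one_le_right (by positivity)
          (one_le_prod_of_one_le fun i hi => hone i (mem_of_mem_erase hi))
      refine le_trans ?_ (mul_le_mul_of_nonneg_left h1 (Real.exp_pos _).le)
      rw [← Real.exp_nat_mul, ← Real.exp_add]
      refine Real.one_le_exp ?_
      have : (130 * k : ℝ) ≤ #(A i₀) := by exact_mod_cast hcard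
      push_cast
      linarith

/-- Pointwise majorant for the product of the four weights. -/
lemma prod_factorAt_le {h : ℕ → ℝ} {P D X Y : ℝ} {j : Fin 4} {e N : Fin 4 → ℕ} {c : Fin 4 → ℤ}
    {n : ℕ} (hP : 2 ≤ P) (hD : P ^ 500 ≤ D) (he : ∀ i, e i < 2) (hPX : P ≤ X) (hYX : Y < X)
    (hh0 : ∀ p, 0 ≤ h p) (hh1 : ∀ p, h p ≤ 1) (hN6 : (N j).Coprime 6)
    (hNY : (N j : ℝ) ≤ Y)
    (hc : ∀ (i : Fin 4) (p : ℕ), p.Prime → ((n : ℤ) ≡ c i [ZMOD p] ↔ p ∣ N i)) :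
    ∏ i, factorAt h P D j e N i ≤ 2 * ∑ k ∈ range ⌈P⌉₊ with 2 ≤ scale P k,
      Real.exp (130 - 130 * k) * ∑ A ∈ tuples X Y D j,
        (∏ i, ∏ p ∈ A i, tupleWeight h P j k i p) *
          ((∏ p ∈ univ.biUnion A, compatWeight c A p n) *
            ∏ p ∈ sievePrimes (scale P k) \ A j, (1 - sieveWeight c h j p n)) := by
  classical
  have hsw : ∀ p, 0 ≤ 1 - sieveWeight c h j p n := fun p => by
    unfold sieveWeight; split_ifs <;> simp [hh0]
  have htw : ∀ k i p, 0 ≤ tupleWeight h P j k i p := fun k i p => by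
    unfold tupleWeight; split_ifs <;> simp [hh0, (Real.exp_pos 1).le]
  have hcw : ∀ A p, 0 ≤ compatWeight c A p n := fun A p => by
    unfold compatWeight; split_ifs <;> simp
  have hinner : ∀ k A, 0 ≤ (∏ i, ∏ p ∈ A i, tupleWeight h P j k i p) *
      ((∏ p ∈ univ.biUnion A, compatWeight c A p n) *
        ∏ p ∈ sievePrimes (scale P k) \ A j, (1 - sieveWeight c h j p n)) := fun k A =>
    mul_nonneg (prod_nonneg fun i _ => prod_nonneg fun p _ => htw k i p)
      (mul_nonneg (prod_nonneg fun p _ => hcw A p) (prod_nonneg fun p _ => hsw p))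
  have hR0 : 0 ≤ 2 * ∑ k ∈ range ⌈P⌉₊ with 2 ≤ scale P k,
      Real.exp (130 - 130 * k) * ∑ A ∈ tuples X Y D j,
        (∏ i, ∏ p ∈ A i, tupleWeight h P j k i p) *
          ((∏ p ∈ univ.biUnion A, compatWeight c A p n) *
            ∏ p ∈ sievePrimes (scale P k) \ A j, (1 - sieveWeight c h j p n)) :=
    mul_nonneg (by norm_num) (sum_nonneg fun k _ => mul_nonneg (Real.exp_pos _).le
      (sum_nonneg fun A _ => hinner k A))
  rw [← mul_prod_erase _ _ (mem_univ j)]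
  by_cases hsq : Squarefree (N j)
  swap
  · have : factorAt h P D j e N j = 0 := by simp [factorAt, hsq]
    rw [this, zero_mul]; exact hR0
  have hNj0 : N j ≠ 0 := hsq.ne_zero
  have hD1 : 1 < D := (one_lt_pow₀ (by linarith) (by norm_num)).trans_le hD
  have hPD : P ≤ D := (le_self_pow₀ (by linarith) (by norm_num)).trans hD
  set t : Fin 4 → Finset ℕ → ℝ := fun i A => if i = j then ∏ p ∈ (N j).primeFactors, h p else
    if (∀ p ∈ A, p ∣ N i) ∧ ∀ q ∈ sievePrimes P, (∀ a ∈ A, q < a) → ¬ q ∣ N i then 1 else 0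
    with ht
  set 𝒰 : Fin 4 → Finset (Finset ℕ) := fun i => if i = j then
    {A ∈ (N j).primeFactors.powerset | (∏ p ∈ A, ((p : ℕ) : ℝ)) ^ 2 ≤ Y} else
    {A ∈ (sievePrimes P).powerset | A = ∅ ∨ FirstFailure (e i) D A} with h𝒰
  have hhN : 0 ≤ ∏ p ∈ (N j).primeFactors, h p := prod_nonneg fun p _ => hh0 p
  have hj : factorAt h P D j e N j ≤ 2 * ∑ A ∈ 𝒰 j, t j A := by
    simp only [factorAt, ht, h𝒰, if_true, if_pos hsq, sum_const, nsmul_eq_mul]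
    rw [← mul_assoc]
    exact mul_le_mul_of_nonneg_right (card_divisors_le hsq hNY) hhN
  have hi : ∀ i ∈ univ.erase j, factorAt h P D j e N i ≤ ∑ A ∈ 𝒰 i, t i A := fun i hi => by
    have hij := (mem_erase.1 hi).1
    simp only [factorAt, ht, h𝒰, if_neg hij]
    exact abs_betaSum_le _ _ _ _
  have ht0 : ∀ i A, 0 ≤ t i A := fun i A => by
    simp only [ht]; split_ifs <;> [exact hhN; exact zero_le_one; exact le_rfl]
  have hstep : factorAt h P D j e N j * ∏ i ∈ univ.erase j, factorAt h P D j e N i ≤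
      2 * ∑ A ∈ Fintype.piFinset 𝒰, ∏ i, t i (A i) := by
    -- The product of four sums becomes a sum over tuples, one set chosen from each family.
    rw [← prod_univ_sum, ← mul_prod_erase _ _ (mem_univ j), ← mul_assoc]
    refine mul_le_mul hj (prod_le_prod (fun i hi' => ?_) hi)
      (prod_nonneg fun i hi' => ?_) (mul_nonneg (by norm_num) (sum_nonneg fun A _ => ht0 j A))
    all_goals
      simp only [factorAt, if_neg (mem_erase.1 hi').1]
      exact abs_nonneg _
  refine hstep.trans (mul_le_mul_of_nonneg_left ?_ (by norm_num))
  -- Coprimality to 6 excludes 2 and 3, so the prime factors of the unsieved form also start at 5.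
  have hpf : (N j).primeFactors ⊆ sievePrimes X := fun p hp => by
    have hpp := Nat.prime_of_mem_primeFactors hp
    have hpd := Nat.dvd_of_mem_primeFactors hp
    refine mem_sievePrimes.2 ⟨hpp, ?_, ?_⟩
    · by_contra hlt
      have h2 := hpp.two_le
      have hpn : p ∣ 6 → False := fun h6 => by
        have := Nat.dvd_gcd hpd h6
        rw [hN6] at this
        exact hpp.one_lt.ne' (Nat.dvd_one.1 this)
      interval_cases p
      · exact hpn (by norm_num)
      · exact hpn (by norm_num)
      · exact absurd hpp (by norm_num)
    · have : (p : ℝ) ≤ N j := by exact_mod_cast Nat.le_of_dvd (Nat.pos_of_ne_zero hNj0) hpd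
      linarith
  have hSX : sievePrimes P ⊆ sievePrimes X := fun p hp => by
    rw [mem_sievePrimes] at hp ⊢
    exact ⟨hp.1, hp.2.1, hp.2.2.trans_le hPX⟩
  have hUsub : Fintype.piFinset 𝒰 ⊆ tuples X Y D j := by
    intro A hA
    rw [Fintype.mem_piFinset] at hA
    have hAj : A j ∈ 𝒰 j := hA j
    simp only [h𝒰, if_true, mem_filter, mem_powerset] at hAj
    have hAi : ∀ i, i ≠ j → A i ⊆ sievePrimes P ∧ (A i = ∅ ∨ FirstFailure (e i) D (A i)) := by
      intro i hij
      have := hA i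
      simpa only [h𝒰, if_neg hij, mem_filter, mem_powerset] using this
    refine mem_filter.2 ⟨Fintype.mem_piFinset.2 fun i => mem_powerset.2 ?_, hAj.2, fun i hij => ?_⟩
    · by_cases hij : i = j
      · subst hij; exact hAj.1.trans hpf
      · exact (hAi i hij).1.trans hSX
    · rcases (hAi i hij).2 with h0 | hF
      · rw [h0, prod_empty]; nlinarith
      · exact prod_le_of_firstFailure hF (he i) hD1 hPD
          (fun p hp => (mem_sievePrimes.1 ((hAi i hij).1 hp)).1.two_le)
          (fun p hp => (mem_sievePrimes.1 ((hAi i hij).1 hp)).2.2)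
  have hterm : ∀ A ∈ Fintype.piFinset 𝒰, ∏ i, t i (A i) ≤
      ∑ k ∈ range ⌈P⌉₊ with 2 ≤ scale P k, Real.exp (130 - 130 * k) *
        ((∏ i, ∏ p ∈ A i, tupleWeight h P j k i p) *
          ((∏ p ∈ univ.biUnion A, compatWeight c A p n) *
            ∏ p ∈ sievePrimes (scale P k) \ A j, (1 - sieveWeight c h j p n))) := by
    intro A hA
    rw [Fintype.mem_piFinset] at hA
    have hAj : A j ⊆ (N j).primeFactors := by
      have := hA j
      simp only [h𝒰, if_true, mem_filter, mem_powerset] at this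
      exact this.1
    have hAi : ∀ i, i ≠ j → A i ⊆ sievePrimes P ∧ (A i = ∅ ∨ FirstFailure (e i) D (A i)) := by
      intro i hij
      have := hA i
      simpa only [h𝒰, if_neg hij, mem_filter, mem_powerset] using this
    by_cases hgood : ∀ i, i ≠ j → (∀ p ∈ A i, p ∣ N i) ∧
        ∀ q ∈ sievePrimes P, (∀ a ∈ A i, q < a) → ¬ q ∣ N i
    swap
    · push Not at hgood
      obtain ⟨i, hij, hbad⟩ := hgood
      have : t i (A i) = 0 := by
        simp only [ht, if_neg hij]
        rw [if_neg]
        rintro ⟨h1, h2⟩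
        obtain ⟨q, hq, hqa, hqd⟩ := hbad h1
        exact h2 q hq hqa hqd
      rw [prod_eq_zero (mem_univ i) this]
      exact sum_nonneg fun k _ => mul_nonneg (Real.exp_pos _).le (hinner k A)
    obtain ⟨k, hk2, hkA, hk1⟩ := exists_scale_tuple hP hD (fun i hi => (hAi i hi).1)
      fun i hi => (hAi i hi).2
    have hkmem : k ∈ (range ⌈P⌉₊).filter (fun k => 2 ≤ scale P k) :=
      mem_filter.2 ⟨mem_range.2 (lt_ceil_of_two_le_scale (by linarith) hk2), hk2⟩
    refine le_trans ?_ (single_le_sum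
      (fun k _ => mul_nonneg (Real.exp_pos _).le (hinner k A)) hkmem)
    have ht1 : ∏ i, t i (A i) = ∏ p ∈ (N j).primeFactors, h p := by
      rw [← mul_prod_erase _ _ (mem_univ j), prod_eq_one fun i hi => ?_, mul_one]
      · simp only [ht, if_true]
      · simp only [ht, if_neg (mem_erase.1 hi).1]
        rw [if_pos (hgood i (mem_erase.1 hi).1)]
    have hw : ∏ i, ∏ p ∈ A i, tupleWeight h P j k i p =
        (∏ p ∈ A j, h p) * ∏ i ∈ univ.erase j, Real.exp 1 ^ #(A i) := by
      rw [← mul_prod_erase _ _ (mem_univ j)]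
      congr 1
      · simp [tupleWeight]
      · refine prod_congr rfl fun i hi => ?_
        have hij := (mem_erase.1 hi).1
        rw [prod_congr rfl fun p hp => ?_, prod_const]
        simp only [tupleWeight, if_neg hij]
        rw [if_pos ⟨hkA i hij p hp, (mem_sievePrimes.1 ((hAi i hij).1 hp)).2.2⟩]
    have hcomp : ∏ p ∈ univ.biUnion A, compatWeight c A p n = 1 := by
      refine prod_eq_one fun p hp => ?_
      unfold compatWeight
      rw [if_pos]
      intro i hpi
      by_cases hij : i = j
      · subst hij
        exact (hc i p (Nat.prime_of_mem_primeFactors (hAj hpi))).2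
          (Nat.dvd_of_mem_primeFactors (hAj hpi))
      · exact (hc i p (prime_of_mem_sievePrimes ((hAi i hij).1 hpi))).2 ((hgood i hij).1 p hpi)
    -- For a contributing tuple no prime below the scale divides a sieved form, so each sifting
    -- factor is h p or 1 according to whether p divides `N j`. The right side is then a product of
    -- h over some of the primes on the left, and h ≤ 1.
    have hsieve : ∏ p ∈ (N j).primeFactors \ A j, h p ≤
        ∏ p ∈ sievePrimes (scale P k) \ A j, (1 - sieveWeight c h j p n) := by
      have e1 : ∏ p ∈ sievePrimes (scale P k) \ A j, (1 - sieveWeight c h j p n) =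
          ∏ p ∈ {p ∈ sievePrimes (scale P k) \ A j | p ∣ N j}, h p := by
        rw [prod_filter]
        refine prod_congr rfl fun p hp => ?_
        have hpS := mem_sievePrimes.1 (mem_sdiff.1 hp).1
        have hno : ¬ ∃ i, i ≠ j ∧ (n : ℤ) ≡ c i [ZMOD p] := by
          rintro ⟨i, hij, hci⟩
          refine (hgood i hij).2 p (mem_sievePrimes.2 ⟨hpS.1, hpS.2.1,
            hpS.2.2.trans_le (scale_le (by linarith) k)⟩) (fun a ha => ?_) ((hc i p hpS.1).1 hci)
          exact_mod_cast hpS.2.2.trans_le (hkA i hij a ha)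
        unfold sieveWeight
        rw [if_neg hno]
        by_cases hd : p ∣ N j
        · rw [if_pos ((hc j p hpS.1).2 hd), if_pos hd]; ring
        · rw [if_neg (fun h' => hd ((hc j p hpS.1).1 h')), if_neg hd]; ring
      rw [e1]
      refine prod_le_prod_of_subset_of_le_one (fun p hp => ?_) (fun p _ => hh0 p) fun p _ => hh1 p
      obtain ⟨hp1, hp2⟩ := mem_filter.1 hp
      exact mem_sdiff.2 ⟨Nat.mem_primeFactors.2 ⟨prime_of_mem_sievePrimes (mem_sdiff.1 hp1).1,
        hp2, hNj0⟩, (mem_sdiff.1 hp1).2⟩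
    rw [ht1, hw, hcomp, one_mul, ← prod_sdiff hAj]
    have ha : 0 ≤ ∏ p ∈ A j, h p := prod_nonneg fun p _ => hh0 p
    have hb : 0 ≤ ∏ p ∈ sievePrimes (scale P k) \ A j, (1 - sieveWeight c h j p n) :=
      prod_nonneg fun p _ => hsw p
    calc (∏ p ∈ (N j).primeFactors \ A j, h p) * ∏ p ∈ A j, h p
        ≤ (∏ p ∈ sievePrimes (scale P k) \ A j, (1 - sieveWeight c h j p n)) *
          ∏ p ∈ A j, h p := by gcongr
      _ ≤ (Real.exp (130 - 130 * k) * ∏ i ∈ univ.erase j, Real.exp 1 ^ #(A i)) *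
          ((∏ p ∈ sievePrimes (scale P k) \ A j, (1 - sieveWeight c h j p n)) *
          ∏ p ∈ A j, h p) := le_mul_of_one_le_left (by positivity) hk1
      _ = _ := by ring
  calc ∑ A ∈ Fintype.piFinset 𝒰, ∏ i, t i (A i)
      ≤ ∑ A ∈ Fintype.piFinset 𝒰, ∑ k ∈ range ⌈P⌉₊ with 2 ≤ scale P k,
        Real.exp (130 - 130 * k) * ((∏ i, ∏ p ∈ A i, tupleWeight h P j k i p) *
          ((∏ p ∈ univ.biUnion A, compatWeight c A p n) *
            ∏ p ∈ sievePrimes (scale P k) \ A j, (1 - sieveWeight c h j p n))) :=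
        sum_le_sum hterm
    _ ≤ ∑ A ∈ tuples X Y D j, ∑ k ∈ range ⌈P⌉₊ with 2 ≤ scale P k,
        Real.exp (130 - 130 * k) * ((∏ i, ∏ p ∈ A i, tupleWeight h P j k i p) *
          ((∏ p ∈ univ.biUnion A, compatWeight c A p n) *
            ∏ p ∈ sievePrimes (scale P k) \ A j, (1 - sieveWeight c h j p n))) :=
        sum_le_sum_of_subset_of_nonneg hUsub fun A _ _ => sum_nonneg fun k _ =>
          mul_nonneg (Real.exp_pos _).le (hinner k A)
    _ = _ := by
        rw [sum_comm]
        exact sum_congr rfl fun k _ => by rw [mul_sum]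

/-! ### Local densities of the sieve -/

lemma natCast_mod_modEq_iff (a : ℤ) (p n : ℕ) :
    ((n % p : ℕ) : ℤ) ≡ a [ZMOD p] ↔ (n : ℤ) ≡ a [ZMOD p] := by
  rw [Int.ModEq, Int.ModEq]
  push_cast
  rw [Int.emod_emod]

lemma sieveWeight_mod (c : Fin 4 → ℤ) (h : ℕ → ℝ) (j : Fin 4) (p n : ℕ) :
    sieveWeight c h j p (n % p) = sieveWeight c h j p n := by
  simp only [sieveWeight, natCast_mod_modEq_iff]

lemma compatWeight_mod (c : Fin 4 → ℤ) (A : Fin 4 → Finset ℕ) (p n : ℕ) :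
    compatWeight c A p (n % p) = compatWeight c A p n := by
  simp only [compatWeight, natCast_mod_modEq_iff]

lemma sum_ite_modEq_le_one (a : ℤ) (p : ℕ) :
    ∑ r ∈ range p, (if (r : ℤ) ≡ a [ZMOD p] then (1 : ℝ) else 0) ≤ 1 := by
  rw [sum_ite, sum_const_zero, add_zero, sum_const, nsmul_eq_mul, mul_one]
  have : #{r ∈ range p | ((r : ℕ) : ℤ) ≡ a [ZMOD p]} ≤ 1 := by
    refine card_le_one.2 fun r hr s hs => ?_
    simp only [mem_filter, mem_range] at hr hs
    have h := hr.2.trans hs.2.symm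
    rw [Int.natCast_modEq_iff] at h
    exact h.eq_of_lt_of_lt hr.1 hs.1
  exact_mod_cast this

lemma sum_sieveWeight_le {c : Fin 4 → ℤ} {h : ℕ → ℝ} {j : Fin 4} (hh0 : ∀ p, 0 ≤ h p) (p : ℕ) :
    ∑ r ∈ range p, sieveWeight c h j p r ≤ 4 := by
  have h1 : ∀ r, sieveWeight c h j p r ≤
      ∑ i : Fin 4, if (r : ℤ) ≡ c i [ZMOD p] then (1 : ℝ) else 0 := by
    intro r
    have hnn : ∀ i ∈ (univ : Finset (Fin 4)),
        (0 : ℝ) ≤ if (r : ℤ) ≡ c i [ZMOD p] then (1 : ℝ) else 0 := fun i _ => by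
      split_ifs <;> simp
    have hone : ∀ i, (r : ℤ) ≡ c i [ZMOD p] →
        (1 : ℝ) ≤ ∑ i : Fin 4, if (r : ℤ) ≡ c i [ZMOD p] then (1 : ℝ) else 0 := fun i hi => by
      have := single_le_sum hnn (mem_univ i)
      rwa [if_pos hi] at this
    unfold sieveWeight
    split_ifs with h2 h3
    · obtain ⟨i, -, hi⟩ := h2
      exact hone i hi
    · have := hone j h3
      linarith [hh0 p]
    · exact sum_nonneg hnn
  calc ∑ r ∈ range p, sieveWeight c h j p r
      ≤ ∑ r ∈ range p, ∑ i : Fin 4, (if (r : ℤ) ≡ c i [ZMOD p] then (1 : ℝ) else 0) :=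
        sum_le_sum fun r _ => h1 r
    _ = ∑ i : Fin 4, ∑ r ∈ range p, (if (r : ℤ) ≡ c i [ZMOD p] then (1 : ℝ) else 0) := sum_comm
    _ ≤ ∑ i : Fin 4, (1 : ℝ) := sum_le_sum fun i _ => sum_ite_modEq_le_one (c i) p
    _ = 4 := by simp

/-- Each distinct root class contributes 1, except that the class of `c j` may contribute 1 - h p if
no other root shares it. -/
lemma le_sum_sieveWeight {c : Fin 4 → ℤ} {h : ℕ → ℝ} {j : Fin 4} (hh0 : ∀ p, 0 ≤ h p)
    {p : ℕ} (hp : p ≠ 0) :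
    (#(univ.image fun i => c i % (p : ℤ)) : ℝ) - h p ≤
      ∑ r ∈ range p, sieveWeight c h j p r := by
  classical
  have h1 : #(univ.image fun i => c i % (p : ℤ)) ≤
      #{r ∈ range p | ∃ i, ((r : ℕ) : ℤ) ≡ c i [ZMOD p]} := by
    refine (card_le_card (t := {r ∈ range p | ∃ i, ((r : ℕ) : ℤ) ≡ c i [ZMOD p]}.image
      (fun r : ℕ => (r : ℤ))) fun x hx => ?_).trans card_image_le
    obtain ⟨i, -, rfl⟩ := mem_image.1 hx
    have hp' : (0 : ℤ) < p := by exact_mod_cast Nat.pos_of_ne_zero hp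
    have h0 := Int.emod_nonneg (c i) hp'.ne'
    have hlt := Int.emod_lt_of_pos (c i) hp'
    refine mem_image.2 ⟨(c i % (p : ℤ)).toNat, mem_filter.2 ⟨mem_range.2 (by omega), i, ?_⟩,
      Int.toNat_of_nonneg h0⟩
    rw [Int.toNat_of_nonneg h0]
    exact Int.mod_modEq _ _
  have h2 : ∀ r : ℕ, (if ∃ i, (r : ℤ) ≡ c i [ZMOD p] then (1 : ℝ) else 0) -
      h p * (if (r : ℤ) ≡ c j [ZMOD p] then (1 : ℝ) else 0) ≤ sieveWeight c h j p r := by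
    intro r
    have hh := hh0 p
    unfold sieveWeight
    by_cases hj : (r : ℤ) ≡ c j [ZMOD p]
    · have hex : ∃ i, (r : ℤ) ≡ c i [ZMOD p] := ⟨j, hj⟩
      simp only [hj, hex, if_true]
      split_ifs <;> linarith
    · simp only [hj, if_false, mul_zero, sub_zero]
      by_cases hex : ∃ i, (r : ℤ) ≡ c i [ZMOD p]
      · obtain ⟨i, hi⟩ := hex
        have hij : i ≠ j := fun h => hj (h ▸ hi)
        rw [if_pos ⟨i, hi⟩, if_pos ⟨i, hij, hi⟩]
      · rw [if_neg hex]; split_ifs <;> simp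
  have h3 := sum_le_sum fun r (_ : r ∈ range p) => h2 r
  rw [sum_sub_distrib, ← mul_sum, ← sum_filter, sum_const, nsmul_eq_mul, mul_one] at h3
  have h4 := mul_le_mul_of_nonneg_left (sum_ite_modEq_le_one (c j) p) (hh0 p)
  have h5 : (#(univ.image fun i => c i % (p : ℤ)) : ℝ) ≤
      #{r ∈ range p | ∃ i, ((r : ℕ) : ℤ) ≡ c i [ZMOD p]} := by exact_mod_cast h1
  linarith

lemma sum_compatWeight_le {c : Fin 4 → ℤ} {A : Fin 4 → Finset ℕ} {p : ℕ}
    (hp : p ∈ univ.biUnion A) : ∑ r ∈ range p, compatWeight c A p r ≤ 1 := by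
  obtain ⟨i, -, hi⟩ := mem_biUnion.1 hp
  refine (sum_le_sum fun r _ => ?_).trans (sum_ite_modEq_le_one (c i) p)
  unfold compatWeight
  split_ifs with h1 h2
  · exact le_rfl
  · exact absurd (h1 i hi) h2
  · exact zero_le_one
  · exact le_rfl

/-! ### Euler products over tuples of sets of primes -/

/-- Euler product expansion of a sum over tuples of sets. -/
lemma sum_piFinset_powerset_eq (Q : Finset ℕ) (F : ℕ → Finset (Fin 4) → ℝ) :
    ∑ A ∈ Fintype.piFinset (fun _ : Fin 4 => Q.powerset), ∏ p ∈ Q, F p {i | p ∈ A i} =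
      ∏ p ∈ Q, ∑ S : Finset (Fin 4), F p S := by
  rw [prod_sum]
  refine sum_bij' (fun A _ => fun p _ => {i | p ∈ A i})
    (fun g _ => fun i => (Q.attach.filter fun x => i ∈ g x.1 x.2).map
      (Function.Embedding.subtype _)) ?_ ?_ ?_ ?_ ?_
  · intro A hA
    simp
  · intro g hg
    rw [Fintype.mem_piFinset]
    intro i
    rw [mem_powerset]
    intro p hp
    simp only [mem_map, mem_filter, mem_attach, true_and, Function.Embedding.coe_subtype] at hp
    obtain ⟨x, -, rfl⟩ := hp
    exact x.2
  · intro A hA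
    rw [Fintype.mem_piFinset] at hA
    funext i
    ext p
    simp only [mem_map, mem_filter, mem_attach, true_and, Function.Embedding.coe_subtype,
      mem_univ]
    constructor
    · rintro ⟨x, hx, rfl⟩; exact hx
    · exact fun h => ⟨⟨p, mem_powerset.1 (hA i) h⟩, h, rfl⟩
  · intro g hg
    funext p hp
    ext i
    simp [hp]
  · intro A hA
    exact (prod_attach Q fun p => F p {i | p ∈ A i}).symm

lemma prod_tuple_eq {Q : Finset ℕ} {A : Fin 4 → Finset ℕ} (hA : ∀ i, A i ⊆ Q)
    (w : Fin 4 → ℕ → ℝ) : ∏ i, ∏ p ∈ A i, w i p = ∏ p ∈ Q, ∏ i with p ∈ A i, w i p := by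
  have h1 : ∀ i, ∏ p ∈ A i, w i p = ∏ p ∈ Q, if p ∈ A i then w i p else 1 := fun i => by
    rw [← prod_filter]
    congr 1
    ext p
    simp only [mem_filter]
    exact ⟨fun h => ⟨hA i h, h⟩, fun h => h.2⟩
  rw [prod_congr rfl fun i _ => h1 i, prod_comm]
  exact prod_congr rfl fun p _ => by rw [prod_filter]

/-- The local factor of the sum over tuples. -/
noncomputable def localFactor (h : ℕ → ℝ) (P : ℝ) (j : Fin 4) (k p : ℕ) (S : Finset (Fin 4)) : ℝ :=
  open Classical in
  (∏ i ∈ S, tupleWeight h P j k i p) * (if S = ∅ then 1 else 1 / (p : ℝ)) *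
    (if j ∈ S ∧ (p : ℝ) < scale P k then (1 - 4 / (p : ℝ))⁻¹ else 1)

lemma tupleWeight_nonneg {h : ℕ → ℝ} (hh0 : ∀ p, 0 ≤ h p) (P : ℝ) (j : Fin 4) (k : ℕ) (i : Fin 4)
    (p : ℕ) : 0 ≤ tupleWeight h P j k i p := by
  unfold tupleWeight
  split_ifs
  · exact hh0 p
  · exact (Real.exp_pos 1).le
  · exact le_rfl

lemma four_div_le {p : ℕ} (hp : 5 ≤ p) : 4 / (p : ℝ) ≤ 4 / 5 := by
  have : (5 : ℝ) ≤ p := by exact_mod_cast hp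
  gcongr

lemma inv_one_sub_four_div_le {p : ℕ} (hp : 5 ≤ p) : (1 - 4 / (p : ℝ))⁻¹ ≤ 1 + 20 / p := by
  have h5 : (5 : ℝ) ≤ p := by exact_mod_cast hp
  have h4 := four_div_le hp
  rw [inv_le_iff_one_le_mul₀ (by linarith)]
  have : (1 + 20 / (p : ℝ)) * (1 - 4 / p) = 1 + 16 * ((p : ℝ) - 5) / p ^ 2 := by
    field_simp; ring
  rw [this]
  have : 0 ≤ 16 * ((p : ℝ) - 5) / p ^ 2 := div_nonneg (by linarith) (by positivity)
  linarith

lemma localFactor_nonneg {h : ℕ → ℝ} (hh0 : ∀ p, 0 ≤ h p) (P : ℝ) (j : Fin 4) (k : ℕ) {p : ℕ}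
    (hp : 5 ≤ p) (S : Finset (Fin 4)) : 0 ≤ localFactor h P j k p S := by
  have h4 := four_div_le hp
  unfold localFactor
  refine mul_nonneg (mul_nonneg (prod_nonneg fun i _ => tupleWeight_nonneg hh0 P j k i p) ?_) ?_
  · split_ifs <;> positivity
  · split_ifs
    · exact inv_nonneg.2 (by linarith)
    · exact zero_le_one

open Classical in
-- S records which sets of the tuple contain p. Outside the range from the scale to P only ∅ and {j}
-- contribute, giving h(p)/p up to 20/p², where the correction comes from (1 - 4/p)⁻¹. Inside that
-- range all subsets may occur, and (1 + h)(1 + e)^3 - 1 ≤ 2 · 3.72³ - 1 < 102.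
lemma sum_localFactor_le {h : ℕ → ℝ} {P : ℝ} {j : Fin 4} {k p : ℕ} (hh0 : ∀ p, 0 ≤ h p)
    (hh1 : ∀ p, h p ≤ 1) (hp : 5 ≤ p) :
    ∑ S : Finset (Fin 4), localFactor h P j k p S ≤
      Real.exp (h p / p + 20 * (1 / (p : ℝ) ^ 2) +
        if scale P k ≤ p ∧ (p : ℝ) < P then 102 * (1 / (p : ℝ)) else 0) := by
  have h5 : (5 : ℝ) ≤ p := by exact_mod_cast hp
  have h4 := four_div_le hp
  set w : Fin 4 → ℝ := fun i => tupleWeight h P j k i p with hw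
  have hw0 : ∀ i, 0 ≤ w i := fun i => tupleWeight_nonneg hh0 P j k i p
  set κ : ℝ := if (p : ℝ) < scale P k then (1 - 4 / (p : ℝ))⁻¹ else 1 with hκ
  have hinv1 : 1 ≤ (1 - 4 / (p : ℝ))⁻¹ := (one_le_inv₀ (by linarith)).2 (by
    have : 0 ≤ 4 / (p : ℝ) := by positivity
    linarith)
  have hκ1 : 1 ≤ κ := by rw [hκ]; split_ifs <;> [exact hinv1; exact le_rfl]
  have hF : ∀ S ∈ (univ : Finset (Finset (Fin 4))).erase ∅,
      localFactor h P j k p S ≤ κ / p * ∏ i ∈ S, w i := by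
    intro S hS
    have hS0 := (mem_erase.1 hS).1
    unfold localFactor
    rw [if_neg hS0]
    have hprod : 0 ≤ ∏ i ∈ S, w i := prod_nonneg fun i _ => hw0 i
    have hle : (if j ∈ S ∧ (p : ℝ) < scale P k then (1 - 4 / (p : ℝ))⁻¹ else 1) ≤ κ := by
      split_ifs with h1
      · rw [hκ, if_pos h1.2]
      · exact hκ1
    calc (∏ i ∈ S, w i) * (1 / (p : ℝ)) *
          (if j ∈ S ∧ (p : ℝ) < scale P k then (1 - 4 / (p : ℝ))⁻¹ else 1)
        ≤ (∏ i ∈ S, w i) * (1 / (p : ℝ)) * κ := by gcongr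
      _ = _ := by ring
  have hempty : localFactor h P j k p ∅ = 1 := by simp [localFactor]
  have hall : ∑ S : Finset (Fin 4), ∏ i ∈ S, w i = ∏ i, (1 + w i) := by
    rw [prod_one_add, powerset_univ]
  have htot : ∑ S : Finset (Fin 4), localFactor h P j k p S ≤
      1 + κ / p * (∏ i, (1 + w i) - 1) := by
    rw [← add_sum_erase _ _ (mem_univ (∅ : Finset (Fin 4))), hempty, ← hall,
      ← add_sum_erase _ (fun S : Finset (Fin 4) => ∏ i ∈ S, w i) (mem_univ (∅ : Finset (Fin 4))),
      prod_empty, add_sub_cancel_left, mul_sum]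
    exact add_le_add le_rfl (sum_le_sum hF)
  refine htot.trans ?_
  have hhp := hh0 p
  have hhp1 := hh1 p
  by_cases hmid : scale P k ≤ p ∧ (p : ℝ) < P
  · rw [if_pos hmid]
    have hκe : κ = 1 := by rw [hκ, if_neg (not_lt.2 hmid.1)]
    have hprod : ∏ i, (1 + w i) ≤ 103 := by
      rw [← mul_prod_erase _ _ (mem_univ j)]
      have h1 : ∏ i ∈ univ.erase j, (1 + w i) = (1 + Real.exp 1) ^ 3 := by
        have hwi : ∀ i ∈ univ.erase j, 1 + w i = 1 + Real.exp 1 := fun i hi => by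
          simp only [hw, tupleWeight, if_neg (mem_erase.1 hi).1, if_pos hmid]
        rw [prod_congr rfl hwi, prod_const, card_erase_of_mem (mem_univ j)]
        simp
      have h2 : w j = h p := by simp [hw, tupleWeight]
      have h3 : (1 + Real.exp 1) ^ 3 ≤ (3.72 : ℝ) ^ 3 :=
        pow_le_pow_left₀ (by positivity) (by linarith [Real.exp_one_lt_d9]) 3
      have h4 : (0 : ℝ) ≤ (1 + Real.exp 1) ^ 3 := by positivity
      rw [h1, h2]
      norm_num at h3 ⊢
      nlinarith
    rw [hκe]
    have : 1 / (p : ℝ) * (∏ i, (1 + w i) - 1) ≤ 102 * (1 / (p : ℝ)) := by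
      rw [mul_comm]
      exact mul_le_mul_of_nonneg_right (by linarith) (by positivity)
    refine le_trans ?_ (Real.add_one_le_exp _)
    have : 0 ≤ h p / p := by positivity
    have : 0 ≤ 20 * (1 / (p : ℝ) ^ 2) := by positivity
    linarith
  · rw [if_neg hmid]
    have hprod : ∏ i, (1 + w i) = 1 + h p := by
      rw [← mul_prod_erase _ _ (mem_univ j), prod_eq_one fun i hi => ?_, mul_one]
      · simp [hw, tupleWeight]
      · simp [hw, tupleWeight, (mem_erase.1 hi).1, hmid]
    have hκ20 : κ ≤ 1 + 20 / p := by
      rw [hκ]; split_ifs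
      · exact inv_one_sub_four_div_le hp
      · have : 0 ≤ 20 / (p : ℝ) := by positivity
        linarith
    rw [hprod, add_sub_cancel_left, add_zero]
    refine le_trans ?_ (Real.add_one_le_exp _)
    have : κ / p * h p ≤ (1 + 20 / p) / p * h p := by gcongr
    have e1 : (1 + 20 / (p : ℝ)) / p * h p = h p / p + 20 * (1 / (p : ℝ) ^ 2) * h p := by
      field_simp
    have : 20 * (1 / (p : ℝ) ^ 2) * h p ≤ 20 * (1 / (p : ℝ) ^ 2) :=
      mul_le_of_le_one_right (by positivity) hhp1
    linarith

lemma mem_tuples {X Y D : ℝ} {j : Fin 4} {A : Fin 4 → Finset ℕ} :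
    A ∈ tuples X Y D j ↔ (∀ i, A i ⊆ sievePrimes X) ∧ (∏ p ∈ A j, (p : ℝ)) ^ 2 ≤ Y ∧
      ∀ i, i ≠ j → ∏ p ∈ A i, (p : ℝ) ≤ D ^ 2 := by
  simp [tuples, Fintype.mem_piFinset]

/-- The j-th set has product at most √Y and the other three at most D² each. This counts the sieve
remainders to be added up. -/
lemma card_tuples_le {X Y D : ℝ} {j : Fin 4} :
    (#(tuples X Y D j) : ℝ) ≤ √Y * D ^ 6 := by
  classical
  set 𝒱 : Fin 4 → Finset (Finset ℕ) := fun i =>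
    {A ∈ (sievePrimes X).powerset | ∏ p ∈ A, ((p : ℕ) : ℝ) ≤ if i = j then √Y else D ^ 2} with h𝒱
  have hsub : tuples X Y D j ⊆ Fintype.piFinset 𝒱 := fun A hA => by
    obtain ⟨h1, h2, h3⟩ := mem_tuples.1 hA
    refine Fintype.mem_piFinset.2 fun i => mem_filter.2 ⟨mem_powerset.2 (h1 i), ?_⟩
    split_ifs with hij
    · subst hij; exact Real.le_sqrt_of_sq_le h2
    · exact h3 i hij
  have hcard : ∀ i, (#(𝒱 i) : ℝ) ≤ if i = j then √Y else D ^ 2 := fun i =>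
    card_le_of_prod_le _ (fun A hA p hp => prime_of_mem_sievePrimes
      (mem_powerset.1 (mem_filter.1 hA).1 hp)) (fun A hA => (mem_filter.1 hA).2)
      (by split_ifs <;> positivity)
  calc (#(tuples X Y D j) : ℝ) ≤ #(Fintype.piFinset 𝒱) := by exact_mod_cast card_le_card hsub
    _ = ∏ i, (#(𝒱 i) : ℝ) := by rw [Fintype.card_piFinset]; push_cast; rfl
    _ ≤ ∏ i, (if i = j then √Y else D ^ 2) :=
        prod_le_prod (fun i _ => by positivity) fun i _ => hcard i
    _ = √Y * D ^ 6 := by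
        rw [← mul_prod_erase _ _ (mem_univ j), if_pos rfl,
          prod_congr rfl fun i hi => if_neg (mem_erase.1 hi).1, prod_const,
          card_erase_of_mem (mem_univ j)]
        simp only [card_univ, Fintype.card_fin]
        ring

/-- Since e ≤ 3 < p, the weight of a set with index other than j is at most the product of its
primes. -/
lemma prod_tupleWeight_le {h : ℕ → ℝ} {P X Y D : ℝ} {j : Fin 4} {k : ℕ} (hh0 : ∀ p, 0 ≤ h p)
    (hh1 : ∀ p, h p ≤ 1) {A : Fin 4 → Finset ℕ} (hA : A ∈ tuples X Y D j) :
    ∏ i, ∏ p ∈ A i, tupleWeight h P j k i p ≤ D ^ 6 := by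
  obtain ⟨h1, h2, h3⟩ := mem_tuples.1 hA
  have hw := tupleWeight_nonneg hh0 P j k
  rw [← mul_prod_erase _ _ (mem_univ j)]
  have hj : ∏ p ∈ A j, tupleWeight h P j k j p ≤ 1 :=
    prod_le_one (fun p _ => hw j p) fun p _ => by simp [tupleWeight, hh1]
  have hi : ∏ i ∈ univ.erase j, ∏ p ∈ A i, tupleWeight h P j k i p ≤ D ^ 6 := by
    calc ∏ i ∈ univ.erase j, ∏ p ∈ A i, tupleWeight h P j k i p
        ≤ ∏ i ∈ univ.erase j, D ^ 2 := by
          refine prod_le_prod (fun i _ => prod_nonneg fun p _ => hw i p) fun i hi => ?_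
          have hij := (mem_erase.1 hi).1
          refine (prod_le_prod (fun p _ => hw i p) fun p hp => ?_).trans (h3 i hij)
          have h5 : (5 : ℝ) ≤ p := by exact_mod_cast (mem_sievePrimes.1 (h1 i hp)).2.1
          simp only [tupleWeight, if_neg hij]
          split_ifs
          · linarith [exp_one_le_three]
          · linarith
      _ = D ^ 6 := by
          rw [prod_const, card_erase_of_mem (mem_univ j)]
          simp only [card_univ, Fintype.card_fin]
          ring
  exact (mul_le_of_le_one_left (prod_nonneg fun i _ => prod_nonneg fun p _ => hw i p) hj).trans hi

/-- The local densities of the sieve. -/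
noncomputable def localDensity (c : Fin 4 → ℤ) (h : ℕ → ℝ) (j : Fin 4) (p : ℕ) : ℝ :=
  (∑ r ∈ range p, sieveWeight c h j p r) / p

lemma localDensity_le {c : Fin 4 → ℤ} {h : ℕ → ℝ} {j : Fin 4} (hh0 : ∀ p, 0 ≤ h p) (p : ℕ) :
    localDensity c h j p ≤ 4 / p :=
  div_le_div_of_nonneg_right (sum_sieveWeight_le hh0 p) (by positivity)

/-- The primes of `A j` are not sifted. Restoring their density factors costs at most (1 - 4/p)⁻¹
each, after which the sifting product no longer depends on A and the rest factorises over primes. -/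
lemma prod_densities_le {c : Fin 4 → ℤ} {h : ℕ → ℝ} {P X Y D : ℝ} {j : Fin 4} {k : ℕ}
    (hh0 : ∀ p, 0 ≤ h p) {A : Fin 4 → Finset ℕ} (hA : A ∈ tuples X Y D j) :
    (∏ i, ∏ p ∈ A i, tupleWeight h P j k i p) *
      ((∏ p ∈ univ.biUnion A, (∑ r ∈ range p, compatWeight c A p r) / (p : ℝ)) *
        ∏ p ∈ sievePrimes (scale P k) \ A j, (1 - localDensity c h j p)) ≤
    (∏ p ∈ sievePrimes (scale P k), (1 - localDensity c h j p)) *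
      ∏ p ∈ sievePrimes X, localFactor h P j k p {i | p ∈ A i} := by
  classical
  obtain ⟨hAX, -, -⟩ := mem_tuples.1 hA
  set Q := sievePrimes X
  set s := scale P k
  have hpos : ∀ z, ∀ p ∈ sievePrimes z, 0 < 1 - localDensity c h j p := fun z p hp => by
    linarith [localDensity_le (c := c) (j := j) hh0 p, four_div_le (mem_sievePrimes.1 hp).2.1]
  have e1 : ∏ p ∈ univ.biUnion A, (∑ r ∈ range p, compatWeight c A p r) / (p : ℝ) ≤
      ∏ p ∈ Q, if (univ.filter fun i => p ∈ A i) = ∅ then 1 else 1 / (p : ℝ) := by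
    have hB : univ.biUnion A = Q.filter fun p => ¬ (univ.filter fun i => p ∈ A i) = ∅ := by
      ext p
      simp only [mem_biUnion, mem_univ, true_and, mem_filter, filter_eq_empty_iff, not_forall,
        not_not]
      constructor
      · rintro ⟨i, hi⟩; exact ⟨hAX i hi, i, trivial, hi⟩
      · rintro ⟨-, i, -, hi⟩; exact ⟨i, hi⟩
    have h2 : ∏ p ∈ Q, (if (univ.filter fun i => p ∈ A i) = ∅ then 1 else 1 / (p : ℝ)) =
        ∏ p ∈ univ.biUnion A, 1 / (p : ℝ) := by
      rw [hB, prod_filter]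
      exact prod_congr rfl fun p _ => by split_ifs <;> rfl
    rw [h2]
    refine prod_le_prod (fun p _ => div_nonneg (sum_nonneg fun r _ => ?_) (by positivity))
      fun p hp => div_le_div_of_nonneg_right (sum_compatWeight_le hp) (by positivity)
    unfold compatWeight; split_ifs <;> simp
  have e2 : ∏ p ∈ sievePrimes s \ A j, (1 - localDensity c h j p) ≤
      (∏ p ∈ sievePrimes s, (1 - localDensity c h j p)) *
        ∏ p ∈ Q, if j ∈ (univ.filter fun i => p ∈ A i) ∧ (p : ℝ) < s
          then (1 - 4 / (p : ℝ))⁻¹ else 1 := by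
    have h1 : ∏ p ∈ Q, (if j ∈ (univ.filter fun i => p ∈ A i) ∧ (p : ℝ) < s
          then (1 - 4 / (p : ℝ))⁻¹ else 1) =
        ∏ p ∈ sievePrimes s ∩ A j, (1 - 4 / (p : ℝ))⁻¹ := by
      rw [← prod_filter]
      refine prod_congr ?_ fun _ _ => rfl
      ext p
      simp only [mem_filter, mem_univ, true_and, mem_inter]
      constructor
      · rintro ⟨hQ, hj, hs⟩
        have := mem_sievePrimes.1 hQ
        exact ⟨mem_sievePrimes.2 ⟨this.1, this.2.1, hs⟩, hj⟩
      · rintro ⟨hs, hj⟩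
        exact ⟨hAX j hj, hj, (mem_sievePrimes.1 hs).2.2⟩
    rw [h1, ← prod_inter_mul_prod_sdiff (sievePrimes s) (A j)]
    have h2 : 1 ≤ (∏ p ∈ sievePrimes s ∩ A j, (1 - localDensity c h j p)) *
        ∏ p ∈ sievePrimes s ∩ A j, (1 - 4 / (p : ℝ))⁻¹ := by
      rw [← prod_mul_distrib]
      refine one_le_prod_of_one_le fun p hp => ?_
      have hps := (mem_inter.1 hp).1
      have h4 := four_div_le (mem_sievePrimes.1 hps).2.1
      rw [← div_eq_mul_inv, one_le_div (by linarith)]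
      linarith [localDensity_le (c := c) (j := j) hh0 p]
    have h3 : 0 ≤ ∏ p ∈ sievePrimes s \ A j, (1 - localDensity c h j p) :=
      prod_nonneg fun p hp => (hpos _ p (mem_sdiff.1 hp).1).le
    calc ∏ p ∈ sievePrimes s \ A j, (1 - localDensity c h j p)
        ≤ ((∏ p ∈ sievePrimes s ∩ A j, (1 - localDensity c h j p)) *
          ∏ p ∈ sievePrimes s ∩ A j, (1 - 4 / (p : ℝ))⁻¹) *
          ∏ p ∈ sievePrimes s \ A j, (1 - localDensity c h j p) :=
          le_mul_of_one_le_left h3 h2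
      _ = _ := by ring
  have hfac : ∏ p ∈ Q, localFactor h P j k p {i | p ∈ A i} =
      (∏ i, ∏ p ∈ A i, tupleWeight h P j k i p) *
      ((∏ p ∈ Q, if (univ.filter fun i => p ∈ A i) = ∅ then 1 else 1 / (p : ℝ)) *
        ∏ p ∈ Q, if j ∈ (univ.filter fun i => p ∈ A i) ∧ (p : ℝ) < s
          then (1 - 4 / (p : ℝ))⁻¹ else 1) := by
    rw [prod_tuple_eq hAX, ← prod_mul_distrib, ← prod_mul_distrib]
    refine prod_congr rfl fun p _ => ?_
    unfold localFactor
    rw [mul_assoc]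
  rw [hfac]
  have hW : 0 ≤ ∏ i, ∏ p ∈ A i, tupleWeight h P j k i p :=
    prod_nonneg fun i _ => prod_nonneg fun p _ => tupleWeight_nonneg hh0 P j k i p
  have hV : 0 ≤ ∏ p ∈ sievePrimes s \ A j, (1 - localDensity c h j p) :=
    prod_nonneg fun p hp => (hpos _ p (mem_sdiff.1 hp).1).le
  have hB0 : 0 ≤ ∏ p ∈ Q, if (univ.filter fun i => p ∈ A i) = ∅ then 1 else 1 / (p : ℝ) :=
    prod_nonneg fun p _ => by split_ifs <;> positivity
  calc _ ≤ (∏ i, ∏ p ∈ A i, tupleWeight h P j k i p) *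
      ((∏ p ∈ Q, if (univ.filter fun i => p ∈ A i) = ∅ then 1 else 1 / (p : ℝ)) *
        ((∏ p ∈ sievePrimes s, (1 - localDensity c h j p)) *
        ∏ p ∈ Q, if j ∈ (univ.filter fun i => p ∈ A i) ∧ (p : ℝ) < s
          then (1 - 4 / (p : ℝ))⁻¹ else 1)) :=
        mul_le_mul_of_nonneg_left (mul_le_mul e1 e2 hV hB0) hW
    _ = _ := by ring

/-- Positivity allows the size constraints on tuples to be dropped, leaving a full product set and
hence an Euler product. The 40 is 20 times the bound 2 for the sum of 1/p². -/
lemma sum_tuples_localFactor_le {h : ℕ → ℝ} {P X Y D : ℝ} {j : Fin 4} {k : ℕ} {C₂ : ℝ}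
    (h₂ : ∑ p ∈ primesLT P with scale P k ≤ (p : ℕ), 1 / (p : ℝ) ≤ k + C₂)
    (hh0 : ∀ p, 0 ≤ h p) (hh1 : ∀ p, h p ≤ 1) :
    ∑ A ∈ tuples X Y D j, ∏ p ∈ sievePrimes X, localFactor h P j k p {i | p ∈ A i} ≤
      Real.exp (∑ p ∈ sievePrimes X, h p / p + 40 + 102 * (k + C₂)) := by
  classical
  have h5 : ∀ p ∈ sievePrimes X, 5 ≤ p := fun p hp => (mem_sievePrimes.1 hp).2.1
  calc ∑ A ∈ tuples X Y D j, ∏ p ∈ sievePrimes X, localFactor h P j k p {i | p ∈ A i}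
      ≤ ∑ A ∈ Fintype.piFinset (fun _ : Fin 4 => (sievePrimes X).powerset),
          ∏ p ∈ sievePrimes X, localFactor h P j k p {i | p ∈ A i} :=
        sum_le_sum_of_subset_of_nonneg (filter_subset _ _) fun A _ _ =>
          prod_nonneg fun p hp => localFactor_nonneg hh0 P j k (h5 p hp) _
    _ = ∏ p ∈ sievePrimes X, ∑ S : Finset (Fin 4), localFactor h P j k p S :=
        sum_piFinset_powerset_eq _ _
    _ ≤ ∏ p ∈ sievePrimes X, Real.exp (h p / p + 20 * (1 / (p : ℝ) ^ 2) +
        if scale P k ≤ p ∧ (p : ℝ) < P then 102 * (1 / (p : ℝ)) else 0) :=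
        prod_le_prod (fun p hp => sum_nonneg fun S _ => localFactor_nonneg hh0 P j k (h5 p hp) S)
          fun p hp => sum_localFactor_le hh0 hh1 (h5 p hp)
    _ ≤ _ := by
        rw [← Real.exp_sum, Real.exp_le_exp, sum_add_distrib, sum_add_distrib, ← mul_sum,
          ← sum_filter, ← mul_sum]
        have h3 : ∑ p ∈ sievePrimes X with scale P k ≤ (p : ℕ) ∧ ((p : ℕ) : ℝ) < P,
            1 / (p : ℝ) ≤ k + C₂ := by
          refine (sum_le_sum_of_subset_of_nonneg (fun p hp => ?_)
            fun _ _ _ => by positivity).trans h₂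
          simp only [mem_filter, mem_sievePrimes, mem_primesLT] at hp ⊢
          tauto
        linarith [sum_inv_sq_le_two (sievePrimes X)]

/-- Only primes below the scale are sifted. Extending the exponent -4/p to all primes below P costs
4(k + C₂). -/
lemma prod_localDensity_le {c : Fin 4 → ℤ} {h δ : ℕ → ℝ} {P X : ℝ} {j : Fin 4} {k : ℕ} {C₂ : ℝ}
    (hP : 1 ≤ P) (hPX : P ≤ X)
    (h₂ : ∑ p ∈ primesLT P with scale P k ≤ (p : ℕ), 1 / (p : ℝ) ≤ k + C₂)
    (hh0 : ∀ p, 0 ≤ h p) (hδ0 : ∀ p, 0 ≤ δ p)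
    (hδ : ∀ p ∈ sievePrimes P, 4 - δ p ≤ #(univ.image fun i => c i % (p : ℤ))) :
    ∏ p ∈ sievePrimes (scale P k), (1 - localDensity c h j p) ≤
      Real.exp (-4 * ∑ p ∈ sievePrimes P, 1 / (p : ℝ) + ∑ p ∈ sievePrimes P, δ p / p +
        ∑ p ∈ sievePrimes X, h p / p + 4 * (k + C₂)) := by
  classical
  have hsub : sievePrimes (scale P k) ⊆ sievePrimes P := fun p hp => by
    rw [mem_sievePrimes] at hp ⊢
    exact ⟨hp.1, hp.2.1, hp.2.2.trans_le (scale_le hP k)⟩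
  have hsubX : sievePrimes (scale P k) ⊆ sievePrimes X := fun p hp => by
    rw [mem_sievePrimes] at hp ⊢
    exact ⟨hp.1, hp.2.1, (hp.2.2.trans_le (scale_le hP k)).trans_le hPX⟩
  have hterm : ∀ p ∈ sievePrimes (scale P k), 1 - localDensity c h j p ≤
      Real.exp (-4 * (1 / (p : ℝ)) + δ p / p + h p / p) := fun p hp => by
    have hpp := prime_of_mem_sievePrimes hp
    have h1 := le_sum_sieveWeight (c := c) (j := j) hh0 hpp.ne_zero
    have h3 := hδ p (hsub hp)
    have h4 : (4 - δ p - h p) / p ≤ localDensity c h j p :=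
      div_le_div_of_nonneg_right (by linarith) (by positivity)
    have h5 : (4 - δ p - h p) / (p : ℝ) = 4 * (1 / (p : ℝ)) - δ p / p - h p / p := by ring
    refine le_trans ?_ (Real.add_one_le_exp _)
    linarith
  have hpos : ∀ p ∈ sievePrimes (scale P k), 0 ≤ 1 - localDensity c h j p := fun p hp => by
    linarith [localDensity_le (c := c) (j := j) hh0 p, four_div_le (mem_sievePrimes.1 hp).2.1]
  refine (prod_le_prod hpos hterm).trans ?_
  rw [← Real.exp_sum, Real.exp_le_exp, sum_add_distrib, sum_add_distrib, ← mul_sum]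
  have h6 : ∑ p ∈ sievePrimes (scale P k), δ p / (p : ℝ) ≤ ∑ p ∈ sievePrimes P, δ p / (p : ℝ) :=
    sum_le_sum_of_subset_of_nonneg hsub fun p _ _ => div_nonneg (hδ0 p) (by positivity)
  have h7 : ∑ p ∈ sievePrimes (scale P k), h p / (p : ℝ) ≤ ∑ p ∈ sievePrimes X, h p / (p : ℝ) :=
    sum_le_sum_of_subset_of_nonneg hsubX fun p _ _ => div_nonneg (hh0 p) (by positivity)
  have h8 : ∑ p ∈ sievePrimes P, 1 / (p : ℝ) ≤
      ∑ p ∈ sievePrimes (scale P k), 1 / (p : ℝ) + (k + C₂) := by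
    rw [← sum_sdiff hsub, add_comm]
    refine add_le_add le_rfl ((sum_le_sum_of_subset_of_nonneg (fun p hp => ?_)
      fun _ _ _ => by positivity).trans h₂)
    rw [mem_sdiff, mem_sievePrimes, mem_sievePrimes] at hp
    refine mem_filter.2 ⟨mem_primesLT.2 ⟨hp.1.1, hp.1.2.2⟩, ?_⟩
    by_contra hlt
    exact hp.2 ⟨hp.1.1, hp.1.2.1, not_le.1 hlt⟩
  linarith

/-! ### Average over n for fixed ξ -/

/-- The average of the product of the four weights over `n ≡ 5 (mod 6)`. -/
lemma exists_sum_prod_factorAt_le :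
    ∃ C : ℝ, 0 < C ∧ ∀ (P D X Y : ℝ) (j : Fin 4) (e : Fin 4 → ℕ) (L : Fin 4 → ℕ → ℕ)
      (c : Fin 4 → ℤ) (h δ : ℕ → ℝ) (u v : ℕ), 2 ≤ P → P ^ 500 ≤ D → (∀ i, e i < 2) → P ≤ X →
      0 ≤ Y → Y < X → (∀ p, 0 ≤ h p) → (∀ p, h p ≤ 1) → u ≤ v →
      (∀ n ∈ Ioc u v, n ≡ 5 [MOD 6] → (L j n).Coprime 6 ∧ (L j n : ℝ) ≤ Y ∧
        ∀ (i : Fin 4) (p : ℕ), p.Prime → ((n : ℤ) ≡ c i [ZMOD p] ↔ p ∣ L i n)) →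
      (∀ p, 0 ≤ δ p) →
      (∀ p ∈ sievePrimes P, 4 - δ p ≤ #(univ.image fun i => c i % (p : ℤ))) →
      ∑ n ∈ Ioc u v with n ≡ 5 [MOD 6], ∏ i, factorAt h P D j e (fun i => L i n) i ≤
        C * ((v : ℝ) - u) * Real.exp (-4 * ∑ p ∈ sievePrimes P, 1 / (p : ℝ) +
          ∑ p ∈ sievePrimes P, δ p / p + 2 * ∑ p ∈ sievePrimes X, h p / p) +
        C * (√Y * D ^ 14) := by
  obtain ⟨C₁, hC₁, hsieve⟩ := exists_sieve_le
  obtain ⟨C₂, hC₂, h₂⟩ := exists_sum_inv_primes_scale_le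
  refine ⟨4 * C₁ * Real.exp (170 + 106 * C₂) + 4 * Real.exp 130, by positivity, ?_⟩
  intro P D X Y j e L c h δ u v hP hD he hPX hY0 hYX hh0 hh1 huv hL hδ0 hδ
  classical
  have huv' : (0 : ℝ) ≤ (v : ℝ) - u := by
    have : (u : ℝ) ≤ v := by exact_mod_cast huv
    linarith
  set E := Real.exp (-4 * ∑ p ∈ sievePrimes P, 1 / (p : ℝ) +
    ∑ p ∈ sievePrimes P, δ p / p + 2 * ∑ p ∈ sievePrimes X, h p / p) with hE
  have hD0 : 0 ≤ D := (by positivity : (0 : ℝ) ≤ P ^ 500).trans hD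
  have hD1 : 1 ≤ D := (one_le_pow₀ (by linarith)).trans hD
  set W : ℕ → (Fin 4 → Finset ℕ) → ℝ := fun k A => ∏ i, ∏ p ∈ A i, tupleWeight h P j k i p with hW
  have hW0 : ∀ k A, 0 ≤ W k A := fun k A =>
    prod_nonneg fun i _ => prod_nonneg fun p _ => tupleWeight_nonneg hh0 P j k i p
  set V : ℕ → ℝ := fun k => ∏ p ∈ sievePrimes (scale P k), (1 - localDensity c h j p) with hV
  have hV0 : ∀ k, 0 ≤ V k := fun k => prod_nonneg fun p hp => by
    linarith [localDensity_le (c := c) (j := j) hh0 p, four_div_le (mem_sievePrimes.1 hp).2.1]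
  set F : ℕ → (Fin 4 → Finset ℕ) → ℝ := fun k A =>
    ∏ p ∈ sievePrimes X, localFactor h P j k p {i | p ∈ A i} with hF
  have hF0 : ∀ k A, 0 ≤ F k A := fun k A =>
    prod_nonneg fun p hp => localFactor_nonneg hh0 P j k (mem_sievePrimes.1 hp).2.1 _
  have hinner : ∀ k, 2 ≤ scale P k → ∀ A ∈ tuples X Y D j,
      W k A * ∑ n ∈ Ioc u v with n ≡ 5 [MOD 6], (∏ p ∈ univ.biUnion A, compatWeight c A p n) *
        ∏ p ∈ sievePrimes (scale P k) \ A j, (1 - sieveWeight c h j p n) ≤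
      C₁ * ((v : ℝ) - u) * (V k * F k A) + D ^ 8 := by
    intro k hk A hA
    obtain ⟨hAX, -, -⟩ := mem_tuples.1 hA
    by_cases hWz : W k A = 0
    · rw [hWz, zero_mul]
      have := hV0 k
      have := hF0 k A
      positivity
    -- A nonzero weight forces the primes of the sets other than `A j` to be at least the scale;
    -- this keeps the divisibility conditions and the sifting at disjoint primes.
    have hAi : ∀ i, i ≠ j → ∀ p ∈ A i, scale P k ≤ p := fun i hij p hp => by
      have h1 := (prod_ne_zero_iff.1 ((prod_ne_zero_iff.1 hWz) i (mem_univ i))) p hp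
      simp only [tupleWeight, if_neg hij, ne_eq, ite_eq_right_iff, not_forall] at h1
      exact h1.1.1
    have hdisj : Disjoint (univ.biUnion A) (sievePrimes (scale P k) \ A j) := by
      rw [disjoint_left]
      intro p hp hq
      obtain ⟨i, -, hi⟩ := mem_biUnion.1 hp
      obtain ⟨hq1, hq2⟩ := mem_sdiff.1 hq
      by_cases hij : i = j
      · subst hij; exact hq2 hi
      · exact absurd (mem_sievePrimes.1 hq1).2.2 (not_lt.2 (hAi i hij p hi))
    have key := hsieve (scale P k) D (sievePrimes (scale P k) \ A j) (univ.biUnion A) u v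
      (sieveWeight c h j) (compatWeight c A) (by linarith)
      ((pow_le_pow_left₀ (by linarith) (scale_le (by linarith) k) 500).trans hD) sdiff_subset hdisj
      (fun p hp => by
        obtain ⟨i, -, hi⟩ := mem_biUnion.1 hp
        have := mem_sievePrimes.1 (hAX i hi)
        exact ⟨this.1, this.2.1⟩)
      huv
      (fun p n => by unfold sieveWeight; split_ifs <;> simp [hh1])
      (fun p n => by unfold sieveWeight; split_ifs <;> simp [hh0])
      (fun p n => sieveWeight_mod c h j p n)
      (fun p n => by unfold compatWeight; split_ifs <;> simp)
      (fun p n => compatWeight_mod c A p n)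
      (fun p _ => sum_sieveWeight_le hh0 p) (fun p hp => sum_compatWeight_le hp)
    have h1 := mul_le_mul_of_nonneg_left key (hW0 k A)
    refine h1.trans ?_
    have h3 := prod_densities_le (c := c) (P := P) (k := k) hh0 hA
    have h4 : W k A * D ^ 2 ≤ D ^ 8 := by
      calc W k A * D ^ 2 ≤ D ^ 6 * D ^ 2 := by
            gcongr; exact prod_tupleWeight_le hh0 hh1 hA
        _ = D ^ 8 := by ring
    rw [mul_add]
    refine add_le_add ?_ h4
    have h5 := mul_le_mul_of_nonneg_left h3 (show 0 ≤ C₁ * ((v : ℝ) - u) by positivity)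
    refine le_trans (le_of_eq ?_) h5
    simp only [hW, localDensity]
    ring
  have hpoint : ∀ n ∈ (Ioc u v).filter (fun n => n ≡ 5 [MOD 6]),
      ∏ i, factorAt h P D j e (fun i => L i n) i ≤ 2 * ∑ k ∈ range ⌈P⌉₊ with 2 ≤ scale P k,
      Real.exp (130 - 130 * k) * ∑ A ∈ tuples X Y D j, W k A *
          ((∏ p ∈ univ.biUnion A, compatWeight c A p n) *
            ∏ p ∈ sievePrimes (scale P k) \ A j, (1 - sieveWeight c h j p n)) := by
    intro n hn
    obtain ⟨hn1, hn2⟩ := mem_filter.1 hn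
    obtain ⟨hcop, hLY, hc⟩ := hL n hn1 hn2
    exact prod_factorAt_le (N := fun i => L i n) hP hD he hPX hYX hh0 hh1 hcop hLY hc
  calc ∑ n ∈ Ioc u v with n ≡ 5 [MOD 6], ∏ i, factorAt h P D j e (fun i => L i n) i
      ≤ ∑ n ∈ Ioc u v with n ≡ 5 [MOD 6], 2 * ∑ k ∈ range ⌈P⌉₊ with 2 ≤ scale P k,
        Real.exp (130 - 130 * k) * ∑ A ∈ tuples X Y D j, W k A *
          ((∏ p ∈ univ.biUnion A, compatWeight c A p n) *
            ∏ p ∈ sievePrimes (scale P k) \ A j, (1 - sieveWeight c h j p n)) :=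
        sum_le_sum hpoint
    _ = 2 * ∑ k ∈ range ⌈P⌉₊ with 2 ≤ scale P k,
        Real.exp (130 - 130 * k) * ∑ A ∈ tuples X Y D j, W k A *
          ∑ n ∈ Ioc u v with n ≡ 5 [MOD 6], (∏ p ∈ univ.biUnion A, compatWeight c A p n) *
            ∏ p ∈ sievePrimes (scale P k) \ A j, (1 - sieveWeight c h j p n) := by
        rw [← mul_sum, sum_comm]
        congr 1
        refine sum_congr rfl fun k _ => ?_
        rw [← mul_sum, sum_comm]
        congr 1
        exact sum_congr rfl fun A _ => by rw [mul_sum]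
    _ ≤ 2 * ∑ k ∈ range ⌈P⌉₊ with 2 ≤ scale P k,
        (2 * C₁ * Real.exp (170 + 106 * C₂) * ((v : ℝ) - u) * E / 2 * Real.exp (-24 * k) +
          Real.exp 130 * (√Y * D ^ 14) * Real.exp (-130 * k)) := by
        -- Growth 4k from the sifting product and 102k from the tuples against -130k leaves
        -- exp(-24k). The remainder is D^8 per tuple, with at most √Y D^6 tuples.
        refine mul_le_mul_of_nonneg_left (sum_le_sum fun k hk => ?_) (by norm_num)
        have hk2 := (mem_filter.1 hk).2
        have hM := h₂ P k (by linarith) hk2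
        have hsumF : ∑ A ∈ tuples X Y D j, F k A ≤ _ :=
          sum_tuples_localFactor_le (Y := Y) (D := D) (j := j) hM hh0 hh1
        have hVk : V k ≤ _ :=
          prod_localDensity_le (c := c) (j := j) (by linarith) hPX hM hh0 hδ0 hδ
        have hVF : V k * ∑ A ∈ tuples X Y D j, F k A ≤
            E * Real.exp (40 + 106 * C₂) * Real.exp (106 * k) := by
          calc V k * ∑ A ∈ tuples X Y D j, F k A ≤ _ :=
                mul_le_mul hVk hsumF (sum_nonneg fun A _ => hF0 k A) (Real.exp_pos _).le
            _ = _ := by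
                rw [hE, ← Real.exp_add, ← Real.exp_add, ← Real.exp_add]
                congr 1
                ring
        calc Real.exp (130 - 130 * k) * ∑ A ∈ tuples X Y D j, W k A *
            ∑ n ∈ Ioc u v with n ≡ 5 [MOD 6], (∏ p ∈ univ.biUnion A, compatWeight c A p n) *
              ∏ p ∈ sievePrimes (scale P k) \ A j, (1 - sieveWeight c h j p n)
            ≤ Real.exp (130 - 130 * k) * ∑ A ∈ tuples X Y D j,
              (C₁ * ((v : ℝ) - u) * (V k * F k A) + D ^ 8) :=
              mul_le_mul_of_nonneg_left (sum_le_sum fun A hA => hinner k hk2 A hA)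
                (Real.exp_pos _).le
          _ = Real.exp (130 - 130 * k) * (C₁ * ((v : ℝ) - u) *
              (V k * ∑ A ∈ tuples X Y D j, F k A) + #(tuples X Y D j) * D ^ 8) := by
              rw [sum_add_distrib, ← mul_sum, ← mul_sum, sum_const, nsmul_eq_mul]
          _ ≤ Real.exp (130 - 130 * k) * (C₁ * ((v : ℝ) - u) *
              (E * Real.exp (40 + 106 * C₂) * Real.exp (106 * k)) + (√Y * D ^ 6) * D ^ 8) := by
              gcongr
              exact card_tuples_le
          _ = C₁ * ((v : ℝ) - u) * E * (Real.exp (130 - 130 * k) * Real.exp (40 + 106 * C₂) *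
                Real.exp (106 * k)) + Real.exp (130 - 130 * k) * (√Y * D ^ 14) := by ring
          _ = _ := by
              have e1 : Real.exp (130 - 130 * k) * Real.exp (40 + 106 * C₂) *
                  Real.exp (106 * k) = Real.exp (170 + 106 * C₂) * Real.exp (-24 * k) := by
                rw [← Real.exp_add, ← Real.exp_add, ← Real.exp_add]
                congr 1
                ring
              have e2 : Real.exp (130 - 130 * k) = Real.exp 130 * Real.exp (-130 * k) := by
                rw [← Real.exp_add]
                congr 1
                ring
              rw [e1, e2]; ring
    _ ≤ 2 * ∑ k ∈ range ⌈P⌉₊,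
        (2 * C₁ * Real.exp (170 + 106 * C₂) * ((v : ℝ) - u) * E / 2 * Real.exp (-24 * k) +
          Real.exp 130 * (√Y * D ^ 14) * Real.exp (-130 * k)) := by
        refine mul_le_mul_of_nonneg_left (sum_le_sum_of_subset_of_nonneg (filter_subset _ _)
          fun _ _ _ => by positivity) (by norm_num)
    _ ≤ 2 * (2 * C₁ * Real.exp (170 + 106 * C₂) * ((v : ℝ) - u) * E / 2 * 2 +
          Real.exp 130 * (√Y * D ^ 14) * 2) := by
        rw [sum_add_distrib, ← mul_sum, ← mul_sum]
        have a1 := sum_exp_neg_mul_le 24 (by norm_num) ⌈P⌉₊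
        have a2 := sum_exp_neg_mul_le 130 (by norm_num) ⌈P⌉₊
        gcongr
    _ ≤ _ := by
        have b1 : 0 ≤ ((v : ℝ) - u) * E := by positivity
        have b2 : 0 ≤ √Y * D ^ 14 := by positivity
        have b3 : 0 < Real.exp (170 + 106 * C₂) := Real.exp_pos _
        have b4 : 0 < Real.exp 130 := Real.exp_pos _
        have b5 : 0 ≤ Real.exp 130 * (((v : ℝ) - u) * E) := by positivity
        have b6 : 0 ≤ C₁ * Real.exp (170 + 106 * C₂) * (√Y * D ^ 14) := by positivity
        nlinarith

/-! ### Lower bound for the singular series -/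

lemma exp_sub_sq_le {t : ℝ} (ht : 0 ≤ t) : Real.exp (t - t ^ 2) ≤ 1 + t := by
  have h := Real.one_sub_inv_le_log_of_pos (show 0 < 1 + t by linarith)
  rw [← Real.le_log_iff_exp_le (by linarith)]
  refine le_trans ?_ h
  have : 1 - (1 + t)⁻¹ - (t - t ^ 2) = t ^ 3 / (1 + t) := by
    field_simp; ring
  have : 0 ≤ t ^ 3 / (1 + t) := by positivity
  linarith

lemma exp_sum_le_prod {S : Finset ℕ} (hS : ∀ p ∈ S, 5 ≤ p) {d : ℝ} (hd : 0 ≤ d) :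
    Real.exp (∑ p ∈ S, d / (p : ℝ) - 2 * d ^ 2) ≤ ∏ p ∈ S, (1 + d / ((p : ℝ) - 4)) := by
  calc Real.exp (∑ p ∈ S, d / (p : ℝ) - 2 * d ^ 2)
      ≤ Real.exp (∑ p ∈ S, (d / (p : ℝ) - (d / (p : ℝ)) ^ 2)) := by
        rw [Real.exp_le_exp, sum_sub_distrib]
        have h1 : ∑ p ∈ S, (d / (p : ℝ)) ^ 2 = d ^ 2 * ∑ p ∈ S, 1 / (p : ℝ) ^ 2 := by
          rw [mul_sum]; exact sum_congr rfl fun p _ => by ring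
        have h2 := mul_le_mul_of_nonneg_left (sum_inv_sq_le_two S) (sq_nonneg d)
        linarith
    _ = ∏ p ∈ S, Real.exp (d / (p : ℝ) - (d / (p : ℝ)) ^ 2) := Real.exp_sum _ _
    _ ≤ _ := by
        refine prod_le_prod (fun p _ => (Real.exp_pos _).le) fun p hp => ?_
        have h5 : (5 : ℝ) ≤ p := by exact_mod_cast hS p hp
        refine (exp_sub_sq_le (by positivity)).trans ?_
        have : d / (p : ℝ) ≤ d / ((p : ℝ) - 4) :=
          div_le_div_of_nonneg_left hd (by linarith) (by linarith)
        linarith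

/-- Each factor is p³(p - 4)/(p - 1)^4 > 0 and differs from 1 by O(p⁻²), so the product is the
exponential of a convergent sum of logarithms. -/
lemma tprod_singular_pos : 0 < ∏' p : {p : ℕ // p.Prime ∧ 5 ≤ p},
    (1 - (6 * (p : ℝ) ^ 2 - 4 * (p : ℝ) + 1) / ((p : ℝ) - 1) ^ 4) := by
  have h5 : ∀ p : {p : ℕ // p.Prime ∧ 5 ≤ p}, (5 : ℝ) ≤ p := fun p => by exact_mod_cast p.2.2
  have hpos : ∀ p : {p : ℕ // p.Prime ∧ 5 ≤ p},
      0 < 1 - (6 * (p : ℝ) ^ 2 - 4 * (p : ℝ) + 1) / ((p : ℝ) - 1) ^ 4 := fun p => by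
    have h := h5 p
    have h1 : (0 : ℝ) < ((p : ℝ) - 1) ^ 4 := pow_pos (by linarith) 4
    rw [sub_pos, div_lt_one h1]
    have : ((p : ℝ) - 1) ^ 4 - (6 * (p : ℝ) ^ 2 - 4 * (p : ℝ) + 1) = (p : ℝ) ^ 3 * (p - 4) := by
      ring
    have : (0 : ℝ) < (p : ℝ) ^ 3 * (p - 4) := mul_pos (by positivity) (by linarith)
    linarith
  have hsum : Summable fun p : {p : ℕ // p.Prime ∧ 5 ≤ p} =>
      -((6 * (p : ℝ) ^ 2 - 4 * (p : ℝ) + 1) / ((p : ℝ) - 1) ^ 4) := by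
    refine Summable.neg ?_
    have hs : Summable fun p : {p : ℕ // p.Prime ∧ 5 ≤ p} => 16 * (1 / (p : ℝ) ^ 2) :=
      ((Real.summable_one_div_nat_pow.2 (by norm_num : 1 < 2)).mul_left 16).subtype
        {p : ℕ | p.Prime ∧ 5 ≤ p}
    refine hs.of_nonneg_of_le (fun p => ?_) fun p => ?_
    · have h := h5 p
      exact div_nonneg (by nlinarith) (by positivity)
    · have h := h5 p
      have h1 : (4 / 5 * (p : ℝ)) ^ 4 ≤ ((p : ℝ) - 1) ^ 4 :=
        pow_le_pow_left₀ (by positivity) (by linarith) 4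
      have h2 : (0 : ℝ) < (4 / 5 * (p : ℝ)) ^ 4 := by positivity
      calc (6 * (p : ℝ) ^ 2 - 4 * (p : ℝ) + 1) / ((p : ℝ) - 1) ^ 4
          ≤ 6 * (p : ℝ) ^ 2 / (4 / 5 * (p : ℝ)) ^ 4 :=
            div_le_div₀ (by positivity) (by linarith) h2 h1
        _ = 6 * (5 / 4) ^ 4 * (1 / (p : ℝ) ^ 2) := by field_simp
        _ ≤ _ := by gcongr; norm_num
  have hlog := Real.summable_log_one_add_of_summable hsum
  have h := Real.rexp_tsum_eq_tprod (f := fun p : {p : ℕ // p.Prime ∧ 5 ≤ p} =>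
    1 - (6 * (p : ℝ) ^ 2 - 4 * (p : ℝ) + 1) / ((p : ℝ) - 1) ^ 4) hpos
    (by simpa only [sub_eq_add_neg] using hlog)
  rw [← h]
  exact Real.exp_pos _

/-- The product over all p is a fixed positive constant, so only the primes dividing m(m + 4) or m +
2 vary with m. The factor exp(-10) collects 2d² for d = 1 and d = 2 from `exp_sum_le_prod`. -/
lemma exists_le_singularSeries :
    ∃ c : ℝ, 0 < c ∧ ∀ m : ℕ, m ≡ 4 [MOD 6] →
      c * Real.exp (∑ p ∈ (m * (m + 4)).primeFactors with 5 ≤ p, 1 / (p : ℝ) +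
        ∑ p ∈ (m + 2).primeFactors with 5 ≤ p, 2 / (p : ℝ)) ≤ singularSeries m := by
  refine ⟨27 / 2 * (∏' p : {p : ℕ // p.Prime ∧ 5 ≤ p},
    (1 - (6 * (p : ℝ) ^ 2 - 4 * (p : ℝ) + 1) / ((p : ℝ) - 1) ^ 4)) * Real.exp (-10),
    mul_pos (mul_pos (by norm_num) tprod_singular_pos) (Real.exp_pos _), fun m hm => ?_⟩
  have hT := tprod_singular_pos
  rw [singularSeries, if_pos hm]
  set T := ∏' p : {p : ℕ // p.Prime ∧ 5 ≤ p},
    (1 - (6 * (p : ℝ) ^ 2 - 4 * (p : ℝ) + 1) / ((p : ℝ) - 1) ^ 4)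
  have h1 := exp_sum_le_prod (S := (m * (m + 4)).primeFactors.filter fun p => 5 ≤ p)
    (fun p hp => (mem_filter.1 hp).2) (zero_le_one)
  have h2 := exp_sum_le_prod (S := (m + 2).primeFactors.filter fun p => 5 ≤ p)
    (fun p hp => (mem_filter.1 hp).2) (zero_le_two)
  have h3 := mul_le_mul h1 h2 (Real.exp_pos _).le ((Real.exp_pos _).le.trans h1)
  rw [← Real.exp_add] at h3
  have h4 := mul_le_mul_of_nonneg_left h3 (show 0 ≤ 27 / 2 * T by positivity)
  rw [← mul_assoc] at h4
  refine le_trans (le_of_eq ?_) h4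
  rw [mul_assoc, ← Real.exp_add]
  congr 2
  ring

/-! ### The four linear forms and their roots modulo p -/

/-- The four linear forms `n`, `n + 2`, `m - n`, `m - n + 2`. -/
def forms (m : ℕ) (i : Fin 4) (n : ℕ) : ℕ := ![n, n + 2, m - n, m - n + 2] i

/-- The roots of the four linear forms. -/
def formRoots (m : ℕ) : Fin 4 → ℤ := ![0, -2, m, m + 2]

lemma modEq_formRoots_iff {m n : ℕ} (hn : n ≤ m) (i : Fin 4) (p : ℕ) :
    ((n : ℤ) ≡ formRoots m i [ZMOD p] ↔ p ∣ forms m i n) := by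
  rw [Int.modEq_iff_dvd, ← Int.natCast_dvd_natCast (m := p)]
  fin_cases i
  · simp [formRoots, forms]
  · have : (-2 : ℤ) - n = -(n + 2) := by ring
    simp [formRoots, forms, this, -neg_add_rev]
  · simp [formRoots, forms, Nat.cast_sub hn]
  · have : (m : ℤ) + 2 - n = m - n + 2 := by ring
    simp [formRoots, forms, Nat.cast_sub hn, this]

lemma coprime_six_iff (a : ℕ) : a.Coprime 6 ↔ a % 6 = 1 ∨ a % 6 = 5 := by
  rw [Nat.coprime_iff_gcd_eq_one, Nat.gcd_comm, Nat.gcd_rec]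
  have := Nat.mod_lt a (show 0 < 6 by norm_num)
  interval_cases a % 6 <;> simp

/-- The form carrying H_R brings no coprimality condition, but the other three already determine n
modulo 6, and then the fourth is coprime to 6 as well. -/
lemma modEq_five_of_coprime {m n : ℕ} (hn : n < m) (hm : m ≡ 4 [MOD 6]) (j : Fin 4)
    (h : ∀ i, i ≠ j → (forms m i n).Coprime 6) : n ≡ 5 [MOD 6] := by
  have hm' : m % 6 = 4 := hm
  have h' : ∀ i, i ≠ j → (forms m i n) % 6 = 1 ∨ (forms m i n) % 6 = 5 := fun i hi =>
    (coprime_six_iff _).1 (h i hi)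
  have h0 := h' 0
  have h1 := h' 1
  have h2 := h' 2
  have h3 := h' 3
  change n % 6 = 5
  fin_cases j <;> simp [forms] at h0 h1 h2 h3 <;> omega

lemma coprime_of_modEq_five {m n : ℕ} (hn : n < m) (hm : m ≡ 4 [MOD 6]) (h : n ≡ 5 [MOD 6])
    (i : Fin 4) : (forms m i n).Coprime 6 := by
  have hm' : m % 6 = 4 := hm
  have hn' : n % 6 = 5 := h
  rw [coprime_six_iff]
  fin_cases i <;> simp [forms] <;> omega

lemma forms_ne_zero {m n : ℕ} (hn : n < m) (hn0 : n ≠ 0) (i : Fin 4) : forms m i n ≠ 0 := by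
  fin_cases i <;> simp [forms] <;> omega

/-- The number of roots lost to coincidences modulo `p`. -/
noncomputable def rootDefect (m p : ℕ) : ℝ :=
  (if p ∣ m * (m + 4) then 1 else 0) + (if p ∣ m + 2 then 2 else 0)

lemma rootDefect_nonneg (m p : ℕ) : 0 ≤ rootDefect m p := by
  unfold rootDefect; split_ifs <;> norm_num

/-- The differences of the roots 0, -2, m, m + 2 are, up to sign, 2, m, m + 4 and twice m + 2. For p
∣ m + 2 two pairs merge but 0 and -2 stay apart; for p ∣ m or p ∣ m + 4 with p ∤ m + 2, three
classes survive because p divides neither 2 nor 4. -/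
lemma four_sub_rootDefect_le {m p : ℕ} (hp : p.Prime) (hp5 : 5 ≤ p) :
    4 - rootDefect m p ≤ #(univ.image fun i => formRoots m i % (p : ℤ)) := by
  have hne : ∀ a b : ℤ, ¬ (p : ℤ) ∣ a - b → a % (p : ℤ) ≠ b % (p : ℤ) := fun a b h h' =>
    h (Int.dvd_of_emod_eq_zero (Int.emod_eq_emod_iff_emod_sub_eq_zero.1 h'))
  have h2 : ¬ p ∣ 2 := fun h => by have := Nat.le_of_dvd (by norm_num) h; omega
  have h4 : ¬ p ∣ 4 := fun h => by have := Nat.le_of_dvd (by norm_num) h; omega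
  have hmem : ∀ i, formRoots m i % (p : ℤ) ∈ univ.image fun i => formRoots m i % (p : ℤ) :=
    fun i => mem_image_of_mem _ (mem_univ i)
  have n01 : (0 : ℤ) % p ≠ (-2) % p := hne _ _ (by
    rw [show (0 : ℤ) - (-2) = ((2 : ℕ) : ℤ) by norm_num, Int.natCast_dvd_natCast]; exact h2)
  have n23 : (m : ℤ) % p ≠ (m + 2) % p := hne _ _ (by
    rw [show (m : ℤ) - (m + 2) = -((2 : ℕ) : ℤ) by push_cast; ring, dvd_neg,
      Int.natCast_dvd_natCast]; exact h2)
  have n02 : ¬ p ∣ m → (0 : ℤ) % p ≠ m % p := fun h => hne _ _ (by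
    rw [show (0 : ℤ) - m = -((m : ℕ) : ℤ) by ring, dvd_neg, Int.natCast_dvd_natCast]; exact h)
  have n03 : ¬ p ∣ m + 2 → (0 : ℤ) % p ≠ (m + 2) % p := fun h => hne _ _ (by
    rw [show (0 : ℤ) - (m + 2) = -((m + 2 : ℕ) : ℤ) by push_cast; ring, dvd_neg,
      Int.natCast_dvd_natCast]; exact h)
  have n12 : ¬ p ∣ m + 2 → (-2 : ℤ) % p ≠ m % p := fun h => hne _ _ (by
    rw [show (-2 : ℤ) - m = -((m + 2 : ℕ) : ℤ) by push_cast; ring, dvd_neg,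
      Int.natCast_dvd_natCast]; exact h)
  have n13 : ¬ p ∣ m + 4 → (-2 : ℤ) % p ≠ (m + 2) % p := fun h => hne _ _ (by
    rw [show (-2 : ℤ) - (m + 2) = -((m + 4 : ℕ) : ℤ) by push_cast; ring, dvd_neg,
      Int.natCast_dvd_natCast]; exact h)
  have m0 := hmem 0
  have m1 := hmem 1
  have m2 := hmem 2
  have m3 := hmem 3
  set I := univ.image fun i => formRoots m i % (p : ℤ)
  change (0 : ℤ) % p ∈ I at m0
  change (-2 : ℤ) % p ∈ I at m1
  change (m : ℤ) % p ∈ I at m2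
  change ((m : ℤ) + 2) % p ∈ I at m3
  have hthree : ∀ a b c : ℤ, a ∈ I → b ∈ I → c ∈ I → a ≠ b → a ≠ c → b ≠ c → (3 : ℝ) ≤ #I := by
    intro a b c ha hb hc hab hac hbc
    have h1 : #({a, b, c} : Finset ℤ) = 3 := card_eq_three.2 ⟨a, b, c, hab, hac, hbc, rfl⟩
    have h2 : ({a, b, c} : Finset ℤ) ⊆ I := by
      simp [insert_subset_iff, ha, hb, hc]
    have := card_le_card h2
    rw [h1] at this
    exact_mod_cast this
  unfold rootDefect
  by_cases hm2 : p ∣ m + 2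
  · rw [if_pos hm2]
    have h1 : #({(0 : ℤ) % p, (-2 : ℤ) % p} : Finset ℤ) = 2 := card_pair n01
    have h3 : ({(0 : ℤ) % p, (-2 : ℤ) % p} : Finset ℤ) ⊆ I := by
      simp only [insert_subset_iff, singleton_subset_iff]
      exact ⟨m0, m1⟩
    have h5 : (2 : ℝ) ≤ #I := by
      have := card_le_card h3
      rw [h1] at this
      exact_mod_cast this
    split_ifs <;> linarith
  · rw [if_neg hm2]
    by_cases hm : p ∣ m
    · rw [if_pos (hm.mul_right _)]
      have := hthree _ _ _ m0 m1 m3 n01 (n03 hm2)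
        (n13 fun h => h4 ((Nat.dvd_add_right hm).1 h))
      linarith
    by_cases hm4 : p ∣ m + 4
    · rw [if_pos (hm4.mul_left _)]
      have := hthree _ _ _ m0 m1 m2 n01 (n02 hm) (n12 hm2)
      linarith
    · rw [if_neg fun h => (hp.dvd_mul.1 h).elim hm hm4]
      have h1 : #({(0 : ℤ) % p, (-2 : ℤ) % p, (m : ℤ) % p, ((m : ℤ) + 2) % p} : Finset ℤ) = 4 := by
        rw [card_insert_of_notMem, card_eq_three.2 ⟨_, _, _, n12 hm2, n13 hm4, n23, rfl⟩]
        simp only [mem_insert, mem_singleton, not_or]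
        exact ⟨n01, n02 hm, n03 hm2⟩
      have h3 : ({(0 : ℤ) % p, (-2 : ℤ) % p, (m : ℤ) % p, ((m : ℤ) + 2) % p} : Finset ℤ) ⊆ I := by
        simp only [insert_subset_iff, singleton_subset_iff]
        exact ⟨m0, m1, m2, m3⟩
      have := card_le_card h3
      rw [h1] at this
      have : (4 : ℝ) ≤ #I := by exact_mod_cast this
      linarith

lemma sum_rootDefect_le {m : ℕ} (hm : m ≠ 0) (P : ℝ) :
    ∑ p ∈ sievePrimes P, rootDefect m p / p ≤
      ∑ p ∈ (m * (m + 4)).primeFactors with 5 ≤ p, 1 / (p : ℝ) +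
        ∑ p ∈ (m + 2).primeFactors with 5 ≤ p, 2 / (p : ℝ) := by
  have h1 : ∀ p ∈ sievePrimes P, rootDefect m p / p =
      (if p ∣ m * (m + 4) then 1 / (p : ℝ) else 0) + (if p ∣ m + 2 then 2 / (p : ℝ) else 0) := by
    intro p _
    unfold rootDefect
    split_ifs <;> ring
  rw [sum_congr rfl h1, sum_add_distrib, ← sum_filter, ← sum_filter]
  refine add_le_add ?_ ?_ <;>
  · refine sum_le_sum_of_subset_of_nonneg (fun p hp => ?_) fun _ _ _ => by positivity
    obtain ⟨hp1, hp2⟩ := mem_filter.1 hp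
    have := mem_sievePrimes.1 hp1
    exact mem_filter.2 ⟨Nat.mem_primeFactors.2 ⟨this.1, hp2, by positivity⟩, this.2.1⟩

/-! ### The weights H_R and the integral over ξ -/

lemma exists_presieve_eq {P D : ℝ} {f : ℕ → ℝ}
    (hf : f = lowerPreSieve P D ∨ f = upperPreSieve P D) :
    ∃ e : ℕ, e < 2 ∧ ∀ n : ℕ, n ≠ 0 → f n = if n.Coprime 6 then
      (∏ p ∈ primesLT P, (1 - 1 / (p : ℝ))⁻¹) * betaSum e P D n else 0 := by
  rcases hf with rfl | rfl
  · exact ⟨0, by norm_num, fun n hn => by rw [lowerPreSieve, sum_lambdaMinus_eq P D hn]⟩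
  · exact ⟨1, by norm_num, fun n hn => by rw [upperPreSieve, sum_lambdaPlus_eq P D hn]⟩

/-- The values of `h_ξ` at primes. -/
noncomputable def hPrime (R ξ : ℝ) (p : ℕ) : ℝ :=
  min 1 (10 * (1 + |ξ|) * (Real.log p / Real.log R))

lemma hPrime_nonneg {R : ℝ} (hR : 0 < Real.log R) (ξ : ℝ) (p : ℕ) : 0 ≤ hPrime R ξ p :=
  le_min zero_le_one (by have := Real.log_natCast_nonneg p; positivity)

lemma hPrime_le_one (R ξ : ℝ) (p : ℕ) : hPrime R ξ p ≤ 1 := min_le_left _ _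

lemma hXi_nonneg {R : ℝ} (hR : 0 < Real.log R) (ξ : ℝ) (n : ℕ) : 0 ≤ hXi R ξ n := by
  unfold hXi
  split_ifs
  · exact prod_nonneg fun p _ => hPrime_nonneg hR ξ p
  · exact le_rfl

lemma hXi_le_one {R : ℝ} (hR : 0 < Real.log R) (ξ : ℝ) (n : ℕ) : hXi R ξ n ≤ 1 := by
  unfold hXi
  split_ifs
  · exact prod_le_one (fun p _ => hPrime_nonneg hR ξ p) fun p _ => hPrime_le_one R ξ p
  · exact zero_le_one

lemma continuous_hXi (R : ℝ) (n : ℕ) : Continuous fun ξ => hXi R ξ n := by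
  unfold hXi
  split_ifs
  · fun_prop
  · exact continuous_const

lemma integrable_one_add_abs_pow_six : Integrable fun ξ : ℝ => 1 / (1 + |ξ|) ^ 6 := by
  have h := integrable_one_add_norm (E := ℝ) (μ := volume) (r := 6) (by simp)
  refine h.congr (Filter.Eventually.of_forall fun ξ => ?_)
  simp only [Real.norm_eq_abs]
  rw [Real.rpow_neg (by positivity), one_div]
  norm_cast

lemma one_div_pow_ten_le (ξ : ℝ) : 1 / (1 + |ξ|) ^ 10 ≤ 1 / (1 + |ξ|) ^ 6 := by
  have : 1 ≤ 1 + |ξ| := by linarith [abs_nonneg ξ]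
  exact one_div_le_one_div_of_le (by positivity) (pow_le_pow_right₀ this (by norm_num))

lemma integrable_hXi_div {R : ℝ} (hR : 0 < Real.log R) (n : ℕ) :
    Integrable fun ξ : ℝ => hXi R ξ n / (1 + |ξ|) ^ 10 := by
  refine integrable_one_add_abs_pow_six.mono' ?_ (Filter.Eventually.of_forall fun ξ => ?_)
  · refine Continuous.aestronglyMeasurable ((continuous_hXi R n).div (by fun_prop) fun ξ => ?_)
    positivity
  · have h0 := hXi_nonneg hR ξ n
    rw [Real.norm_of_nonneg (by positivity)]
    refine le_trans ?_ (one_div_pow_ten_le ξ)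
    gcongr
    exact hXi_le_one hR ξ n

lemma factorAt_self (R ξ P D : ℝ) (j : Fin 4) (e N : Fin 4 → ℕ) :
    factorAt (hPrime R ξ) P D j e N j = (#(N j).divisors : ℝ) * hXi R ξ (N j) := by
  simp only [factorAt, if_true, hXi, hPrime]

lemma factorAt_of_ne (h : ℕ → ℝ) (P D : ℝ) {i j : Fin 4} (hij : i ≠ j) (e N : Fin 4 → ℕ) :
    factorAt h P D j e N i = |betaSum (e i) P D (N i)| := by
  simp only [factorAt, if_neg hij]

/-- The total weight of the primes in the Euler product, in terms of `ξ`. -/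
lemma exists_exp_sum_hPrime_le :
    ∃ C : ℝ, 0 < C ∧ ∀ (X R ε ξ : ℝ), 2 ≤ X → 0 < ε → ε ≤ 1 → 0 < Real.log R →
      ε * Real.log X ≤ 2 * Real.log R →
      Real.exp (2 * ∑ p ∈ sievePrimes X, hPrime R ξ p / p) ≤ C * (ε⁻¹ ^ 4 * (1 + |ξ|) ^ 4) := by
  obtain ⟨C, hC, h⟩ := exists_sum_min_log_div_le
  refine ⟨Real.exp (2 * C) * 21 ^ 4, by positivity, fun X R ε ξ hX hε hε1 hR hXR => ?_⟩
  have hξ : 1 ≤ 1 + |ξ| := by linarith [abs_nonneg ξ]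
  -- This l makes h_ξ(p) equal to min(1, log p / l). The final exponent 4 is the 2 in front of the
  -- sum times the 2 in `exists_sum_min_log_div_le`.
  set l := Real.log R / (10 * (1 + |ξ|)) with hl
  have hl0 : 0 < l := by positivity
  have h1 : ∑ p ∈ sievePrimes X, hPrime R ξ p / p ≤ 2 * Real.log (1 + Real.log X / l) + C := by
    refine le_trans ?_ (h X l hX hl0)
    calc ∑ p ∈ sievePrimes X, hPrime R ξ p / p ≤ ∑ p ∈ primesLT X, hPrime R ξ p / p :=
          sum_le_sum_of_subset_of_nonneg (filter_subset _ _) fun p _ _ =>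
            div_nonneg (hPrime_nonneg hR ξ p) (by positivity)
      _ = _ := by
          refine sum_congr rfl fun p _ => ?_
          have : 10 * (1 + |ξ|) * (Real.log p / Real.log R) = Real.log p / l := by
            rw [hl]; field_simp
          rw [hPrime, this]
  have hlX : 0 < Real.log X := Real.log_pos (by linarith)
  have h2 : 1 + Real.log X / l ≤ 21 * (ε⁻¹ * (1 + |ξ|)) := by
    have e1 : Real.log X / l = 10 * (1 + |ξ|) * (Real.log X / Real.log R) := by
      rw [hl]; field_simp
    have e2 : Real.log X / Real.log R ≤ 2 * ε⁻¹ := by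
      rw [div_le_iff₀ hR, mul_assoc, mul_comm ε⁻¹, ← mul_assoc, ← div_eq_mul_inv,
        le_div_iff₀ hε]
      linarith
    have e3 : 1 ≤ ε⁻¹ := (one_le_inv₀ hε).2 hε1
    have e4 : 1 ≤ ε⁻¹ * (1 + |ξ|) := one_le_mul_of_one_le_of_one_le e3 hξ
    rw [e1]
    have := mul_le_mul_of_nonneg_left e2 (show 0 ≤ 10 * (1 + |ξ|) by positivity)
    linarith
  have h3 : 0 < 1 + Real.log X / l := by positivity
  calc Real.exp (2 * ∑ p ∈ sievePrimes X, hPrime R ξ p / p)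
      ≤ Real.exp (2 * C + (4 : ℕ) * Real.log (1 + Real.log X / l)) := by
        rw [Real.exp_le_exp]; push_cast; linarith
    _ = Real.exp (2 * C) * (1 + Real.log X / l) ^ 4 := by
        rw [Real.exp_add, Real.exp_nat_mul, Real.exp_log h3]
    _ ≤ Real.exp (2 * C) * (21 * (ε⁻¹ * (1 + |ξ|))) ^ 4 := by gcongr
    _ = _ := by ring

lemma prod_primesLT_le_exp (P : ℝ) :
    ∏ p ∈ primesLT P, (1 - 1 / (p : ℝ))⁻¹ ≤
      Real.exp (∑ p ∈ sievePrimes P, 1 / (p : ℝ) + 11) := by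
  refine (prod_inv_one_sub_le_exp (S := primesLT P) fun p hp => ?_).trans ?_
  · have : (2 : ℝ) ≤ p := by exact_mod_cast (mem_primesLT.1 hp).1.two_le
    rw [div_le_iff₀ (by linarith)]; linarith
  · rw [Real.exp_le_exp]
    linarith [sum_primesLT_le P]

lemma prod_primesLT_nonneg (P : ℝ) : 0 ≤ ∏ p ∈ primesLT P, (1 - 1 / (p : ℝ))⁻¹ := by
  refine prod_nonneg fun p hp => inv_nonneg.2 ?_
  have : (2 : ℝ) ≤ p := by exact_mod_cast (mem_primesLT.1 hp).1.two_le
  have : 1 / (p : ℝ) ≤ 1 := by rw [div_le_one (by linarith)]; linarith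
  linarith

/-- A crude polynomial bound, needed only in the error term. Taking l = log 2 makes every minimum
equal to 1. -/
lemma exists_exp_sum_inv_le :
    ∃ C : ℝ, 0 < C ∧ ∀ P : ℝ, 2 ≤ P → Real.exp (∑ p ∈ sievePrimes P, 1 / (p : ℝ)) ≤ C * P ^ 2 := by
  obtain ⟨C, hC, h⟩ := exists_sum_min_log_div_le
  refine ⟨Real.exp C * 4, by positivity, fun P hP => ?_⟩
  have hl2 : 0 < Real.log 2 := Real.log_pos (by norm_num)
  have hlP : 0 < Real.log P := Real.log_pos (by linarith)
  have h1 : ∑ p ∈ sievePrimes P, 1 / (p : ℝ) ≤ 2 * Real.log (1 + Real.log P / Real.log 2) + C := by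
    refine le_trans ?_ (h P _ hP hl2)
    refine (sum_le_sum fun p hp => ?_).trans (sum_le_sum_of_subset_of_nonneg (filter_subset _ _)
      fun p hp _ => ?_)
    · rw [min_eq_left]
      rw [one_le_div hl2]
      exact Real.log_le_log (by norm_num)
        (by exact_mod_cast (prime_of_mem_sievePrimes hp).two_le)
    · have := Real.log_natCast_nonneg p
      positivity
  have h2 : 1 + Real.log P / Real.log 2 ≤ 2 * P := by
    have e1 : Real.log P / Real.log 2 ≤ 2 * (P - 1) := by
      rw [div_le_iff₀ hl2]
      have := Real.log_le_sub_one_of_pos (show 0 < P by linarith)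
      nlinarith [Real.log_two_gt_d9]
    linarith
  have h3 : 0 < 1 + Real.log P / Real.log 2 := by positivity
  calc Real.exp (∑ p ∈ sievePrimes P, 1 / (p : ℝ))
      ≤ Real.exp (C + (2 : ℕ) * Real.log (1 + Real.log P / Real.log 2)) := by
        rw [Real.exp_le_exp]; push_cast; linarith
    _ = Real.exp C * (1 + Real.log P / Real.log 2) ^ 2 := by
        rw [Real.exp_add, Real.exp_nat_mul, Real.exp_log h3]
    _ ≤ Real.exp C * (2 * P) ^ 2 := by gcongr
    _ = _ := by ring

lemma prod_factorAt_div_eq (R P D ξ : ℝ) (j : Fin 4) (e N : Fin 4 → ℕ) :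
    (∏ i, factorAt (hPrime R ξ) P D j e N i) / (1 + |ξ|) ^ 10 =
      (#(N j).divisors : ℝ) * (∏ i ∈ univ.erase j, |betaSum (e i) P D (N i)|) *
        (hXi R ξ (N j) / (1 + |ξ|) ^ 10) := by
  rw [← mul_prod_erase _ _ (mem_univ j), factorAt_self,
    prod_congr rfl fun i hi => factorAt_of_ne _ P D (mem_erase.1 hi).1 e _]
  ring

/-- The product of the four weights in terms of the truncated divisor sums. -/
lemma prod_weights_eq {m n : ℕ} {R P D : ℝ} {j : Fin 4} {f : Fin 4 → ℕ → ℝ} {e : Fin 4 → ℕ}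
    (hm : m ≡ 4 [MOD 6]) (hn0 : n ≠ 0) (hnm : n < m)
    (hf : ∀ i, ∀ n : ℕ, n ≠ 0 → f i n = if n.Coprime 6 then
      (∏ p ∈ primesLT P, (1 - 1 / (p : ℝ))⁻¹) * betaSum (e i) P D n else 0) :
    ∏ i, (if i = j then HR R (forms m i n) else |f i (forms m i n)|) =
      if n ≡ 5 [MOD 6] then (∏ p ∈ primesLT P, (1 - 1 / (p : ℝ))⁻¹) ^ 3 * Real.log R *
        ∫ ξ : ℝ, (∏ i, factorAt (hPrime R ξ) P D j e (fun i => forms m i n) i) / (1 + |ξ|) ^ 10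
      else 0 := by
  have hL0 := forms_ne_zero hnm hn0
  set V := ∏ p ∈ primesLT P, (1 - 1 / (p : ℝ))⁻¹ with hV
  have hV0 : 0 ≤ V := prod_primesLT_nonneg P
  split_ifs with h5
  · have hcop := coprime_of_modEq_five hnm hm h5
    set B := ∏ i ∈ univ.erase j, |betaSum (e i) P D (forms m i n)| with hB
    have e1 : ∏ i, (if i = j then HR R (forms m i n) else |f i (forms m i n)|) =
        HR R (forms m j n) * (V ^ 3 * B) := by
      rw [← mul_prod_erase _ _ (mem_univ j), if_pos rfl]
      congr 1
      have : ∀ i ∈ univ.erase j, (if i = j then HR R (forms m i n) else |f i (forms m i n)|) =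
          V * |betaSum (e i) P D (forms m i n)| := fun i hi => by
        rw [if_neg (mem_erase.1 hi).1, hf i _ (hL0 i), if_pos (hcop i), abs_mul,
          abs_of_nonneg hV0]
      rw [prod_congr rfl this, prod_mul_distrib, prod_const, card_erase_of_mem (mem_univ j)]
      simp only [card_univ, Fintype.card_fin, hB]
    simp_rw [prod_factorAt_div_eq]
    rw [e1, integral_const_mul, HR]
    ring
  · have hex : ∃ i, i ≠ j ∧ ¬ (forms m i n).Coprime 6 := by
      by_contra hcon
      push Not at hcon
      exact h5 (modEq_five_of_coprime hnm hm j hcon)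
    obtain ⟨i, hij, hi⟩ := hex
    refine prod_eq_zero (mem_univ i) ?_
    rw [if_neg hij, hf i _ (hL0 i), if_neg hi, abs_zero]

/-! ### Parameters and assembly -/

/-- N^ε ≤ P ≤ D ≤ N^(1/100) bounds ε from above, while log log m ≤ log N turns the lower bound on ε
into N^ε ≥ e, so that P ≥ 2 and the Mertens estimates apply. -/
lemma parameter_bounds {m : ℕ} {N ε P D : ℝ} (hm : 10 ≤ m)
    (hε : 1 / Real.log (Real.log m) < ε) (hP : N ^ ε ≤ P) (hPD : P ^ 500 ≤ D)
    (hD : D ≤ N ^ (1 / 100 : ℝ)) (hmN : (m : ℝ) ≤ 7 * N / 4) :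
    5 < N ∧ 0 < ε ∧ ε ≤ 1 ∧ 1 ≤ ε * Real.log N := by
  have hm' : (10 : ℝ) ≤ m := by exact_mod_cast hm
  have hN : 5 < N := by linarith
  have hlm : 1 < Real.log m := by
    rw [Real.lt_log_iff_exp_lt (by linarith)]
    linarith [Real.exp_one_lt_d9]
  have hllm : 0 < Real.log (Real.log m) := Real.log_pos hlm
  have hε0 : 0 < ε := (by positivity : 0 < 1 / Real.log (Real.log m)).trans hε
  have hle : Real.log (Real.log m) ≤ Real.log N := by
    have h1 := Real.log_le_sub_one_of_pos (show 0 < Real.log m by linarith)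
    have h2 : Real.log m ≤ Real.log (7 / 4 * N) :=
      Real.log_le_log (by linarith) (by linarith)
    rw [Real.log_mul (by norm_num) (by linarith)] at h2
    have h3 := Real.log_le_sub_one_of_pos (show (0 : ℝ) < 7 / 4 by norm_num)
    linarith
  refine ⟨hN, hε0, ?_, ?_⟩
  · have hP1 : 1 ≤ P := (Real.one_le_rpow (by linarith) hε0.le).trans hP
    have h1 : N ^ ε ≤ N ^ (1 / 100 : ℝ) :=
      ((hP.trans (le_self_pow₀ hP1 (by norm_num))).trans hPD).trans hD
    have := (Real.rpow_le_rpow_left_iff (show 1 < N by linarith)).1 h1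
    linarith
  · rw [div_lt_iff₀ hllm] at hε
    exact hε.le.trans (mul_le_mul_of_nonneg_left hle hε0.le)

/-- A bound for the sums with fixed `ξ` gives one for the sums weighted by `H_R`. -/
lemma sum_prod_weights_le {m u v : ℕ} {R P D G : ℝ} {j : Fin 4} {f : Fin 4 → ℕ → ℝ}
    {e : Fin 4 → ℕ} (hR : 0 < Real.log R) (hm : m ≡ 4 [MOD 6]) (hvm : v < m)
    (hf : ∀ i, ∀ n : ℕ, n ≠ 0 → f i n = if n.Coprime 6 then
      (∏ p ∈ primesLT P, (1 - 1 / (p : ℝ))⁻¹) * betaSum (e i) P D n else 0)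
    (hG : ∀ ξ : ℝ, ∑ n ∈ Ioc u v with n ≡ 5 [MOD 6],
      ∏ i, factorAt (hPrime R ξ) P D j e (fun i => forms m i n) i ≤ G * (1 + |ξ|) ^ 4) :
    ∑ n ∈ Ioc u v, ∏ i, (if i = j then HR R (forms m i n) else |f i (forms m i n)|) ≤
      (∏ p ∈ primesLT P, (1 - 1 / (p : ℝ))⁻¹) ^ 3 * Real.log R *
        (G * ∫ ξ : ℝ, 1 / (1 + |ξ|) ^ 6) := by
  have hint : ∀ n, Integrable fun ξ : ℝ =>
      (∏ i, factorAt (hPrime R ξ) P D j e (fun i => forms m i n) i) / (1 + |ξ|) ^ 10 := fun n => by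
    simp_rw [prod_factorAt_div_eq]
    exact (integrable_hXi_div hR _).const_mul _
  have hV0 := prod_primesLT_nonneg P
  rw [sum_congr rfl fun n hn => prod_weights_eq hm
    (Nat.pos_iff_ne_zero.1 ((Nat.zero_le u).trans_lt (mem_Ioc.1 hn).1))
    ((mem_Ioc.1 hn).2.trans_lt hvm) hf, ← sum_filter, ← mul_sum,
    ← integral_finsetSum _ fun n _ => hint n, ← integral_const_mul G]
  refine mul_le_mul_of_nonneg_left (integral_mono (integrable_finsetSum _ fun n _ => hint n)
    (integrable_one_add_abs_pow_six.const_mul _) fun ξ => ?_) (by positivity)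
  have hξ : 0 < 1 + |ξ| := by linarith [abs_nonneg ξ]
  dsimp only
  rw [← sum_div, div_le_iff₀ (by positivity)]
  refine (hG ξ).trans (le_of_eq ?_)
  field_simp

/-- The error term of the sieve is negligible. -/
lemma error_term_le {N D l : ℝ} (hN : 5 < N) (hD0 : 0 ≤ D) (hD : D ≤ N ^ (1 / 100 : ℝ))
    (hl : l ≤ Real.log N) : l * (√(2 * N) * D ^ 15) ≤ 200 * N := by
  have hN0 : 0 ≤ N := by linarith
  have h1 : Real.log N ≤ 100 * N ^ (1 / 100 : ℝ) := by
    have := Real.log_le_rpow_div hN0 (show (0 : ℝ) < 1 / 100 by norm_num)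
    linarith
  have h2 : √(2 * N) ≤ 2 * N ^ (1 / 2 : ℝ) := by
    rw [Real.sqrt_mul (by norm_num), ← Real.sqrt_eq_rpow]
    gcongr
    rw [Real.sqrt_le_left (by norm_num)]; norm_num
  have h3 : D ^ 15 ≤ N ^ (15 / 100 : ℝ) := by
    refine (pow_le_pow_left₀ hD0 hD 15).trans (le_of_eq ?_)
    rw [← Real.rpow_mul_natCast hN0]
    norm_num
  calc l * (√(2 * N) * D ^ 15)
      ≤ (100 * N ^ (1 / 100 : ℝ)) * (2 * N ^ (1 / 2 : ℝ) * N ^ (15 / 100 : ℝ)) := by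
        gcongr
        exact hl.trans h1
    -- The total exponent is 0.66, comfortably below 1.
    _ = 200 * N ^ (1 / 100 + (1 / 2 + 15 / 100) : ℝ) := by
        rw [Real.rpow_add (by linarith), Real.rpow_add (by linarith)]
        ring
    _ ≤ 200 * N ^ (1 : ℝ) := by
        gcongr
        · linarith
        · norm_num
    _ = 200 * N := by rw [Real.rpow_one]

/-- The weighted correlation bound, with `H_R` on the `j`-th linear form. -/
lemma exists_sum_prod_weights_le :
    ∃ C : ℝ, 0 < C ∧ ∀ (m : ℕ) (N ε R P D : ℝ) (j : Fin 4) (f : Fin 4 → ℕ → ℝ),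
      10 ≤ m → 1 / Real.log (Real.log m) < ε → N ^ ε ≤ R → R ≤ N → N ^ ε ≤ P → P ≤ N →
      P ^ 500 ≤ D → D ≤ N ^ (1 / 100 : ℝ) → 5 * N / 4 ≤ m → m ≤ 7 * N / 4 → m ≡ 4 [MOD 6] →
      (∀ i, f i = lowerPreSieve P D ∨ f i = upperPreSieve P D) →
      ∑ n ∈ Ioc ⌊N / 2⌋₊ ⌊N⌋₊,
        ∏ i, (if i = j then HR R (forms m i n) else |f i (forms m i n)|) ≤
          C * (ε⁻¹ ^ 10 * N * singularSeries m) := by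
  obtain ⟨C₁, hC₁, hsieve⟩ := exists_sum_prod_factorAt_le
  obtain ⟨C₂, hC₂, hexp⟩ := exists_exp_sum_hPrime_le
  obtain ⟨C₃, hC₃, hinv⟩ := exists_exp_sum_inv_le
  obtain ⟨c, hc, hsing⟩ := exists_le_singularSeries
  set K := ∫ ξ : ℝ, 1 / (1 + |ξ|) ^ 6 with hK
  have hK0 : 0 ≤ K := integral_nonneg fun ξ => by positivity
  refine ⟨K * Real.exp 33 * C₁ * (C₂ * Real.exp 11 + 200 * C₃ ^ 3) / c + 1, by positivity, ?_⟩
  intro m N ε R P D j f hm10 hε hNR hRN hNP hPN hPD hDN hNm hmN hm hf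
  obtain ⟨hN5, hε0, hε1, hεN⟩ := parameter_bounds hm10 hε hNP hPD hDN hmN
  have hN0 : 0 < N := by linarith
  have hNε : 0 < N ^ ε := Real.rpow_pos_of_pos hN0 ε
  have hlog : ∀ x, N ^ ε ≤ x → ε * Real.log N ≤ Real.log x := fun x hx => by
    rw [← Real.log_rpow hN0]
    exact Real.log_le_log hNε hx
  have hlR : 0 < Real.log R := by linarith [hlog R hNR]
  have hlRN : Real.log R ≤ Real.log N := Real.log_le_log (hNε.trans_le hNR) hRN
  have hlP : 0 < Real.log P := by linarith [hlog P hNP]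
  have hlN : 0 < Real.log N := hlR.trans_le hlRN
  have hP2 : 2 ≤ P := by
    have h1 : Real.exp 1 ≤ P := by
      rw [← Real.le_log_iff_exp_le (hNε.trans_le hNP)]
      linarith [hlog P hNP]
    linarith [Real.exp_one_gt_d9]
  have hD0 : 0 ≤ D := (by positivity : (0 : ℝ) ≤ P ^ 500).trans hPD
  have hεinv : 1 ≤ ε⁻¹ := (one_le_inv₀ hε0).2 hε1
  have hvN : (⌊N⌋₊ : ℝ) ≤ N := Nat.floor_le hN0.le
  have hvm : ⌊N⌋₊ < m := by
    have : (⌊N⌋₊ : ℝ) < m := by linarith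
    exact_mod_cast this
  have huv : ⌊N / 2⌋₊ ≤ ⌊N⌋₊ := Nat.floor_le_floor (by linarith)
  choose e he2 hfe using fun i => exists_presieve_eq (hf i)
  set S := ∑ p ∈ sievePrimes P, 1 / (p : ℝ) with hS
  set Δ := ∑ p ∈ sievePrimes P, rootDefect m p / p with hΔ
  have hΔ0 : 0 ≤ Δ := sum_nonneg fun p _ => div_nonneg (rootDefect_nonneg m p) (by positivity)
  have hΔS : Real.exp Δ ≤ singularSeries m / c := by
    rw [le_div_iff₀ hc, mul_comm]
    refine le_trans ?_ (hsing m hm)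
    have := sum_rootDefect_le (show m ≠ 0 by omega) P
    gcongr
  have hS1 : 1 ≤ singularSeries m / c := (Real.one_le_exp hΔ0).trans hΔS
  have hforms : ∀ n ∈ Ioc ⌊N / 2⌋₊ ⌊N⌋₊, (forms m j n : ℝ) ≤ 2 * N := fun n hn => by
    have h1 : (n : ℝ) ≤ N := (Nat.cast_le.2 (mem_Ioc.1 hn).2).trans hvN
    have h2 : N / 2 < n := Nat.lt_of_floor_lt (mem_Ioc.1 hn).1
    have h3 : n ≤ m := (mem_Ioc.1 hn).2.trans hvm.le
    fin_cases j <;> simp [forms, Nat.cast_sub h3] <;> linarith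
  have hε4N : ε * Real.log (4 * N) ≤ 2 * Real.log R := by
    have h1 : Real.log (4 * N) ≤ Real.log (N * N) :=
      Real.log_le_log (by linarith) (by nlinarith)
    rw [Real.log_mul hN0.ne' hN0.ne'] at h1
    have := mul_le_mul_of_nonneg_left h1 hε0.le
    linarith [hlog R hNR]
  set G := C₁ * N * Real.exp (-4 * S + Δ) * (C₂ * ε⁻¹ ^ 4) + C₁ * (√(2 * N) * D ^ 14) with hG
  have hpoint : ∀ ξ : ℝ, ∑ n ∈ Ioc ⌊N / 2⌋₊ ⌊N⌋₊ with n ≡ 5 [MOD 6],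
      ∏ i, factorAt (hPrime R ξ) P D j e (fun i => forms m i n) i ≤ G * (1 + |ξ|) ^ 4 := by
    intro ξ
    have hξ : 1 ≤ (1 + |ξ|) ^ 4 := one_le_pow₀ (by linarith [abs_nonneg ξ])
    -- All four forms are at most Y = 2N on the range of n; X = 4N is a convenient bound strictly
    -- above Y.
    refine (hsieve P D (4 * N) (2 * N) j e (forms m) (formRoots m) (hPrime R ξ) (rootDefect m) _ _
      hP2 hPD he2 (by linarith) (by linarith) (by linarith) (hPrime_nonneg hlR ξ)
      (hPrime_le_one R ξ) huv (fun n hn h5 => ⟨?_, hforms n hn, fun i p _ => ?_⟩)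
      (rootDefect_nonneg m) (fun p hp => ?_)).trans ?_
    · exact coprime_of_modEq_five ((mem_Ioc.1 hn).2.trans_lt hvm) hm h5 j
    · exact modEq_formRoots_iff ((mem_Ioc.1 hn).2.trans hvm.le) i p
    · exact four_sub_rootDefect_le (mem_sievePrimes.1 hp).1 (mem_sievePrimes.1 hp).2.1
    · rw [Real.exp_add, hG, add_mul]
      have h1 := hexp (4 * N) R ε ξ (by linarith) hε0 hε1 hlR hε4N
      have h2 : (⌊N⌋₊ : ℝ) - ⌊N / 2⌋₊ ≤ N := by linarith [(Nat.cast_nonneg ⌊N / 2⌋₊ : (0 : ℝ) ≤ _)]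
      refine add_le_add ?_ (le_mul_of_one_le_right (by positivity) hξ)
      calc C₁ * ((⌊N⌋₊ : ℝ) - ⌊N / 2⌋₊) * (Real.exp (-4 * S + Δ) *
            Real.exp (2 * ∑ p ∈ sievePrimes (4 * N), hPrime R ξ p / p))
          ≤ C₁ * N * (Real.exp (-4 * S + Δ) * (C₂ * (ε⁻¹ ^ 4 * (1 + |ξ|) ^ 4))) := by gcongr
        _ = _ := by ring
  refine (sum_prod_weights_le hlR hm hvm hfe hpoint).trans ?_
  rw [← hK]
  have hG0 : 0 ≤ G := by positivity
  have hV : (∏ p ∈ primesLT P, (1 - 1 / (p : ℝ))⁻¹) ^ 3 ≤ Real.exp 33 * Real.exp S ^ 3 := by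
    refine (pow_le_pow_left₀ (prod_primesLT_nonneg P) (prod_primesLT_le_exp P) 3).trans
      (le_of_eq ?_)
    rw [← Real.exp_nat_mul, ← Real.exp_nat_mul, ← Real.exp_add]
    congr 1
    push_cast
    ring
  -- Mertens gives exp(-S) ≪ 1/log P, and log R ≤ log N ≤ ε⁻¹ log P.
  have hmain : Real.log R * Real.exp (-S) ≤ Real.exp 11 * ε⁻¹ := by
    have h1 : Real.exp (-S) * Real.log P ≤ Real.exp 11 := by
      rw [← Real.exp_log hlP, ← Real.exp_add, Real.exp_le_exp]
      have := log_log_le_sum_sievePrimes hP2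
      linarith
    have h2 : Real.log R ≤ ε⁻¹ * Real.log P := by
      have := mul_le_mul_of_nonneg_left (hlog P hNP) (inv_nonneg.2 hε0.le)
      rw [inv_mul_cancel_left₀ hε0.ne'] at this
      linarith
    calc Real.log R * Real.exp (-S) ≤ ε⁻¹ * Real.log P * Real.exp (-S) := by gcongr
      _ = Real.exp (-S) * Real.log P * ε⁻¹ := by ring
      _ ≤ _ := by gcongr
  have herr : Real.log R * (√(2 * N) * D ^ 14) * Real.exp S ^ 3 ≤ C₃ ^ 3 * (200 * N) := by
    -- The normalising factors cost at most a constant times P^6 ≤ D, raising D^14 to the D^15 of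
    -- `error_term_le`.
    have h1 : Real.exp S ^ 3 ≤ C₃ ^ 3 * D := by
      calc Real.exp S ^ 3 ≤ (C₃ * P ^ 2) ^ 3 := by gcongr; exact hinv P hP2
        _ = C₃ ^ 3 * P ^ 6 := by ring
        _ ≤ C₃ ^ 3 * D := by
          gcongr
          exact (pow_le_pow_right₀ (by linarith) (by norm_num)).trans hPD
    calc Real.log R * (√(2 * N) * D ^ 14) * Real.exp S ^ 3
        ≤ Real.log R * (√(2 * N) * D ^ 14) * (C₃ ^ 3 * D) := by gcongr
      _ = C₃ ^ 3 * (Real.log R * (√(2 * N) * D ^ 15)) := by ring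
      _ ≤ _ := mul_le_mul_of_nonneg_left (error_term_le hN5 hD0 hDN hlRN) (by positivity)
  -- Three normalisations against four sifted dimensions leave one factor exp(-S), which cancels log
  -- R up to ε⁻¹.
  have hsplit : Real.exp S ^ 3 * Real.exp (-4 * S + Δ) = Real.exp (-S) * Real.exp Δ := by
    rw [← Real.exp_nat_mul, ← Real.exp_add, ← Real.exp_add]
    congr 1
    push_cast
    ring
  have hε10 : ε⁻¹ * ε⁻¹ ^ 4 ≤ ε⁻¹ ^ 10 := by
    rw [← pow_succ']
    exact pow_le_pow_right₀ hεinv (by norm_num)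
  have hε10' : 1 ≤ ε⁻¹ ^ 10 := one_le_pow₀ hεinv
  set T := singularSeries m / c with hT
  have hT0 : 0 ≤ T := zero_le_one.trans hS1
  calc (∏ p ∈ primesLT P, (1 - 1 / (p : ℝ))⁻¹) ^ 3 * Real.log R * (G * K)
      ≤ Real.exp 33 * Real.exp S ^ 3 * Real.log R * (G * K) := by gcongr
    _ = K * Real.exp 33 * C₁ * (C₂ * N * ε⁻¹ ^ 4 * (Real.log R *
          (Real.exp S ^ 3 * Real.exp (-4 * S + Δ))) +
          Real.log R * (√(2 * N) * D ^ 14) * Real.exp S ^ 3) := by rw [hG]; ring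
    _ = K * Real.exp 33 * C₁ * (C₂ * N * ε⁻¹ ^ 4 * ((Real.log R * Real.exp (-S)) * Real.exp Δ) +
          Real.log R * (√(2 * N) * D ^ 14) * Real.exp S ^ 3) := by rw [hsplit]; ring
    _ ≤ K * Real.exp 33 * C₁ * (C₂ * N * ε⁻¹ ^ 4 * ((Real.exp 11 * ε⁻¹) * T) +
          C₃ ^ 3 * (200 * N)) := by gcongr
    _ = K * Real.exp 33 * C₁ * (C₂ * Real.exp 11 * (N * (ε⁻¹ * ε⁻¹ ^ 4) * T) +
          200 * C₃ ^ 3 * (N * 1 * 1)) := by ring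
    _ ≤ K * Real.exp 33 * C₁ * (C₂ * Real.exp 11 * (N * ε⁻¹ ^ 10 * T) +
          200 * C₃ ^ 3 * (N * ε⁻¹ ^ 10 * T)) := by gcongr
    _ = K * Real.exp 33 * C₁ * (C₂ * Real.exp 11 + 200 * C₃ ^ 3) / c *
          (ε⁻¹ ^ 10 * N * singularSeries m) := by rw [hT]; ring
    _ ≤ _ := by
      have : 0 ≤ singularSeries m := by
        rw [hT, le_div_iff₀ hc] at hS1
        linarith
      gcongr
      linarith

end ChenGoldbach

theorem proposition6p6 :
    ∃ C : ℝ, 0 < C ∧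
      ∀ (m : ℕ) (N ε R P₁ D₁ : ℝ) (f₁ f₂ f₃ : ℕ → ℝ),
        10 ≤ m → 1 / Real.log (Real.log m) < ε →
        N ^ ε ≤ R → R ≤ N → N ^ ε ≤ P₁ → P₁ ≤ N →
        P₁ ^ 500 ≤ D₁ → D₁ ≤ N ^ (1 / 100 : ℝ) →
        5 * N / 4 ≤ m → m ≤ 7 * N / 4 → m ≡ 4 [MOD 6] →
        (f₁ = ChenGoldbach.lowerPreSieve P₁ D₁ ∨ f₁ = ChenGoldbach.upperPreSieve P₁ D₁) →
        (f₂ = ChenGoldbach.lowerPreSieve P₁ D₁ ∨ f₂ = ChenGoldbach.upperPreSieve P₁ D₁) →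
        (f₃ = ChenGoldbach.lowerPreSieve P₁ D₁ ∨ f₃ = ChenGoldbach.upperPreSieve P₁ D₁) →
        ChenGoldbach.correlation N m (ChenGoldbach.HR R) (|f₁ ·|) (|f₂ ·|) (|f₃ ·|)
            ≤ C * (ε⁻¹ ^ 10 * N * ChenGoldbach.singularSeries m) ∧
        ChenGoldbach.correlation N m (|f₁ ·|) (ChenGoldbach.HR R) (|f₂ ·|) (|f₃ ·|)
            ≤ C * (ε⁻¹ ^ 10 * N * ChenGoldbach.singularSeries m) ∧
        ChenGoldbach.correlation N m (|f₂ ·|) (|f₁ ·|) (ChenGoldbach.HR R) (|f₃ ·|)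
            ≤ C * (ε⁻¹ ^ 10 * N * ChenGoldbach.singularSeries m) ∧
        ChenGoldbach.correlation N m (|f₃ ·|) (|f₁ ·|) (|f₂ ·|) (ChenGoldbach.HR R)
            ≤ C * (ε⁻¹ ^ 10 * N * ChenGoldbach.singularSeries m) := by
  obtain ⟨C, hC, h⟩ := ChenGoldbach.exists_sum_prod_weights_le
  refine ⟨C, hC, fun m N ε R P₁ D₁ f₁ f₂ f₃ hm hε hR hRN hP hPN hPD hD hNm hmN h4 h₁ h₂ h₃ => ?_⟩
  have key := fun (j : Fin 4) (f : Fin 4 → ℕ → ℝ) =>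
    h m N ε R P₁ D₁ j f hm hε hR hRN hP hPN hPD hD hNm hmN h4
  -- The entry in the slot carrying H_R is never evaluated; f₁ fills it only to satisfy the
  -- pre-sieve hypothesis.
  have k0 := key 0 ![f₁, f₁, f₂, f₃] (by simp [Fin.forall_fin_succ, h₁, h₂, h₃])
  have k1 := key 1 ![f₁, f₁, f₂, f₃] (by simp [Fin.forall_fin_succ, h₁, h₂, h₃])
  have k2 := key 2 ![f₂, f₁, f₁, f₃] (by simp [Fin.forall_fin_succ, h₁, h₂, h₃])
  have k3 := key 3 ![f₃, f₁, f₂, f₁] (by simp [Fin.forall_fin_succ, h₁, h₂, h₃])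
  simp only [Fin.prod_univ_four, ChenGoldbach.forms] at k0 k1 k2 k3
  exact ⟨k0, k1, k2, k3⟩
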